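/- Let $1<\gamma\le 2$, $p(\rho)=\bigl(1-\tfrac1\gamma\bigr)\rho^\gamma$ and $f(\rho)=\rho\int_0^\rho \frac{p(s)}{s^2}\,ds=\tfrac1\gamma\rho^\gamma$. Let $T>0$ and let $(\rho,J)\in C^\infty([0,T]\times\mathbb R^2)$, with values in $\mathbb R\times\mathbb R^2$ and $\rho>0$, solve the quantum hydrodynamic system $$\partial_t\rho+\operatorname{div}J=0,\qquad \partial_tJ+\operatorname{div}\Bigl(\frac{J\otimes J}{\rho}\Bigr)+\nabla p(\rho)=\frac12\,\rho\,\nabla\Bigl(\frac{\Delta\sqrt\rho}{\sqrt\rho}\Bigr)$$ on $[0,T]\times\mathbb R^2$. Put $\Lambda=J/\sqrt\rho$, and assume that $\nabla\wedge J=2\,\nabla\sqrt\rho\wedge\Lambda$ (equivalently, the velocity $J/\rho$ is irrotational) and that the mass $M(t)=\int_{\mathbb R^2}\rho\,dx$ and the energy $E(t)=\int_{\mathbb R^2}\frac12|\nabla\sqrt\rho|^2+\frac12|\Lambda|^2+f(\rho)\,dx$ are bounded on $[0,T]$. Define $$\lambda=-\frac12\Delta\sqrt\rho+\frac12\frac{|\Lambda|^2}{\sqrt\rho}+f'(\rho)\sqrt\rho,\qquad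 I(t)=\int_{\mathbb R^2}\lambda^2+(\partial_t\sqrt\rho)^2\,dx\in[0,\infty].$$ Then $$I(t)\le C(T)\,I(0)\qquad\text{for all }t\in[0,T],$$ where the constant $C(T)$ depends only on $T$, $\gamma$ and upper bounds for the mass $M(0)$ and the energy $E(0)$. (If $I(0)=\infty$ nothing is claimed; if $I(0)<\infty$, then in particular $I(t)<\infty$.) -/

import Mathlib

open Set MeasureTheory
open scoped ContDiff NNReal ENNReal

noncomputable section

namespace QHD

/-- The Euclidean plane. -/
abbrev Plane : Type := EuclideanSpace ℝ (Fin 2)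

/-- The spatial partial derivative `∂ᵢ f`. -/
def pd (i : Fin 2) (f : Plane → ℝ) (x : Plane) : ℝ :=
  fderiv ℝ f x (EuclideanSpace.single i 1)

/-- The divergence of a vector field. -/
def div (F : Plane → Plane) (x : Plane) : ℝ :=
  ∑ i : Fin 2, pd i (fun y => F y i) x

/-- The (row-wise) divergence of a matrix field: the `i`-th component is `∑ⱼ ∂ⱼ Aᵢⱼ`. -/
def tensorDiv (A : Plane → Matrix (Fin 2) (Fin 2) ℝ) (x : Plane) : Plane :=
  WithLp.toLp 2 (fun i : Fin 2 => ∑ j : Fin 2, pd j (fun y => A y i j) x)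

/-- The scalar curl `∂₁ F₂ - ∂₂ F₁` of a planar vector field. -/
def curl (F : Plane → Plane) (x : Plane) : ℝ :=
  pd 0 (fun y => F y 1) x - pd 1 (fun y => F y 0) x

/-- The scalar wedge product of two planar vectors. -/
def wedge (a b : Plane) : ℝ := a 0 * b 1 - a 1 * b 0

/-- The pressure law `p(r) = (1 - 1/γ) r^γ`. -/
def pressure (γ r : ℝ) : ℝ := (1 - 1 / γ) * r ^ γ

/-- The internal energy density `f(r) = r ∫₀ʳ p(s)/s² ds`. -/
def internalEnergy (γ r : ℝ) : ℝ := r * ∫ s in (0 : ℝ)..r, pressure γ s / s ^ 2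

theorem internalEnergy_eq {γ r : ℝ} (hγ : 1 < γ) (hr : 0 < r) :
    internalEnergy γ r = r ^ γ / γ := by
  have h : ∫ s in (0 : ℝ)..r, pressure γ s / s ^ 2
      = ∫ s in (0 : ℝ)..r, (1 - 1 / γ) * s ^ (γ - 2) := by
    refine intervalIntegral.integral_congr_ae (Filter.Eventually.of_forall fun s hs => ?_)
    rw [Set.uIoc_of_le hr.le] at hs
    simp only [pressure]
    rw [Real.rpow_sub hs.1, Real.rpow_two, mul_div_assoc]
  have h1 : γ - 2 + 1 ≠ 0 := by linarith
  rw [internalEnergy, h, intervalIntegral.integral_const_mul,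
    integral_rpow (Or.inl (by linarith)), Real.zero_rpow h1]
  have h2 : γ - 2 + 1 = γ - 1 := by ring
  rw [h2, Real.rpow_sub hr, Real.rpow_one]
  have h3 : γ - 1 ≠ 0 := by linarith
  have h4 : γ ≠ 0 := by linarith
  have h5 : r ≠ 0 := hr.ne'
  field_simp
  ring

section Functionals

variable (γ T : ℝ) (ρ : ℝ → Plane → ℝ) (J : ℝ → Plane → Plane)

/-- `√ρ`. -/
def sqrtDensity (t : ℝ) (x : Plane) : ℝ := √(ρ t x)

/-- `Λ = J / √ρ`, for positive densities. -/
def Lam (t : ℝ) (x : Plane) : Plane := (sqrtDensity ρ t x)⁻¹ • J t x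

/-- The total mass `M(t) = ∫ ρ dx`, with value `∞` allowed. -/
def mass (t : ℝ) : ℝ≥0∞ := ∫⁻ x, ENNReal.ofReal (ρ t x)

/-- The energy density `e = ½|∇√ρ|² + ½|Λ|² + f(ρ)`; here `|Λ|² = |J|²/ρ`. -/
def energyDensity (t : ℝ) (x : Plane) : ℝ :=
  1 / 2 * ‖gradient (sqrtDensity ρ t) x‖ ^ 2 + 1 / 2 * ‖Lam ρ J t x‖ ^ 2
    + internalEnergy γ (ρ t x)

/-- The total energy `E(t) = ∫ e dx`, with value `∞` allowed. -/
def energy (t : ℝ) : ℝ≥0∞ := ∫⁻ x, ENNReal.ofReal (energyDensity γ ρ J t x)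

/-- `λ = -½ Δ√ρ + ½ |Λ|²/√ρ + f'(ρ) √ρ`, for positive densities. -/
def lam (t : ℝ) (x : Plane) : ℝ :=
  -(1 / 2) * Laplacian.laplacian (sqrtDensity ρ t) x
    + 1 / 2 * (‖Lam ρ J t x‖ ^ 2 / sqrtDensity ρ t x)
    + deriv (internalEnergy γ) (ρ t x) * sqrtDensity ρ t x

/-- `∂ₜ√ρ` on the time interval `[0, T]` (one-sided at the end points). -/
def dtSqrtDensity (t : ℝ) (x : Plane) : ℝ :=
  derivWithin (fun s => sqrtDensity ρ s x) (Icc 0 T) t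

/-- The functional `I(t) = ∫ λ² + (∂ₜ√ρ)² dx`, with value `∞` allowed. -/
def functionalI (t : ℝ) : ℝ≥0∞ :=
  ∫⁻ x, ENNReal.ofReal (lam γ ρ J t x ^ 2 + dtSqrtDensity T ρ t x ^ 2)

/-- `(ρ, J)` is a smooth solution with positive density, finite mass and finite energy of the
quantum hydrodynamic system on `[0, T] × ℝ²`. Time derivatives are one-sided at `0` and `T`. -/
structure IsSmoothSolution : Prop where
  smooth_density : ContDiffOn ℝ ∞ (fun z : ℝ × Plane => ρ z.1 z.2) (Icc 0 T ×ˢ univ)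
  smooth_momentum : ContDiffOn ℝ ∞ (fun z : ℝ × Plane => J z.1 z.2) (Icc 0 T ×ˢ univ)
  density_pos : ∀ t ∈ Icc 0 T, ∀ x, 0 < ρ t x
  /-- `∂ₜρ + div J = 0`. -/
  continuity_eq : ∀ t ∈ Icc 0 T, ∀ x,
    derivWithin (fun s => ρ s x) (Icc 0 T) t + div (J t) x = 0
  /-- `∂ₜJ + div (J ⊗ J / ρ) + ∇p(ρ) = ½ ρ ∇(Δ√ρ / √ρ)`. -/
  momentum_eq : ∀ t ∈ Icc 0 T, ∀ x,
    derivWithin (fun s => J s x) (Icc 0 T) t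
        + tensorDiv (fun y => Matrix.of fun i j => J t y i * J t y j / ρ t y) x
        + gradient (fun y => pressure γ (ρ t y)) x
      = (1 / 2 * ρ t x) •
          gradient (fun y => Laplacian.laplacian (sqrtDensity ρ t) y / sqrtDensity ρ t y) x
  /-- `∇ ∧ J = 2 ∇√ρ ∧ Λ`, that is, the velocity `J / ρ` is irrotational. -/
  irrotational : ∀ t ∈ Icc 0 T, ∀ x,
    curl (J t) x = 2 * wedge (gradient (sqrtDensity ρ t) x) (Lam ρ J t x)
  /-- Finite mass and energy: `√ρ ∈ L^∞(0, T; H¹)` and `Λ ∈ L^∞(0, T; L²)`. -/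
  finite_mass_energy : ∃ K : ℝ≥0, ∀ t ∈ Icc 0 T, mass ρ t ≤ K ∧ energy γ ρ J t ≤ K

end Functionals

end QHD

end

open Set MeasureTheory
open scoped ContDiff NNReal ENNReal

noncomputable section

namespace QHD

open Filter Topology Function
open scoped ComplexConjugate

/-! The Madelung transform turns the system into a nonlinear Schrödinger equation. Continuity,
momentum balance and irrotationality together say that the one-form on [0,T] × ℝ² with time
coefficient -λ/√ρ (`pot`) and space coefficients J/ρ is closed. The slab is convex, so this form is
dθ, and ψ = √ρ e^{iθ} solves ∂ₜψ = (i/2)Δψ - i|ψ|^{2γ-2}ψ (`Hydro.exists_wave`). Since |∂ₜψ|² =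
(∂ₜ√ρ)² + λ², the functional I(t) is the squared L² norm of ∂ₜψ(t)
(`IsSmoothSolution.functionalI_density`). What remains is to propagate that norm for finite-energy
solutions.

Time increments of ψ are estimated rather than ∂ₜψ itself. The difference u of two solutions ψ, φ
obeys a Schrödinger equation whose nonlinear term is at most 4(1 + W)|u| with W = |ψ|² + |φ|²,
because 2γ-2 ≤ 2. In the plane H¹ does not embed in L^∞, but the supremum of |ψ|² over x₂ is
integrable in x₁. A matching smoothing estimate uses dispersive decay in x₁ only and L² boundedness
in x₂, at the price |t-s|^{-1/2} (`norm_integral_kern_le`). This singularity is integrable, so T T*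
and a Schur test in time bound ∫∫ W|u|² with a gain √τ on an interval of length τ
(`Schro.weighted_le`). The L² identity then closes for τ small in terms of the H¹ bound alone
(`Schro.short_time_bound`). The propagator is taken at complex times ε + i(t-s), where its kernel is
Gaussian and all integrals converge absolutely; the final bounds do not contain ε, and ε → 0 at the
end.

Iterating over short intervals gives ‖ψ(t+η) - ψ(t)‖ ≤ C‖ψ(η) - ψ(0)‖ on [0,T]. Comparing ψ with its
frozen initial value gives ‖ψ(η) - ψ(0)‖ ≤ 4η‖∂ₜψ(0)‖. Dividing by η and applying Fatou's lemma
yields the bound (`exists_time_deriv_bound`), with a constant depending on the supremum of the H¹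
norm. Conservation of mass and energy replaces that supremum by the initial data; since the energy
flux contains ∂ₜψ, the estimate is run twice, first only to make the energy law legitimate
(`exists_nls_bound`). -/

/-! ### Cutoff functions -/

/-- A fixed bump function on the line. -/
def bump : ContDiffBump (0 : ℝ) := ⟨1, 2, one_pos, one_lt_two⟩

/-- The bump function at scale `n + 1`. -/
def cut (n : ℕ) (r : ℝ) : ℝ := bump (r / (n + 1))

/-- The derivative of `cut`. -/
def cutDeriv (n : ℕ) (r : ℝ) : ℝ := deriv bump (r / (n + 1)) / (n + 1)

/-- A product cutoff on the plane. -/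
def cutoff (n : ℕ) (x : ℝ × ℝ) : ℝ := cut n x.1 * cut n x.2

theorem bump_contDiff : ContDiff ℝ 1 bump := bump.contDiff

theorem cut_continuous (n : ℕ) : Continuous (cut n) :=
  bump.continuous.comp (continuous_id.div_const _)

theorem cutDeriv_continuous (n : ℕ) : Continuous (cutDeriv n) :=
  ((bump_contDiff.continuous_deriv le_rfl).comp (continuous_id.div_const _)).div_const _

theorem cut_nonneg (n : ℕ) (r : ℝ) : 0 ≤ cut n r := bump.nonneg

theorem cut_le_one (n : ℕ) (r : ℝ) : cut n r ≤ 1 := bump.le_one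

theorem cut_hasDerivAt (n : ℕ) (r : ℝ) : HasDerivAt (cut n) (cutDeriv n r) r := by
  have h1 : HasDerivAt bump (deriv bump (r / (n + 1))) (r / (n + 1)) :=
    (bump_contDiff.differentiable one_ne_zero _).hasDerivAt
  have h2 : HasDerivAt (fun r : ℝ => r / ((n : ℝ) + 1)) (1 / ((n : ℝ) + 1)) r :=
    (hasDerivAt_id r).div_const _
  have := h1.comp r h2
  rw [mul_one_div] at this
  exact this

theorem cut_eq_zero {n : ℕ} {r : ℝ} (h : 2 * ((n : ℝ) + 1) ≤ |r|) : cut n r = 0 := by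
  apply bump.zero_of_le_dist
  have : (0 : ℝ) < n + 1 := by positivity
  rw [Real.dist_eq, sub_zero, abs_div, abs_of_pos this, le_div_iff₀ this]
  exact h

theorem cut_eq_one {n : ℕ} {r : ℝ} (h : |r| ≤ (n : ℝ) + 1) : cut n r = 1 := by
  apply bump.one_of_mem_closedBall
  have : (0 : ℝ) < n + 1 := by positivity
  rw [Metric.mem_closedBall, Real.dist_eq, sub_zero, abs_div, abs_of_pos this, div_le_iff₀ this]
  simpa [bump] using h

theorem cutDeriv_eq_zero {n : ℕ} {r : ℝ} (h : 2 * ((n : ℝ) + 1) < |r|) : cutDeriv n r = 0 := by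
  have h1 : cut n =ᶠ[𝓝 r] fun _ => 0 := by
    filter_upwards [(isOpen_lt continuous_const continuous_abs).mem_nhds h] with y hy
    exact cut_eq_zero (le_of_lt hy)
  rw [← (cut_hasDerivAt n r).deriv, h1.deriv_eq, deriv_const]

theorem exists_cutDeriv_bound : ∃ C : ℝ, 0 ≤ C ∧ ∀ n r, |cutDeriv n r| ≤ C / (n + 1) := by
  have hc : Continuous (deriv bump) := bump_contDiff.continuous_deriv le_rfl
  have hs : HasCompactSupport (deriv bump) := bump.hasCompactSupport.deriv
  obtain ⟨C, hC⟩ := hs.exists_bound_of_continuous hc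
  refine ⟨C, (norm_nonneg _).trans (hC 0), fun n r => ?_⟩
  have : (0 : ℝ) < n + 1 := by positivity
  rw [cutDeriv, abs_div, abs_of_pos this]
  gcongr
  exact hC _

theorem cutoff_continuous (n : ℕ) : Continuous (cutoff n) :=
  ((cut_continuous n).comp continuous_fst).mul ((cut_continuous n).comp continuous_snd)

theorem cutoff_nonneg (n : ℕ) (x : ℝ × ℝ) : 0 ≤ cutoff n x :=
  mul_nonneg (cut_nonneg _ _) (cut_nonneg _ _)

theorem cutoff_le_one (n : ℕ) (x : ℝ × ℝ) : cutoff n x ≤ 1 :=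
  mul_le_one₀ (cut_le_one _ _) (cut_nonneg _ _) (cut_le_one _ _)

theorem cutoff_tendsto (x : ℝ × ℝ) : Tendsto (fun n => cutoff n x) atTop (𝓝 1) := by
  apply tendsto_const_nhds.congr'
  obtain ⟨N, hN⟩ := exists_nat_ge (max |x.1| |x.2|)
  filter_upwards [eventually_ge_atTop N] with n hn
  have : (N : ℝ) ≤ n := by exact_mod_cast hn
  rw [cutoff, cut_eq_one, cut_eq_one, mul_one]
  · linarith [le_max_right |x.1| |x.2|]
  · linarith [le_max_left |x.1| |x.2|]

/-- The square outside of which `cutoff n` and its derivatives vanish. -/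
def cutBox (n : ℕ) : Set (ℝ × ℝ) :=
  Icc (-(2 * ((n : ℝ) + 1))) (2 * (n + 1)) ×ˢ Icc (-(2 * ((n : ℝ) + 1))) (2 * (n + 1))

theorem cutBox_isCompact (n : ℕ) : IsCompact (cutBox n) := isCompact_Icc.prod isCompact_Icc

theorem abs_gt_of_notMem_cutBox {n : ℕ} {x : ℝ × ℝ} (hx : x ∉ cutBox n) :
    2 * ((n : ℝ) + 1) < |x.1| ∨ 2 * ((n : ℝ) + 1) < |x.2| := by
  by_contra! h
  exact hx ⟨abs_le.1 h.1, abs_le.1 h.2⟩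

theorem cutoff_eq_zero {n : ℕ} {x : ℝ × ℝ} (hx : x ∉ cutBox n) : cutoff n x = 0 := by
  rcases abs_gt_of_notMem_cutBox hx with h | h <;> simp [cutoff, cut_eq_zero h.le]

/-! ### Integration of functions supported over a compact set, and integrals of derivatives. -/

theorem integrable_of_eq_zero_off_compact {f : ℝ × ℝ → ℂ} (hf : Continuous f)
    {k : Set (ℝ × ℝ)} (hk : IsCompact k) (h0 : ∀ x, x ∉ k → f x = 0) : Integrable f :=
  hf.integrable_of_hasCompactSupport (HasCompactSupport.intro hk h0)

theorem integrable_prod_of_eq_zero_off_compact {f : ℝ × ℝ × ℝ → ℂ} (hf : Continuous f)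
    {k : Set (ℝ × ℝ)} (hk : IsCompact k) (h0 : ∀ s x, x ∉ k → f (s, x) = 0) (a b : ℝ) :
    Integrable f ((volume.restrict (Ioc a b)).prod volume) := by
  have h1 : IntegrableOn f (Icc a b ×ˢ k) (volume.prod volume) :=
    hf.continuousOn.integrableOn_compact (isCompact_Icc.prod hk)
  have h2 : IntegrableOn f (Ioc a b ×ˢ k) (volume.prod volume) :=
    h1.mono_set (prod_mono Ioc_subset_Icc_self le_rfl)
  have h3 : IntegrableOn f (Ioc a b ×ˢ univ) (volume.prod volume) := by
    refine h2.of_forall_sdiff_eq_zero (measurableSet_Ioc.prod MeasurableSet.univ) ?_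
    rintro ⟨s, x⟩ ⟨hx1, hx2⟩
    exact h0 s x fun hk => hx2 ⟨hx1.1, hk⟩
  rwa [IntegrableOn, ← Measure.prod_restrict, Measure.restrict_univ] at h3

/-- On almost every line both `g` and its derivative are integrable, which already forces the
integral of the derivative to vanish; Fubini concludes. No decay beyond integrability is required.
-/
theorem integral_deriv_fst_eq_zero {g g' : ℝ × ℝ → ℂ} (hg : Integrable g) (hg' : Integrable g')
    (h : ∀ a b, HasDerivAt (fun a => g (a, b)) (g' (a, b)) a) : ∫ x, g' x = 0 := by
  rw [Measure.volume_eq_prod] at hg hg' ⊢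
  rw [integral_prod_symm _ hg']
  refine integral_eq_zero_of_ae ?_
  filter_upwards [hg.prod_left_ae, hg'.prod_left_ae] with b h1 h2
  exact integral_eq_zero_of_hasDerivAt_of_integrable (fun a => h a b) h2 h1

theorem integral_deriv_snd_eq_zero {g g' : ℝ × ℝ → ℂ} (hg : Integrable g) (hg' : Integrable g')
    (h : ∀ a b, HasDerivAt (fun b => g (a, b)) (g' (a, b)) b) : ∫ x, g' x = 0 := by
  rw [Measure.volume_eq_prod] at hg hg' ⊢
  rw [integral_prod _ hg']
  refine integral_eq_zero_of_ae ?_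
  filter_upwards [hg.prod_right_ae, hg'.prod_right_ae] with a h1 h2
  exact integral_eq_zero_of_hasDerivAt_of_integrable (fun b => h a b) h2 h1

/-! ### Balance laws -/

theorem continuous_slice {q : ℝ → ℝ × ℝ → ℂ} (hq : Continuous (uncurry q)) (t : ℝ) :
    Continuous (q t) := hq.comp (by fun_prop : Continuous fun x : ℝ × ℝ => (t, x))

theorem continuous_time {q : ℝ → ℝ × ℝ → ℂ} (hq : Continuous (uncurry q)) (x : ℝ × ℝ) :
    Continuous (fun t => q t x) := hq.comp (by fun_prop : Continuous fun t : ℝ => (t, x))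

theorem norm_cutoff_mul_le (n : ℕ) (x : ℝ × ℝ) (z : ℂ) : ‖(cutoff n x : ℂ) * z‖ ≤ ‖z‖ := by
  rw [norm_mul, Complex.norm_real, Real.norm_eq_abs, abs_of_nonneg (cutoff_nonneg n x)]
  exact mul_le_of_le_one_left (norm_nonneg _) (cutoff_le_one n x)

theorem integral_cutoff_tendsto {f : ℝ × ℝ → ℂ} (hf : Integrable f) :
    Tendsto (fun n => ∫ x, (cutoff n x : ℂ) * f x) atTop (𝓝 (∫ x, f x)) := by
  refine tendsto_integral_of_dominated_convergence (fun x => ‖f x‖) (fun n => ?_) hf.norm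
    (fun n => Eventually.of_forall fun x => norm_cutoff_mul_le n x _)
    (Eventually.of_forall fun x => ?_)
  · exact (Complex.continuous_ofReal.comp (cutoff_continuous n)).aestronglyMeasurable.mul
      hf.aestronglyMeasurable
  · have := ((Complex.continuous_ofReal.tendsto _).comp (cutoff_tendsto x)).mul_const (f x)
    simpa using this

/-- The flux through the cutoff in the first variable. -/
theorem integral_cutoff_deriv_fst {P P' : ℝ × ℝ → ℂ} (hP : Continuous P) (hP' : Continuous P')
    (h : ∀ a b, HasDerivAt (fun a => P (a, b)) (P' (a, b)) a) (n : ℕ) :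
    ∫ x, (cutoff n x : ℂ) * P' x
      = -∫ x : ℝ × ℝ, ((cutDeriv n x.1 * cut n x.2 : ℝ) : ℂ) * P x := by
  have c1 : Continuous fun x : ℝ × ℝ => (cutoff n x : ℂ) * P' x :=
    (Complex.continuous_ofReal.comp (cutoff_continuous n)).mul hP'
  have c2 : Continuous fun x : ℝ × ℝ => ((cutDeriv n x.1 * cut n x.2 : ℝ) : ℂ) * P x :=
    (Complex.continuous_ofReal.comp (((cutDeriv_continuous n).comp continuous_fst).mul
      ((cut_continuous n).comp continuous_snd))).mul hP
  have c0 : Continuous fun x : ℝ × ℝ => (cutoff n x : ℂ) * P x :=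
    (Complex.continuous_ofReal.comp (cutoff_continuous n)).mul hP
  have i1 := integrable_of_eq_zero_off_compact c1 (cutBox_isCompact n)
    (fun x hx => by simp [cutoff_eq_zero hx])
  have i0 := integrable_of_eq_zero_off_compact c0 (cutBox_isCompact n)
    (fun x hx => by simp [cutoff_eq_zero hx])
  have i2 := integrable_of_eq_zero_off_compact c2 (cutBox_isCompact n) (fun x hx => by
    rcases abs_gt_of_notMem_cutBox hx with h | h
    · simp [cutDeriv_eq_zero h]
    · simp [cut_eq_zero h.le])
  rw [eq_neg_iff_add_eq_zero, add_comm, ← integral_add i2 i1]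
  refine integral_deriv_fst_eq_zero i0 (i2.add i1) fun a b => ?_
  have h1 : HasDerivAt (fun a => ((cutoff n (a, b) : ℝ) : ℂ))
      ((cutDeriv n a * cut n b : ℝ) : ℂ) a :=
    ((cut_hasDerivAt n a).mul_const (cut n b)).ofReal_comp
  exact h1.mul (h a b)

/-- The flux through the cutoff in the second variable. -/
theorem integral_cutoff_deriv_snd {P P' : ℝ × ℝ → ℂ} (hP : Continuous P) (hP' : Continuous P')
    (h : ∀ a b, HasDerivAt (fun b => P (a, b)) (P' (a, b)) b) (n : ℕ) :
    ∫ x, (cutoff n x : ℂ) * P' x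
      = -∫ x : ℝ × ℝ, ((cut n x.1 * cutDeriv n x.2 : ℝ) : ℂ) * P x := by
  have c1 : Continuous fun x : ℝ × ℝ => (cutoff n x : ℂ) * P' x :=
    (Complex.continuous_ofReal.comp (cutoff_continuous n)).mul hP'
  have c2 : Continuous fun x : ℝ × ℝ => ((cut n x.1 * cutDeriv n x.2 : ℝ) : ℂ) * P x :=
    (Complex.continuous_ofReal.comp (((cut_continuous n).comp continuous_fst).mul
      ((cutDeriv_continuous n).comp continuous_snd))).mul hP
  have c0 : Continuous fun x : ℝ × ℝ => (cutoff n x : ℂ) * P x :=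
    (Complex.continuous_ofReal.comp (cutoff_continuous n)).mul hP
  have i1 := integrable_of_eq_zero_off_compact c1 (cutBox_isCompact n)
    (fun x hx => by simp [cutoff_eq_zero hx])
  have i0 := integrable_of_eq_zero_off_compact c0 (cutBox_isCompact n)
    (fun x hx => by simp [cutoff_eq_zero hx])
  have i2 := integrable_of_eq_zero_off_compact c2 (cutBox_isCompact n) (fun x hx => by
    rcases abs_gt_of_notMem_cutBox hx with h | h
    · simp [cut_eq_zero h.le]
    · simp [cutDeriv_eq_zero h])
  rw [eq_neg_iff_add_eq_zero, add_comm, ← integral_add i2 i1]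
  refine integral_deriv_snd_eq_zero i0 (i2.add i1) fun a b => ?_
  have h1 : HasDerivAt (fun b => ((cutoff n (a, b) : ℝ) : ℂ))
      ((cut n a * cutDeriv n b : ℝ) : ℂ) b :=
    ((cut_hasDerivAt n b).const_mul (cut n a)).ofReal_comp
  exact h1.mul (h a b)

theorem norm_integral_mul_le_of_abs_le {w : ℝ × ℝ → ℝ} {P : ℝ × ℝ → ℂ} {c K : ℝ} (hc : 0 ≤ c)
    (hw : ∀ x, |w x| ≤ c) (hP : Integrable P) (hK : ∫ x, ‖P x‖ ≤ K) :
    ‖∫ x, (w x : ℂ) * P x‖ ≤ c * K := by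
  calc ‖∫ x, (w x : ℂ) * P x‖ ≤ ∫ x, c * ‖P x‖ := by
        refine norm_integral_le_of_norm_le (hP.norm.const_mul c) (Eventually.of_forall fun x => ?_)
        rw [norm_mul, Complex.norm_real, Real.norm_eq_abs]
        gcongr
        exact hw x
    _ ≤ c * K := by rw [integral_const_mul]; gcongr

/-- If `∂ₜ q = ∂₁ P + ∂₂ S + Q` with `q`, `P`, `S`, `Q` in `L^∞(0, τ; L¹)`, then
`∫ q(t) - ∫ q(0) = ∫₀ᵗ ∫ Q`. -/
theorem balance_law {τ K : ℝ} {q qt P P' S S' Q : ℝ → ℝ × ℝ → ℂ}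
    (hq : Continuous (uncurry q)) (hqt : Continuous (uncurry qt))
    (hP : Continuous (uncurry P)) (hP' : Continuous (uncurry P'))
    (hS : Continuous (uncurry S)) (hS' : Continuous (uncurry S'))
    (hQ : Continuous (uncurry Q))
    (dq : ∀ t ∈ Ioo 0 τ, ∀ x, HasDerivAt (fun s => q s x) (qt t x) t)
    (dP : ∀ t a b, HasDerivAt (fun a => P t (a, b)) (P' t (a, b)) a)
    (dS : ∀ t a b, HasDerivAt (fun b => S t (a, b)) (S' t (a, b)) b)
    (heq : ∀ t ∈ Icc 0 τ, ∀ x, qt t x = P' t x + S' t x + Q t x)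
    (iq : ∀ t ∈ Icc 0 τ, Integrable (q t))
    (iP : ∀ t ∈ Icc 0 τ, Integrable (P t)) (bP : ∀ t ∈ Icc 0 τ, ∫ x, ‖P t x‖ ≤ K)
    (iS : ∀ t ∈ Icc 0 τ, Integrable (S t)) (bS : ∀ t ∈ Icc 0 τ, ∫ x, ‖S t x‖ ≤ K)
    (iQ : ∀ t ∈ Icc 0 τ, Integrable (Q t)) (bQ : ∀ t ∈ Icc 0 τ, ∫ x, ‖Q t x‖ ≤ K)
    {t : ℝ} (ht : t ∈ Icc 0 τ) :
    (∫ x, q t x) - ∫ x, q 0 x = ∫ s in (0 : ℝ)..t, ∫ x, Q s x := by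
  obtain ⟨C, hC0, hC⟩ := exists_cutDeriv_bound
  have h0 : (0 : ℝ) ∈ Icc 0 τ := ⟨le_rfl, ht.1.trans ht.2⟩
  have hK : 0 ≤ K := (integral_nonneg fun _ => norm_nonneg _).trans (bP 0 h0)
  have cutC : ∀ n, Continuous fun x : ℝ × ℝ => (cutoff n x : ℂ) := fun n =>
    Complex.continuous_ofReal.comp (cutoff_continuous n)
  have ci : ∀ n {f : ℝ × ℝ → ℂ}, Continuous f → Integrable fun x => (cutoff n x : ℂ) * f x :=
    fun n f hf => integrable_of_eq_zero_off_compact ((cutC n).mul hf) (cutBox_isCompact n)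
      (fun x hx => by simp [cutoff_eq_zero hx])
  have contQ : ∀ n, Continuous (fun p : ℝ × ℝ × ℝ => (cutoff n p.2 : ℂ) * Q p.1 p.2) :=
    fun n => ((cutC n).comp continuous_snd).mul hQ
  have hsub : ∀ s ∈ Ioc 0 t, s ∈ Icc 0 τ := fun s hs => ⟨hs.1.le, hs.2.trans ht.2⟩
  -- the identity with a cutoff
  have key : ∀ n, (∫ x, (cutoff n x : ℂ) * q t x) - ∫ x, (cutoff n x : ℂ) * q 0 x
      = ∫ s in (0 : ℝ)..t, ∫ x, (cutoff n x : ℂ) * qt s x := by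
    intro n
    have i2 : Integrable (fun p : ℝ × ℝ × ℝ => (cutoff n p.2 : ℂ) * qt p.1 p.2)
        ((volume.restrict (Ioc 0 t)).prod volume) :=
      integrable_prod_of_eq_zero_off_compact (((cutC n).comp continuous_snd).mul hqt)
        (cutBox_isCompact n) (fun s x hx => by simp [cutoff_eq_zero hx]) 0 t
    rw [intervalIntegral.integral_of_le ht.1, integral_integral_swap i2,
      ← integral_sub (ci n (continuous_slice hq t)) (ci n (continuous_slice hq 0))]
    refine integral_congr_ae (Eventually.of_forall fun x => ?_)
    dsimp only
    rw [← intervalIntegral.integral_of_le ht.1, intervalIntegral.integral_const_mul,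
      intervalIntegral.integral_eq_sub_of_hasDerivAt_of_le ht.1
        (continuous_time hq x).continuousOn
        (fun s hs => dq s ⟨hs.1, hs.2.trans_le ht.2⟩ x)
        ((continuous_time hqt x).intervalIntegrable _ _), mul_sub]
  have meas : ∀ n, StronglyMeasurable fun s => ∫ x, (cutoff n x : ℂ) * Q s x := fun n =>
    (contQ n).stronglyMeasurable.integral_prod_right
  have bd : ∀ n, ∀ s ∈ Icc 0 τ, ‖∫ x, (cutoff n x : ℂ) * Q s x‖ ≤ K := fun n s hs =>
    (norm_integral_le_of_norm_le (iQ s hs).norm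
      (Eventually.of_forall fun x => norm_cutoff_mul_le n x _)).trans (bQ s hs)
  have ii : ∀ n, IntervalIntegrable (fun s => ∫ x, (cutoff n x : ℂ) * Q s x) volume 0 t := by
    intro n
    rw [intervalIntegrable_iff_integrableOn_Ioc_of_le ht.1]
    refine Measure.integrableOn_of_bounded (M := K) (by simp) (meas n).aestronglyMeasurable ?_
    filter_upwards [ae_restrict_mem measurableSet_Ioc] with s hs
    exact bd n s (hsub s hs)
  -- The divergence terms only see the derivative of the cutoff, of size C/(n+1); an L¹ bound on the
  -- fluxes is therefore enough for them to disappear in the limit.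
  have err : ∀ n, ‖((∫ x, (cutoff n x : ℂ) * q t x) - ∫ x, (cutoff n x : ℂ) * q 0 x)
      - ∫ s in (0 : ℝ)..t, ∫ x, (cutoff n x : ℂ) * Q s x‖ ≤ 2 * (C / (n + 1)) * K * t := by
    intro n
    have hCn : 0 ≤ C / ((n : ℝ) + 1) := by positivity
    have iqt : IntervalIntegrable (fun s => ∫ x, (cutoff n x : ℂ) * qt s x) volume 0 t := by
      have i2 : Integrable (fun p : ℝ × ℝ × ℝ => (cutoff n p.2 : ℂ) * qt p.1 p.2)
          ((volume.restrict (Ioc 0 t)).prod volume) :=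
        integrable_prod_of_eq_zero_off_compact (((cutC n).comp continuous_snd).mul hqt)
          (cutBox_isCompact n) (fun s x hx => by simp [cutoff_eq_zero hx]) 0 t
      rw [intervalIntegrable_iff_integrableOn_Ioc_of_le ht.1]
      exact i2.integral_prod_left
    rw [key n, ← intervalIntegral.integral_sub iqt (ii n)]
    have := intervalIntegral.norm_integral_le_of_norm_le_const (a := 0) (b := t)
      (f := fun s => (∫ x, (cutoff n x : ℂ) * qt s x) - ∫ x, (cutoff n x : ℂ) * Q s x)
      (C := 2 * (C / (n + 1)) * K) ?_
    · rwa [sub_zero, abs_of_nonneg ht.1] at this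
    intro s hs
    rw [uIoc_of_le ht.1] at hs
    have hs' := hsub s hs
    have e1 : (∫ x, (cutoff n x : ℂ) * qt s x) - ∫ x, (cutoff n x : ℂ) * Q s x
        = (∫ x, (cutoff n x : ℂ) * P' s x) + ∫ x, (cutoff n x : ℂ) * S' s x := by
      rw [← integral_sub (ci n (continuous_slice hqt s)) (ci n (continuous_slice hQ s)),
        ← integral_add (ci n (continuous_slice hP' s)) (ci n (continuous_slice hS' s))]
      refine integral_congr_ae (Eventually.of_forall fun x => ?_)
      dsimp only
      rw [heq s hs' x]; ring
    rw [e1, integral_cutoff_deriv_fst (continuous_slice hP s) (continuous_slice hP' s) (dP s) n,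
      integral_cutoff_deriv_snd (continuous_slice hS s) (continuous_slice hS' s) (dS s) n]
    have b1 : ‖∫ x : ℝ × ℝ, ((cutDeriv n x.1 * cut n x.2 : ℝ) : ℂ) * P s x‖ ≤ C / (n + 1) * K := by
      refine norm_integral_mul_le_of_abs_le hCn (fun x => ?_) (iP s hs') (bP s hs')
      rw [abs_mul, abs_of_nonneg (cut_nonneg n x.2)]
      exact (mul_le_of_le_one_right (abs_nonneg _) (cut_le_one _ _)).trans (hC n x.1)
    have b2 : ‖∫ x : ℝ × ℝ, ((cut n x.1 * cutDeriv n x.2 : ℝ) : ℂ) * S s x‖ ≤ C / (n + 1) * K := by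
      refine norm_integral_mul_le_of_abs_le hCn (fun x => ?_) (iS s hs') (bS s hs')
      rw [abs_mul, abs_of_nonneg (cut_nonneg n x.1)]
      exact (mul_le_of_le_one_left (abs_nonneg _) (cut_le_one _ _)).trans (hC n x.2)
    calc _ ≤ _ := norm_add_le _ _
      _ ≤ _ := by rw [norm_neg, norm_neg]; linarith
  have lim1 : Tendsto (fun n => ((∫ x, (cutoff n x : ℂ) * q t x) - ∫ x, (cutoff n x : ℂ) * q 0 x)
      - ∫ s in (0 : ℝ)..t, ∫ x, (cutoff n x : ℂ) * Q s x) atTop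
      (𝓝 (((∫ x, q t x) - ∫ x, q 0 x) - ∫ s in (0 : ℝ)..t, ∫ x, Q s x)) := by
    refine ((integral_cutoff_tendsto (iq t ht)).sub (integral_cutoff_tendsto (iq 0 h0))).sub ?_
    refine intervalIntegral.tendsto_integral_filter_of_dominated_convergence (fun _ => K)
      (Eventually.of_forall fun n => (meas n).aestronglyMeasurable)
      (Eventually.of_forall fun n => Eventually.of_forall fun s hs => ?_)
      intervalIntegrable_const (Eventually.of_forall fun s hs => ?_)
    · rw [uIoc_of_le ht.1] at hs
      exact bd n s (hsub s hs)
    · rw [uIoc_of_le ht.1] at hs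
      exact integral_cutoff_tendsto (iQ s (hsub s hs))
  have lim2 : Tendsto (fun n : ℕ => 2 * (C / ((n : ℝ) + 1)) * K * t) atTop (𝓝 0) := by
    have := ((tendsto_const_div_atTop_nhds_zero_nat C).comp (tendsto_add_atTop_nat 1)).const_mul 2
      |>.mul_const K |>.mul_const t
    simpa [Function.comp_def] using this
  exact sub_eq_zero.1 (tendsto_nhds_unique lim1 (squeeze_zero_norm err lim2))

/-! ### Cauchy–Schwarz and Gram bounds -/

section CauchySchwarz

variable {X Y : Type*} [MeasurableSpace X] [MeasurableSpace Y] {μ : Measure X} {ν : Measure Y}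

theorem integrable_mul_of_sq {f g : X → ℂ} (hf : AEStronglyMeasurable f μ)
    (hg : AEStronglyMeasurable g μ) (hf2 : Integrable (fun x => ‖f x‖ ^ 2) μ)
    (hg2 : Integrable (fun x => ‖g x‖ ^ 2) μ) : Integrable (fun x => f x * g x) μ := by
  refine (hf2.add hg2).mono' (hf.mul hg) (Eventually.of_forall fun x => ?_)
  simp only [Pi.add_apply, norm_mul]
  nlinarith [sq_nonneg (‖f x‖ - ‖g x‖), sq_nonneg (‖f x‖ + ‖g x‖)]

/-- The quadratic s ↦ ∫ (s‖f‖ - ‖g‖)² is nonnegative, so its discriminant is nonpositive. -/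
theorem sq_integral_norm_mul_le {f g : X → ℂ} (hf : AEStronglyMeasurable f μ)
    (hg : AEStronglyMeasurable g μ) (hf2 : Integrable (fun x => ‖f x‖ ^ 2) μ)
    (hg2 : Integrable (fun x => ‖g x‖ ^ 2) μ) :
    (∫ x, ‖f x * g x‖ ∂μ) ^ 2 ≤ (∫ x, ‖f x‖ ^ 2 ∂μ) * ∫ x, ‖g x‖ ^ 2 ∂μ := by
  have hfg := (integrable_mul_of_sq hf hg hf2 hg2).norm
  have h : ∀ s : ℝ, 0 ≤ (∫ x, ‖f x‖ ^ 2 ∂μ) * (s * s) + (-2 * ∫ x, ‖f x * g x‖ ∂μ) * s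
      + ∫ x, ‖g x‖ ^ 2 ∂μ := by
    intro s
    have h1 : 0 ≤ ∫ x, (s * ‖f x‖ - ‖g x‖) ^ 2 ∂μ := integral_nonneg fun x => sq_nonneg _
    have h2 : ∫ x, (s * ‖f x‖ - ‖g x‖) ^ 2 ∂μ
        = ∫ x, (s * s) * ‖f x‖ ^ 2 + (-2 * s) * ‖f x * g x‖ + ‖g x‖ ^ 2 ∂μ := by
      congr 1; ext x; rw [norm_mul]; ring
    rw [h2, integral_add (f := fun x => (s * s) * ‖f x‖ ^ 2 + (-2 * s) * ‖f x * g x‖)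
      ((hf2.const_mul _).add (hfg.const_mul _)) hg2,
      integral_add (hf2.const_mul _) (hfg.const_mul _), integral_const_mul,
      integral_const_mul] at h1
    linarith
  have := discrim_le_zero h
  rw [discrim] at this
  nlinarith

theorem integral_norm_mul_le {f g : X → ℂ} (hf : AEStronglyMeasurable f μ)
    (hg : AEStronglyMeasurable g μ) (hf2 : Integrable (fun x => ‖f x‖ ^ 2) μ)
    (hg2 : Integrable (fun x => ‖g x‖ ^ 2) μ) :
    ∫ x, ‖f x * g x‖ ∂μ ≤ √(∫ x, ‖f x‖ ^ 2 ∂μ) * √(∫ x, ‖g x‖ ^ 2 ∂μ) := by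
  rw [← Real.sqrt_mul (integral_nonneg fun x => sq_nonneg _)]
  exact Real.le_sqrt_of_sq_le (sq_integral_norm_mul_le hf hg hf2 hg2)

/-- Cauchy–Schwarz in the form needed to integrate over x₁ the product of a line weight `v` and the
mass `P` of a slice. -/
theorem integrable_sqrt_mul_sqrt {v P : X → ℝ} (hv : Integrable v μ) (hP : Integrable P μ)
    (hv0 : 0 ≤ᵐ[μ] v) (hP0 : 0 ≤ᵐ[μ] P) :
    Integrable (fun x => √(v x) * √(P x)) μ
      ∧ ∫ x, √(v x) * √(P x) ∂μ ≤ √((∫ x, v x ∂μ) * ∫ x, P x ∂μ) := by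
  have m1 : AEStronglyMeasurable (fun x => ((√(v x) : ℝ) : ℂ)) μ :=
    (Complex.continuous_ofReal.comp Real.continuous_sqrt).comp_aestronglyMeasurable
      hv.aestronglyMeasurable
  have m2 : AEStronglyMeasurable (fun x => ((√(P x) : ℝ) : ℂ)) μ :=
    (Complex.continuous_ofReal.comp Real.continuous_sqrt).comp_aestronglyMeasurable
      hP.aestronglyMeasurable
  have e1 : (fun x => ‖((√(v x) : ℝ) : ℂ)‖ ^ 2) =ᵐ[μ] v := by
    filter_upwards [hv0] with x hx
    rw [Complex.norm_real, Real.norm_of_nonneg (Real.sqrt_nonneg _), Real.sq_sqrt hx]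
  have e2 : (fun x => ‖((√(P x) : ℝ) : ℂ)‖ ^ 2) =ᵐ[μ] P := by
    filter_upwards [hP0] with x hx
    rw [Complex.norm_real, Real.norm_of_nonneg (Real.sqrt_nonneg _), Real.sq_sqrt hx]
  have e3 : ∀ x, ‖((√(v x) : ℝ) : ℂ) * ((√(P x) : ℝ) : ℂ)‖ = √(v x) * √(P x) := by
    intro x
    rw [← Complex.ofReal_mul, Complex.norm_real, Real.norm_of_nonneg (by positivity)]
  have i := (integrable_mul_of_sq m1 m2 (hv.congr e1.symm) (hP.congr e2.symm)).norm
  have b := sq_integral_norm_mul_le m1 m2 (hv.congr e1.symm) (hP.congr e2.symm)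
  simp_rw [e3] at i b
  rw [integral_congr_ae e1, integral_congr_ae e2] at b
  exact ⟨i, Real.le_sqrt_of_sq_le b⟩

theorem integrable_prod_of_norm_integral_le [SFinite ν] {F : X × Y → ℂ} (hF : StronglyMeasurable F)
    (h1 : ∀ p, Integrable (fun y => F (p, y)) ν) {b : X → ℝ} (hb : Integrable b μ)
    (h2 : ∀ p, ∫ y, ‖F (p, y)‖ ∂ν ≤ b p) : Integrable F (μ.prod ν) := by
  rw [integrable_prod_iff hF.aestronglyMeasurable]
  refine ⟨Eventually.of_forall h1, hb.mono' ?_ (Eventually.of_forall fun p => ?_)⟩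
  · exact hF.norm.integral_prod_right'.aestronglyMeasurable
  · rw [Real.norm_of_nonneg (integral_nonneg fun _ => norm_nonneg _)]
    exact h2 p

theorem stronglyMeasurable_conj {φ : X → ℂ} (h : StronglyMeasurable φ) :
    StronglyMeasurable (fun z => conj (φ z)) :=
  Complex.continuous_conj.comp_stronglyMeasurable h

/-- A `T T*` bound: an operator with kernel `k` is controlled by the kernel of `T T*`. -/
theorem sq_norm_integral_kernel_le [SigmaFinite μ] [SigmaFinite ν] {k : X → Y → ℂ} (hk : StronglyMeasurable (uncurry k)) {C : ℝ}
    (k2 : ∀ p, Integrable (fun y => ‖k p y‖ ^ 2) ν) (kC : ∀ p, ∫ y, ‖k p y‖ ^ 2 ∂ν ≤ C)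
    {f : X → ℂ} (hf : StronglyMeasurable f) (hfi : Integrable f μ) {g : Y → ℂ}
    (hg : StronglyMeasurable g) (hg2 : Integrable (fun y => ‖g y‖ ^ 2) ν) :
    ‖∫ p, f p * ∫ y, k p y * g y ∂ν ∂μ‖ ^ 2
      ≤ (∫ y, ‖g y‖ ^ 2 ∂ν)
        * ‖∫ p, ∫ p', f p * conj (f p') * ∫ y, k p y * conj (k p' y) ∂ν ∂μ ∂μ‖ := by
  have hkp : ∀ p, StronglyMeasurable (k p) := fun p =>
    hk.comp_measurable measurable_prodMk_left
  have hC : ∀ p, √(∫ y, ‖k p y‖ ^ 2 ∂ν) ≤ √C := fun p => Real.sqrt_le_sqrt (kC p)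
  -- first Fubini
  have F1m : StronglyMeasurable (fun q : X × Y => f q.1 * (k q.1 q.2 * g q.2)) :=
    (hf.comp_measurable measurable_fst).mul (hk.mul (hg.comp_measurable measurable_snd))
  have F1 : Integrable (fun q : X × Y => f q.1 * (k q.1 q.2 * g q.2)) (μ.prod ν) := by
    refine integrable_prod_of_norm_integral_le F1m (b := fun p => ‖f p‖ *
      (√C * √(∫ y, ‖g y‖ ^ 2 ∂ν))) (fun p => ?_) (hfi.norm.mul_const _) (fun p => ?_)
    · exact (integrable_mul_of_sq (hkp p).aestronglyMeasurable hg.aestronglyMeasurable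
        (k2 p) hg2).const_mul (f p)
    · simp only [norm_mul (f p)]
      rw [integral_const_mul]
      gcongr
      refine (integral_norm_mul_le (hkp p).aestronglyMeasurable hg.aestronglyMeasurable
        (k2 p) hg2).trans ?_
      exact mul_le_mul_of_nonneg_right (hC p) (Real.sqrt_nonneg _)
  -- `Ψ` is the transpose of the operator applied to `f`. The left side is ∫ Ψ g, and expanding |Ψ|²
  -- as a double integral produces the kernel of T T*, so Cauchy–Schwarz finishes.
  set Ψ : Y → ℂ := fun y => ∫ p, f p * k p y ∂μ with hΨ
  have Ψm : StronglyMeasurable Ψ := by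
    have : StronglyMeasurable (fun q : X × Y => f q.1 * k q.1 q.2) :=
      (hf.comp_measurable measurable_fst).mul hk
    exact this.integral_prod_left'
  have e1 : ∫ p, f p * ∫ y, k p y * g y ∂ν ∂μ = ∫ y, Ψ y * g y ∂ν := by
    calc _ = ∫ p, ∫ y, f p * (k p y * g y) ∂ν ∂μ := by simp_rw [integral_const_mul]
      _ = ∫ y, ∫ p, f p * (k p y * g y) ∂μ ∂ν := integral_integral_swap F1
      _ = _ := by simp_rw [← mul_assoc, integral_mul_const]; rfl
  -- second Fubini
  have F2m : StronglyMeasurable (fun q : (X × X) × Y =>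
      (f q.1.1 * conj (f q.1.2)) * (k q.1.1 q.2 * conj (k q.1.2 q.2))) := by
    refine ((hf.comp_measurable (measurable_fst.comp measurable_fst)).mul
      (stronglyMeasurable_conj (hf.comp_measurable (measurable_snd.comp measurable_fst)))).mul (.mul ?_ (stronglyMeasurable_conj ?_))
    · exact hk.comp_measurable ((measurable_fst.comp measurable_fst).prodMk measurable_snd)
    · exact hk.comp_measurable ((measurable_snd.comp measurable_fst).prodMk measurable_snd)
  have ff : Integrable (fun q : X × X => ‖f q.1‖ * ‖f q.2‖) (μ.prod μ) :=
    hfi.norm.mul_prod hfi.norm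
  have kk : ∀ p p', Integrable (fun y => k p y * conj (k p' y)) ν := fun p p' =>
    integrable_mul_of_sq (hkp p).aestronglyMeasurable (stronglyMeasurable_conj (hkp p')).aestronglyMeasurable
        (k2 p) (by simpa using k2 p')
  have F2 : Integrable (fun q : (X × X) × Y =>
      (f q.1.1 * conj (f q.1.2)) * (k q.1.1 q.2 * conj (k q.1.2 q.2))) ((μ.prod μ).prod ν) := by
    refine integrable_prod_of_norm_integral_le F2m (b := fun p => ‖f p.1‖ * ‖f p.2‖ *
      (√C * √C)) (fun p => (kk p.1 p.2).const_mul (f p.1 * conj (f p.2))) (ff.mul_const _) (fun p => ?_)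
    simp only [norm_mul (f p.1 * conj (f p.2))]
    rw [integral_const_mul, norm_mul, RCLike.norm_conj]
    gcongr
    refine (integral_norm_mul_le (hkp p.1).aestronglyMeasurable
        (stronglyMeasurable_conj (hkp p.2)).aestronglyMeasurable (k2 p.1) (by simpa using k2 p.2)).trans ?_
    simp only [RCLike.norm_conj]
    exact mul_le_mul (hC _) (hC _) (Real.sqrt_nonneg _) (Real.sqrt_nonneg _)
  have e2 : ∀ y, ((‖Ψ y‖ ^ 2 : ℝ) : ℂ)
      = ∫ q : X × X, (f q.1 * conj (f q.2)) * (k q.1 y * conj (k q.2 y)) ∂(μ.prod μ) := by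
    intro y
    have : ∀ q : X × X, (f q.1 * conj (f q.2)) * (k q.1 y * conj (k q.2 y))
        = (f q.1 * k q.1 y) * conj (f q.2 * k q.2 y) := by
      intro q; rw [map_mul]; ring
    simp_rw [this]
    rw [integral_prod_mul (fun p => f p * k p y) (fun p => conj (f p * k p y)), integral_conj,
      Complex.mul_conj, Complex.normSq_eq_norm_sq]
  have e3 : ((∫ y, ‖Ψ y‖ ^ 2 ∂ν : ℝ) : ℂ)
      = ∫ p, ∫ p', f p * conj (f p') * ∫ y, k p y * conj (k p' y) ∂ν ∂μ ∂μ := by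
    rw [← integral_complex_ofReal]
    simp_rw [e2]
    rw [← integral_integral_swap F2]
    simp_rw [integral_const_mul]
    rw [integral_prod (fun q : X × X => f q.1 * conj (f q.2) * ∫ y, k q.1 y * conj (k q.2 y) ∂ν)]
    simpa only [integral_const_mul] using F2.integral_prod_left
  have Ψ2 : Integrable (fun y => ‖Ψ y‖ ^ 2) ν := by
    have := F2.integral_prod_right
    simp_rw [← e2] at this
    exact this.re
  have e4 : ∫ y, ‖Ψ y‖ ^ 2 ∂ν
      = ‖∫ p, ∫ p', f p * conj (f p') * ∫ y, k p y * conj (k p' y) ∂ν ∂μ ∂μ‖ := by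
    rw [← e3, Complex.norm_real, Real.norm_of_nonneg (integral_nonneg fun y => sq_nonneg _)]
  rw [e1, ← e4, mul_comm]
  refine le_trans ?_ (sq_integral_norm_mul_le Ψm.aestronglyMeasurable hg.aestronglyMeasurable Ψ2 hg2)
  gcongr
  exact norm_integral_le_integral_norm _

end CauchySchwarz

/-! ### Complex Gaussian kernels -/

/-- The one-dimensional Gaussian `exp (-r² / 2z)`. -/
def gauss (z : ℂ) (r : ℝ) : ℂ := Complex.exp (-(r : ℂ) ^ 2 / (2 * z))

/-- The planar Schrödinger–heat kernel `(2πz)⁻¹ exp (-|x|² / 2z)`. -/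
def kern (z : ℂ) (x : ℝ × ℝ) : ℂ := (2 * Real.pi * z)⁻¹ * (gauss z x.1 * gauss z x.2)

theorem ne_zero_of_re_pos {z : ℂ} (hz : 0 < z.re) : z ≠ 0 := by
  rintro rfl; simp at hz

theorem norm_gauss (z : ℂ) (r : ℝ) :
    ‖gauss z r‖ = Real.exp (-(z.re / (2 * Complex.normSq z)) * r ^ 2) := by
  rw [gauss, Complex.norm_exp]
  congr 1
  have : -(r : ℂ) ^ 2 / (2 * z) = ((-(r ^ 2) / 2 : ℝ) : ℂ) * z⁻¹ := by
    push_cast; rw [div_eq_mul_inv, mul_inv]; ring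
  rw [this, Complex.re_ofReal_mul, Complex.inv_re]
  ring

theorem norm_gauss_le_one {z : ℂ} (hz : 0 < z.re) (r : ℝ) : ‖gauss z r‖ ≤ 1 := by
  rw [norm_gauss, Real.exp_le_one_iff]
  have : 0 ≤ z.re / (2 * Complex.normSq z) := div_nonneg hz.le (by positivity [Complex.normSq_nonneg z])
  nlinarith [sq_nonneg r]

theorem gauss_conj (z : ℂ) (r : ℝ) : conj (gauss z r) = gauss (conj z) r := by
  rw [gauss, gauss, ← Complex.exp_conj]
  simp [map_ofNat]

theorem gauss_neg (z : ℂ) (r : ℝ) : gauss z (-r) = gauss z r := by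
  simp [gauss]

theorem gauss_sub_comm (z : ℂ) (r s : ℝ) : gauss z (r - s) = gauss z (s - r) := by
  rw [← gauss_neg, neg_sub]

theorem gauss_continuous (z : ℂ) : Continuous (gauss z) := by
  unfold gauss; fun_prop

theorem gauss_coeff_pos {z : ℂ} (hz : 0 < z.re) : 0 < z.re / (2 * Complex.normSq z) :=
  div_pos hz (mul_pos two_pos (Complex.normSq_pos.2 (ne_zero_of_re_pos hz)))

theorem integrable_norm_gauss {z : ℂ} (hz : 0 < z.re) : Integrable (fun r => ‖gauss z r‖) := by
  simp_rw [norm_gauss]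
  exact integrable_exp_neg_mul_sq (gauss_coeff_pos hz)

theorem integrable_norm_gauss_sq {z : ℂ} (hz : 0 < z.re) :
    Integrable (fun r => ‖gauss z r‖ ^ 2) := by
  refine (integrable_norm_gauss hz).mono' ((gauss_continuous z).norm.pow 2).aestronglyMeasurable
    (Eventually.of_forall fun r => ?_)
  rw [Real.norm_of_nonneg (by positivity), pow_two]
  exact mul_le_of_le_one_left (norm_nonneg _) (norm_gauss_le_one hz r)

/-- The constant in the convolution of two Gaussians. -/
def gaussConst (z w : ℂ) : ℂ := (Real.pi / ((z + w) / (2 * z * w))) ^ (1 / 2 : ℂ)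

/-- Only this square is used later, through its norm or through the product over the two axes, so
the branch of the root is irrelevant. -/
theorem gaussConst_sq {z w : ℂ} : gaussConst z w ^ 2 = Real.pi / ((z + w) / (2 * z * w)) := by
  rw [gaussConst, ← Complex.cpow_nat_mul]
  simp

/-- Completing the square; the integral converges because 1/z + 1/w has positive real part. -/
theorem gauss_conv {z w : ℂ} (hz : 0 < z.re) (hw : 0 < w.re) (x x' : ℝ) :
    ∫ y, gauss z (x - y) * gauss w (y - x') = gaussConst z w * gauss (z + w) (x - x') := by
  have z0 := ne_zero_of_re_pos hz
  have w0 := ne_zero_of_re_pos hw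
  have zw : z + w ≠ 0 := ne_zero_of_re_pos (by simpa using add_pos hz hw)
  have hb : (-((z + w) / (2 * z * w))).re < 0 := by
    have : (z + w) / (2 * z * w) = ((1 / 2 : ℝ) : ℂ) * z⁻¹ + ((1 / 2 : ℝ) : ℂ) * w⁻¹ := by
      push_cast; field_simp; ring
    rw [this, Complex.neg_re, Complex.add_re, Complex.re_ofReal_mul, Complex.re_ofReal_mul,
      Complex.inv_re, Complex.inv_re]
    have := div_pos hz (Complex.normSq_pos.2 z0)
    have := div_pos hw (Complex.normSq_pos.2 w0)
    linarith
  have h := integral_cexp_quadratic hb (x / z + x' / w) (-(x : ℂ) ^ 2 / (2 * z) - x' ^ 2 / (2 * w))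
  have e : ∀ y : ℝ, gauss z (x - y) * gauss w (y - x')
      = Complex.exp (-((z + w) / (2 * z * w)) * y ^ 2 + (x / z + x' / w) * y
        + (-(x : ℂ) ^ 2 / (2 * z) - x' ^ 2 / (2 * w))) := by
    intro y
    rw [gauss, gauss, ← Complex.exp_add]
    congr 1
    push_cast
    field_simp
    ring
  simp_rw [e]
  rw [h, neg_neg, gaussConst, gauss]
  congr 2
  push_cast
  field_simp
  ring

/-- This is the L¹ norm of the T T* kernel of convolution with `gauss z`. One factor blows up and
the other vanishes as Re z → 0, but the product depends only on ‖z‖; this makes the later bounds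
uniform in the regularisation. -/
theorem norm_gaussConst_conj_mul {z : ℂ} (hz : 0 < z.re) :
    ‖gaussConst z (conj z)‖ * ∫ r, ‖gauss (z + conj z) r‖ = 2 * Real.pi * ‖z‖ := by
  have z0 := ne_zero_of_re_pos hz
  have hn : 0 < ‖z‖ := norm_pos_iff.2 z0
  have hsum : z + conj z = ((2 * z.re : ℝ) : ℂ) := Complex.add_conj z
  simp_rw [norm_gauss]
  rw [integral_gaussian]
  have h1 : ‖gaussConst z (conj z)‖ ^ 2 = Real.pi * ‖z‖ ^ 2 / z.re := by
    rw [← norm_pow, gaussConst_sq]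
    have : 2 * z * conj z = ((2 * ‖z‖ ^ 2 : ℝ) : ℂ) := by
      rw [mul_assoc, Complex.mul_conj, Complex.normSq_eq_norm_sq]; push_cast; ring
    rw [hsum, this, ← Complex.ofReal_div, ← Complex.ofReal_div, Complex.norm_real,
      Real.norm_of_nonneg (by positivity)]
    field_simp
  have h2 : Real.pi / ((z + conj z).re / (2 * Complex.normSq (z + conj z)))
      = 4 * Real.pi * z.re := by
    rw [hsum, Complex.normSq_ofReal, Complex.ofReal_re]
    field_simp
    ring
  rw [h2]
  have h3 : ‖gaussConst z (conj z)‖ = √(Real.pi * ‖z‖ ^ 2 / z.re) := by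
    rw [← h1, Real.sqrt_sq (norm_nonneg _)]
  rw [h3, ← Real.sqrt_mul (by positivity)]
  have : Real.pi * ‖z‖ ^ 2 / z.re * (4 * Real.pi * z.re) = (2 * Real.pi * ‖z‖) ^ 2 := by
    field_simp; ring
  rw [this, Real.sqrt_sq (by positivity)]

/-- `L²` boundedness of the one-dimensional Gaussian convolution, as a bilinear bound. -/
theorem norm_integral_gauss_le {z : ℂ} (hz : 0 < z.re) {f g : ℝ → ℂ} (hf : Continuous f)
    (hfi : Integrable f) (hf2 : Integrable fun x => ‖f x‖ ^ 2) (hg : Continuous g)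
    (hg2 : Integrable fun x => ‖g x‖ ^ 2) :
    ‖∫ x, f x * ∫ y, gauss z (x - y) * g y‖
      ≤ √(2 * Real.pi * ‖z‖) * (√(∫ x, ‖f x‖ ^ 2) * √(∫ x, ‖g x‖ ^ 2)) := by
  have hcont : Continuous (uncurry fun x y : ℝ => gauss z (x - y)) :=
    (gauss_continuous z).comp (by fun_prop : Continuous fun p : ℝ × ℝ => p.1 - p.2)
  have hG := sq_norm_integral_kernel_le (μ := volume) (ν := volume)
    (k := fun x y : ℝ => gauss z (x - y)) (C := ∫ r, ‖gauss z r‖ ^ 2) hcont.stronglyMeasurable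
    (fun p => (integrable_norm_gauss_sq hz).comp_sub_left p)
    (fun p => (integral_sub_left_eq_self (fun r => ‖gauss z r‖ ^ 2) volume p).le)
    hf.stronglyMeasurable hfi hg.stronglyMeasurable hg2
  have hzz : 0 < (z + conj z).re := by simpa using hz
  have ek : ∀ p p' : ℝ, ∫ y, gauss z (p - y) * conj (gauss z (p' - y))
      = gaussConst z (conj z) * gauss (z + conj z) (p - p') := by
    intro p p'
    rw [← gauss_conv hz (by simpa using hz)]
    simp_rw [gauss_conj]
    congr 1; ext y; rw [gauss_sub_comm (conj z) p' y]
  set c := ‖gaussConst z (conj z)‖ with hc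
  set e := fun r => ‖gauss (z + conj z) r‖ with he
  have hei : Integrable e := integrable_norm_gauss hzz
  -- Schur test
  have hS : ‖∫ p, ∫ p', f p * conj (f p') * ∫ y, gauss z (p - y) * conj (gauss z (p' - y))‖
      ≤ 2 * Real.pi * ‖z‖ * ∫ x, ‖f x‖ ^ 2 := by
    simp_rw [ek]
    have A2 : Integrable (fun q : ℝ × ℝ => ‖f q.2‖ ^ 2 * e (q.1 - q.2)) (volume.prod volume) :=
      hf2.convolution_integrand (ContinuousLinearMap.mul ℝ ℝ) hei
    have esymm : ∀ r s, e (r - s) = e (s - r) := fun r s => by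
      simp only [he]; rw [gauss_sub_comm]
    have A1 : Integrable (fun q : ℝ × ℝ => ‖f q.1‖ ^ 2 * e (q.1 - q.2)) (volume.prod volume) := by
      have := A2.swap
      refine this.congr (Eventually.of_forall fun q => ?_)
      simp only [comp_apply, Prod.fst_swap, Prod.snd_swap]
      rw [esymm]
    have I1 : ∫ q : ℝ × ℝ, ‖f q.1‖ ^ 2 * e (q.1 - q.2) ∂(volume.prod volume)
        = (∫ x, ‖f x‖ ^ 2) * ∫ r, e r := by
      rw [integral_prod _ A1]
      simp_rw [integral_const_mul, integral_sub_left_eq_self e volume]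
      rw [integral_mul_const]
    have I2 : ∫ q : ℝ × ℝ, ‖f q.2‖ ^ 2 * e (q.1 - q.2) ∂(volume.prod volume)
        = (∫ x, ‖f x‖ ^ 2) * ∫ r, e r := by
      rw [integral_prod_symm _ A2]
      simp_rw [integral_const_mul, integral_sub_right_eq_self e]
      rw [integral_mul_const]
    have hb : ∀ q : ℝ × ℝ, ‖f q.1 * conj (f q.2) *
        (gaussConst z (conj z) * gauss (z + conj z) (q.1 - q.2))‖
        ≤ c / 2 * (‖f q.1‖ ^ 2 * e (q.1 - q.2) + ‖f q.2‖ ^ 2 * e (q.1 - q.2)) := by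
      intro q
      rw [norm_mul, norm_mul, norm_mul, RCLike.norm_conj]
      have h1 : 2 * (‖f q.1‖ * ‖f q.2‖) ≤ ‖f q.1‖ ^ 2 + ‖f q.2‖ ^ 2 := by
        nlinarith [sq_nonneg (‖f q.1‖ - ‖f q.2‖)]
      have h2 : 0 ≤ c * e (q.1 - q.2) := by positivity
      nlinarith [mul_le_mul_of_nonneg_right h1 h2]
    have B : Integrable (fun q : ℝ × ℝ => f q.1 * conj (f q.2) *
        (gaussConst z (conj z) * gauss (z + conj z) (q.1 - q.2))) (volume.prod volume) := by
      refine ((A1.add A2).const_mul (c / 2)).mono' ?_ (Eventually.of_forall hb)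
      have := gauss_continuous (z + conj z)
      exact Continuous.aestronglyMeasurable (by fun_prop)
    rw [← integral_prod (fun q : ℝ × ℝ => f q.1 * conj (f q.2) *
        (gaussConst z (conj z) * gauss (z + conj z) (q.1 - q.2))) B]
    refine (norm_integral_le_of_norm_le ((A1.add A2).const_mul (c / 2))
      (Eventually.of_forall hb)).trans ?_
    rw [integral_const_mul, integral_add' A1 A2, I1, I2, ← norm_gaussConst_conj_mul hz]
    exact le_of_eq (by ring)
  have hF : 0 ≤ ∫ x, ‖f x‖ ^ 2 := integral_nonneg fun x => sq_nonneg _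
  have hGn : 0 ≤ ∫ x, ‖g x‖ ^ 2 := integral_nonneg fun x => sq_nonneg _
  rw [← Real.sqrt_mul hF, ← Real.sqrt_mul (by positivity)]
  refine Real.le_sqrt_of_sq_le (hG.trans ?_)
  calc _ ≤ (∫ x, ‖g x‖ ^ 2) * (2 * Real.pi * ‖z‖ * ∫ x, ‖f x‖ ^ 2) := by gcongr
    _ = _ := by ring

/-! ### The planar kernel and its decay in mixed norms. -/

theorem kern_continuous (z : ℂ) : Continuous (kern z) := by
  have := gauss_continuous z
  unfold kern; fun_prop

theorem norm_kern_eq (z : ℂ) (x : ℝ × ℝ) :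
    ‖kern z x‖ = (2 * Real.pi * ‖z‖)⁻¹ * (‖gauss z x.1‖ * ‖gauss z x.2‖) := by
  simp [kern, abs_of_pos Real.pi_pos]

theorem norm_kern_le {z : ℂ} (hz : 0 < z.re) (x : ℝ × ℝ) :
    ‖kern z x‖ ≤ (2 * Real.pi * ‖z‖)⁻¹ := by
  rw [norm_kern_eq]
  exact mul_le_of_le_one_right (by positivity)
    (mul_le_one₀ (norm_gauss_le_one hz _) (norm_nonneg _) (norm_gauss_le_one hz _))

theorem kern_conj (z : ℂ) (x : ℝ × ℝ) : conj (kern z x) = kern (conj z) x := by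
  simp [kern, gauss_conj, map_ofNat]

theorem kern_sub_comm (z : ℂ) (x y : ℝ × ℝ) : kern z (x - y) = kern z (y - x) := by
  simp only [kern, Prod.fst_sub, Prod.snd_sub]
  rw [gauss_sub_comm, gauss_sub_comm z x.2]

theorem integrable_norm_kern_sq {z : ℂ} (hz : 0 < z.re) :
    Integrable (fun x => ‖kern z x‖ ^ 2) := by
  have := ((integrable_norm_gauss_sq hz).mul_prod (integrable_norm_gauss_sq hz)).const_mul
    (((2 * Real.pi * ‖z‖)⁻¹) ^ 2)
  refine this.congr (Eventually.of_forall fun x => ?_)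
  simp only [norm_kern_eq]; ring

/-- The semigroup law. The two axes each contribute `gaussConst`, and its square 2πzw/(z+w) converts
the prefactors 1/(2πz) and 1/(2πw) into 1/(2π(z+w)). -/
theorem kern_conv {z w : ℂ} (hz : 0 < z.re) (hw : 0 < w.re) (x x' : ℝ × ℝ) :
    ∫ y, kern z (x - y) * kern w (y - x') = kern (z + w) (x - x') := by
  have z0 := ne_zero_of_re_pos hz
  have w0 := ne_zero_of_re_pos hw
  have zw : z + w ≠ 0 := ne_zero_of_re_pos (by simpa using add_pos hz hw)
  have pi0 : (Real.pi : ℂ) ≠ 0 := by exact_mod_cast Real.pi_ne_zero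
  have e : ∀ y : ℝ × ℝ, kern z (x - y) * kern w (y - x')
      = ((2 * Real.pi * z)⁻¹ * (2 * Real.pi * w)⁻¹) *
        ((gauss z (x.1 - y.1) * gauss w (y.1 - x'.1))
          * (gauss z (x.2 - y.2) * gauss w (y.2 - x'.2))) := by
    intro y; simp only [kern, Prod.fst_sub, Prod.snd_sub]; ring
  simp_rw [e]
  rw [integral_const_mul, Measure.volume_eq_prod,
    integral_prod_mul (fun y => gauss z (x.1 - y) * gauss w (y - x'.1))
      (fun y => gauss z (x.2 - y) * gauss w (y - x'.2)), gauss_conv hz hw, gauss_conv hz hw]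
  have : gaussConst z w * gauss (z + w) (x.1 - x'.1) * (gaussConst z w * gauss (z + w) (x.2 - x'.2))
      = gaussConst z w ^ 2 * (gauss (z + w) (x.1 - x'.1) * gauss (z + w) (x.2 - x'.2)) := by ring
  rw [this, gaussConst_sq, kern]
  simp only [Prod.fst_sub, Prod.snd_sub]
  field_simp

/-- Integrating the pointwise bound along a vertical line leaves the weight outside, which gives the
L² norm of almost every slice. -/
theorem slice_sq_bound {k : ℝ × ℝ → ℂ} {w : ℝ → ℝ} {r : ℝ × ℝ → ℝ} (hk : Continuous k)
    (hr : Integrable r (volume.prod volume)) (hw : ∀ a, 0 ≤ w a)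
    (hkb : ∀ᵐ a, ∀ b, ‖k (a, b)‖ ^ 2 ≤ w a * r (a, b)) :
    ∀ᵐ a, Integrable (fun b => ‖k (a, b)‖ ^ 2)
      ∧ √(∫ b, ‖k (a, b)‖ ^ 2) ≤ √(w a) * √(∫ b, r (a, b)) := by
  filter_upwards [hr.prod_right_ae, hkb] with a ha hka
  have hi : Integrable (fun b => ‖k (a, b)‖ ^ 2) := by
    refine (ha.const_mul (w a)).mono' (Continuous.aestronglyMeasurable (by fun_prop))
      (Eventually.of_forall fun b => ?_)
    rw [Real.norm_of_nonneg (by positivity)]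
    exact hka b
  refine ⟨hi, ?_⟩
  rw [← Real.sqrt_mul (hw a), ← integral_const_mul]
  exact Real.sqrt_le_sqrt (integral_mono hi (ha.const_mul _) hka)

/-- Gaussian convolution in the second variable. -/
def gaussSnd (z : ℂ) (g : ℝ × ℝ → ℂ) (q : ℝ × ℝ) : ℂ := ∫ b', gauss z (q.2 - b') * g (q.1, b')

theorem gaussSnd_stronglyMeasurable (z : ℂ) {g : ℝ × ℝ → ℂ} (hg : Continuous g) :
    StronglyMeasurable (gaussSnd z g) := by
  have gc := gauss_continuous z
  have : Continuous fun q : (ℝ × ℝ) × ℝ => gauss z (q.1.2 - q.2) * g (q.1.1, q.2) := by fun_prop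
  exact this.stronglyMeasurable.integral_prod_right'

theorem norm_gaussSnd_le {z : ℂ} (hz : 0 < z.re) {g : ℝ × ℝ → ℂ}
    (hgi : Integrable g (volume.prod volume)) :
    ∀ᵐ a', ∀ b, ‖gaussSnd z g (a', b)‖ ≤ ∫ b', ‖g (a', b')‖ := by
  filter_upwards [hgi.prod_right_ae] with a' ha' b
  refine norm_integral_le_of_norm_le ha'.norm (Eventually.of_forall fun b' => ?_)
  rw [norm_mul]
  exact mul_le_of_le_one_left (norm_nonneg _) (norm_gauss_le_one hz _)

theorem integrable_kern_mul {z : ℂ} (hz : 0 < z.re) {g : ℝ × ℝ → ℂ} (hgi : Integrable g)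
    (x : ℝ × ℝ) : Integrable (fun y => kern z (x - y) * g y) := by
  refine hgi.bdd_mul (c := (2 * Real.pi * ‖z‖)⁻¹) ?_ (Eventually.of_forall fun y => norm_kern_le hz _)
  exact ((kern_continuous z).comp (continuous_const.sub continuous_id)).aestronglyMeasurable

/-- The kernel is a product over the axes, so the x₂ convolution can be carried out first and the x₁
Gaussian stays as an explicit factor. -/
theorem kern_integral_eq {z : ℂ} (hz : 0 < z.re) {g : ℝ × ℝ → ℂ} (hgi : Integrable g)
    (x : ℝ × ℝ) : ∫ y, kern z (x - y) * g y
      = ∫ a', (2 * Real.pi * z)⁻¹ * gauss z (x.1 - a') * gaussSnd z g (a', x.2) := by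
  have := integrable_kern_mul hz hgi x
  rw [Measure.volume_eq_prod] at this ⊢
  rw [integral_prod _ this]
  congr 1; ext a'
  rw [gaussSnd, ← integral_const_mul]
  congr 1; ext b'
  simp only [kern, Prod.fst_sub, Prod.snd_sub]; ring

theorem kern_integral_stronglyMeasurable (z : ℂ) {g : ℝ × ℝ → ℂ} (hg : Continuous g) :
    StronglyMeasurable fun x : ℝ × ℝ => ∫ y, kern z (x - y) * g y := by
  have := kern_continuous z
  have : Continuous fun q : (ℝ × ℝ) × (ℝ × ℝ) => kern z (q.1 - q.2) * g q.2 := by fun_prop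
  exact this.stronglyMeasurable.integral_prod_right'

theorem norm_kern_integral_le {z : ℂ} (hz : 0 < z.re) {g : ℝ × ℝ → ℂ} (hgi : Integrable g)
    (x : ℝ × ℝ) : ‖∫ y, kern z (x - y) * g y‖ ≤ (2 * Real.pi * ‖z‖)⁻¹ * ∫ y, ‖g y‖ := by
  rw [← integral_const_mul]
  refine norm_integral_le_of_norm_le (hgi.norm.const_mul _) (Eventually.of_forall fun y => ?_)
  rw [norm_mul]
  gcongr
  exact norm_kern_le hz _

/-- With x₁ frozen at `a`, Fubini isolates a bilinear pairing in x₂ alone, to which the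
one-dimensional bound `norm_integral_gauss_le` applies for each `a'`. -/
theorem integral_mul_kern_slice {z : ℂ} (hz : 0 < z.re) {g : ℝ × ℝ → ℂ} (hg : Continuous g)
    (hgi : Integrable g) {k : ℝ → ℂ} (hk : Continuous k) (hki : Integrable k) (a : ℝ) :
    ∫ b, k b * ∫ y, kern z ((a, b) - y) * g y
      = ∫ a', (2 * Real.pi * z)⁻¹ * gauss z (a - a') * ∫ b, k b * gaussSnd z g (a', b) := by
  have gc := gauss_continuous z
  set c₀ : ℂ := (2 * Real.pi * z)⁻¹
  have hgi' : Integrable g (volume.prod volume) := hgi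
  have hγ : Integrable fun a' => ∫ b', ‖g (a', b')‖ := hgi'.norm.integral_prod_left
  have dom : Integrable (fun q : ℝ × ℝ => ‖k q.1‖ * (‖c₀‖ * ∫ b', ‖g (q.2, b')‖))
      (volume.prod volume) := hki.norm.mul_prod (hγ.const_mul ‖c₀‖)
  have hi : Integrable (fun q : ℝ × ℝ => k q.1 * (c₀ * gauss z (a - q.2) * gaussSnd z g (q.2, q.1)))
      (volume.prod volume) := by
    refine dom.mono' ?_ ?_
    · have c1 : Continuous fun q : ℝ × ℝ => k q.1 := by fun_prop
      have c2 : Continuous fun q : ℝ × ℝ => c₀ * gauss z (a - q.2) := by fun_prop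
      exact (c1.stronglyMeasurable.mul (c2.stronglyMeasurable.mul
        ((gaussSnd_stronglyMeasurable z hg).comp_measurable
          (measurable_snd.prodMk measurable_fst)))).aestronglyMeasurable
    · filter_upwards [Measure.quasiMeasurePreserving_snd.ae (norm_gaussSnd_le hz hgi')] with q hq
      rw [norm_mul, norm_mul, norm_mul]
      refine mul_le_mul_of_nonneg_left ?_ (norm_nonneg _)
      exact mul_le_mul (mul_le_of_le_one_right (norm_nonneg _) (norm_gauss_le_one hz _)) (hq q.1)
        (norm_nonneg _) (norm_nonneg _)
  calc _ = ∫ b, ∫ a', k b * (c₀ * gauss z (a - a') * gaussSnd z g (a', b)) := by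
        congr 1; ext b
        rw [kern_integral_eq hz hgi, integral_const_mul]
    _ = ∫ a', ∫ b, k b * (c₀ * gauss z (a - a') * gaussSnd z g (a', b)) :=
        integral_integral_swap hi
    _ = _ := by
        congr 1; ext a'
        rw [← integral_const_mul]; congr 1; ext b; ring

/-- The mixed-norm dispersive bound: decay `|z|^{-1/2}` from the first variable and `L²`
boundedness in the second. -/
theorem norm_integral_kern_le {z : ℂ} (hz : 0 < z.re) {h g : ℝ × ℝ → ℂ} (hh : Continuous h)
    (hhi : Integrable h) (hg : Continuous g) (hgi : Integrable g)
    {v v' : ℝ → ℝ} {p p' : ℝ × ℝ → ℝ} (hv0 : ∀ a, 0 ≤ v a) (hv : Integrable v)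
    (hv0' : ∀ a, 0 ≤ v' a) (hv' : Integrable v')
    (hp0 : ∀ x, 0 ≤ p x) (hp : Integrable p) (hp0' : ∀ x, 0 ≤ p' x) (hp' : Integrable p')
    (hb : ∀ᵐ a, ∀ b, ‖h (a, b)‖ ^ 2 ≤ v a * p (a, b))
    (hb' : ∀ᵐ a, ∀ b, ‖g (a, b)‖ ^ 2 ≤ v' a * p' (a, b)) :
    ‖∫ x, h x * ∫ y, kern z (x - y) * g y‖
      ≤ (√(2 * Real.pi * ‖z‖))⁻¹ * (√((∫ a, v a) * ∫ x, p x) * √((∫ a, v' a) * ∫ x, p' x)) := by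
  have hz0 : 0 < ‖z‖ := norm_pos_iff.2 (ne_zero_of_re_pos hz)
  have hhi1 : Integrable h (volume.prod volume) := hhi
  have hp1 : Integrable p (volume.prod volume) := hp
  have hp1' : Integrable p' (volume.prod volume) := hp'
  have hΦi : Integrable (fun x => h x * ∫ y, kern z (x - y) * g y) (volume.prod volume) :=
    hhi1.mul_bdd (kern_integral_stronglyMeasurable z hg).aestronglyMeasurable
      (Eventually.of_forall (norm_kern_integral_le hz hgi))
  obtain ⟨is, bs⟩ := integrable_sqrt_mul_sqrt hv hp1.integral_prod_left (Eventually.of_forall hv0)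
    (Eventually.of_forall fun a => integral_nonneg fun b => hp0 _)
  obtain ⟨is', bs'⟩ := integrable_sqrt_mul_sqrt hv' hp1'.integral_prod_left
    (Eventually.of_forall hv0') (Eventually.of_forall fun a => integral_nonneg fun b => hp0' _)
  set D := (√(2 * Real.pi * ‖z‖))⁻¹ with hD
  have hD0 : 0 ≤ D := by positivity
  -- The prefactor 1/(2π‖z‖) loses √(2π‖z‖) to the L² operator norm in x₂; the power ‖z‖^{-1/2} that
  -- survives is the one-dimensional dispersive decay.
  have hDe : ‖(2 * Real.pi * z)⁻¹‖ * √(2 * Real.pi * ‖z‖) = D := by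
    have nc₀ : ‖(2 * Real.pi * z)⁻¹‖ = (2 * Real.pi * ‖z‖)⁻¹ := by simp [abs_of_pos Real.pi_pos]
    rw [nc₀, hD]
    have : 0 < 2 * Real.pi * ‖z‖ := by positivity
    nth_rewrite 1 [← Real.mul_self_sqrt this.le]
    have : √(2 * Real.pi * ‖z‖) ≠ 0 := by positivity
    field_simp
  -- In x₁ the Gaussian is simply bounded by 1, while x₂ is handled by L² boundedness on slices.
  have key : ∀ᵐ a, ‖∫ b, h (a, b) * ∫ y, kern z ((a, b) - y) * g y‖
      ≤ D * (√(v a) * √(∫ b, p (a, b))) * ∫ a', √(v' a') * √(∫ b, p' (a', b)) := by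
    filter_upwards [hhi1.prod_right_ae, slice_sq_bound hh hp1 hv0 hb] with a ha hs
    have c1 : Continuous fun b => h (a, b) := hh.comp (Continuous.prodMk_right a)
    rw [integral_mul_kern_slice hz hg hgi c1 ha, ← integral_const_mul]
    refine norm_integral_le_of_norm_le (is'.const_mul _) ?_
    filter_upwards [slice_sq_bound hg hp1' hv0' hb'] with a' hs'
    rw [norm_mul, norm_mul]
    have c2 : Continuous fun b => g (a', b) := hg.comp (Continuous.prodMk_right a')
    have b2 : ‖∫ b, h (a, b) * gaussSnd z g (a', b)‖
        ≤ √(2 * Real.pi * ‖z‖) * ((√(v a) * √(∫ b, p (a, b))) * (√(v' a') * √(∫ b, p' (a', b)))) :=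
      (norm_integral_gauss_le hz c1 ha hs.1 c2 hs'.1).trans
        (mul_le_mul_of_nonneg_left (mul_le_mul hs.2 hs'.2 (Real.sqrt_nonneg _) (by positivity))
          (Real.sqrt_nonneg _))
    calc _ ≤ ‖(2 * Real.pi * z)⁻¹‖ * 1 * (√(2 * Real.pi * ‖z‖) *
          ((√(v a) * √(∫ b, p (a, b))) * (√(v' a') * √(∫ b, p' (a', b))))) :=
          mul_le_mul (mul_le_mul_of_nonneg_left (norm_gauss_le_one hz _) (norm_nonneg _)) b2
            (norm_nonneg _) (by positivity)
      _ = _ := by rw [← hDe]; ring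
  have e0 : ∫ x, h x * ∫ y, kern z (x - y) * g y
      = ∫ a, ∫ b, h (a, b) * ∫ y, kern z ((a, b) - y) * g y := integral_prod _ hΦi
  rw [e0]
  refine (norm_integral_le_of_norm_le ((is.const_mul D).mul_const _) key).trans ?_
  rw [integral_mul_const, integral_const_mul, mul_assoc]
  have e1 : ∫ x, p x = ∫ a, ∫ b, p (a, b) := integral_prod _ hp1
  have e2 : ∫ x, p' x = ∫ a, ∫ b, p' (a, b) := integral_prod _ hp1'
  rw [e1, e2]
  refine mul_le_mul_of_nonneg_left (mul_le_mul bs bs' ?_ (Real.sqrt_nonneg _)) hD0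
  exact integral_nonneg fun a => by positivity

/-! ### Bounded families in `L¹` and `L²` -/

/-- `f ∈ L^∞(0, τ; L¹)`. -/
def L1Bdd (τ : ℝ) (f : ℝ → ℝ × ℝ → ℂ) : Prop :=
  ∃ K, ∀ t ∈ Icc 0 τ, Integrable (f t) ∧ ∫ x, ‖f t x‖ ≤ K

/-- `f ∈ L^∞(0, τ; L²)`. -/
def L2Bdd (τ : ℝ) (f : ℝ → ℝ × ℝ → ℂ) : Prop :=
  ∃ K, ∀ t ∈ Icc 0 τ, Integrable (fun x => ‖f t x‖ ^ 2) ∧ ∫ x, ‖f t x‖ ^ 2 ≤ K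

theorem L1Bdd.add {τ : ℝ} {f g : ℝ → ℝ × ℝ → ℂ} (hf : L1Bdd τ f) (hg : L1Bdd τ g) :
    L1Bdd τ (fun t x => f t x + g t x) := by
  obtain ⟨K, hK⟩ := hf
  obtain ⟨L, hL⟩ := hg
  refine ⟨K + L, fun t ht => ⟨(hK t ht).1.add (hL t ht).1, ?_⟩⟩
  calc _ ≤ ∫ x, ‖f t x‖ + ‖g t x‖ := integral_mono ((hK t ht).1.add (hL t ht).1).norm
        ((hK t ht).1.norm.add (hL t ht).1.norm) fun x => norm_add_le _ _
    _ = _ := integral_add (hK t ht).1.norm (hL t ht).1.norm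
    _ ≤ _ := add_le_add (hK t ht).2 (hL t ht).2

theorem L1Bdd.of_norm_le {τ : ℝ} {f g : ℝ → ℝ × ℝ → ℂ} (hf : L1Bdd τ f)
    (hg : Continuous (uncurry g)) (h : ∀ t ∈ Icc 0 τ, ∀ x, ‖g t x‖ ≤ ‖f t x‖) : L1Bdd τ g := by
  obtain ⟨K, hK⟩ := hf
  refine ⟨K, fun t ht => ?_⟩
  have hi : Integrable (g t) := (hK t ht).1.mono (continuous_slice hg t).aestronglyMeasurable
    (Eventually.of_forall (h t ht))
  exact ⟨hi, (integral_mono hi.norm (hK t ht).1.norm (h t ht)).trans (hK t ht).2⟩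

theorem L1Bdd.const_mul {τ : ℝ} {f : ℝ → ℝ × ℝ → ℂ} (hf : L1Bdd τ f) (c : ℂ) :
    L1Bdd τ (fun t x => c * f t x) := by
  obtain ⟨K, hK⟩ := hf
  refine ⟨‖c‖ * K, fun t ht => ⟨(hK t ht).1.const_mul c, ?_⟩⟩
  simp_rw [norm_mul]
  rw [integral_const_mul]
  exact mul_le_mul_of_nonneg_left (hK t ht).2 (norm_nonneg _)

theorem L1Bdd.neg {τ : ℝ} {f : ℝ → ℝ × ℝ → ℂ} (hf : L1Bdd τ f) :
    L1Bdd τ (fun t x => -f t x) := by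
  simpa using hf.const_mul (-1)

theorem L1Bdd.sub {τ : ℝ} {f g : ℝ → ℝ × ℝ → ℂ} (hf : L1Bdd τ f) (hg : L1Bdd τ g) :
    L1Bdd τ (fun t x => f t x - g t x) := by
  simpa [sub_eq_add_neg] using hf.add hg.neg

theorem L2Bdd.mul {τ : ℝ} {f g : ℝ → ℝ × ℝ → ℂ} (hf : L2Bdd τ f) (hg : L2Bdd τ g)
    (cf : Continuous (uncurry f)) (cg : Continuous (uncurry g)) :
    L1Bdd τ (fun t x => f t x * g t x) := by
  obtain ⟨K, hK⟩ := hf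
  obtain ⟨L, hL⟩ := hg
  refine ⟨K + L, fun t ht => ?_⟩
  have hi := integrable_mul_of_sq (continuous_slice cf t).aestronglyMeasurable
    (continuous_slice cg t).aestronglyMeasurable (hK t ht).1 (hL t ht).1
  refine ⟨hi, ?_⟩
  calc _ ≤ ∫ x, ‖f t x‖ ^ 2 + ‖g t x‖ ^ 2 := integral_mono hi.norm ((hK t ht).1.add (hL t ht).1)
        fun x => by
          simp only [norm_mul]
          nlinarith [sq_nonneg (‖f t x‖ - ‖g t x‖), sq_nonneg (‖f t x‖ + ‖g t x‖)]
    _ = _ := integral_add (hK t ht).1 (hL t ht).1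
    _ ≤ _ := add_le_add (hK t ht).2 (hL t ht).2

theorem L2Bdd.add {τ : ℝ} {f g : ℝ → ℝ × ℝ → ℂ} (hf : L2Bdd τ f) (hg : L2Bdd τ g)
    (cf : Continuous (uncurry f)) (cg : Continuous (uncurry g)) :
    L2Bdd τ (fun t x => f t x + g t x) := by
  obtain ⟨K, hK⟩ := hf
  obtain ⟨L, hL⟩ := hg
  refine ⟨2 * K + 2 * L, fun t ht => ?_⟩
  have hb : ∀ x, ‖f t x + g t x‖ ^ 2 ≤ 2 * ‖f t x‖ ^ 2 + 2 * ‖g t x‖ ^ 2 := fun x => by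
    have := pow_le_pow_left₀ (norm_nonneg _) (norm_add_le (f t x) (g t x)) 2
    nlinarith [sq_nonneg (‖f t x‖ - ‖g t x‖)]
  have hbi := ((hK t ht).1.const_mul 2).add ((hL t ht).1.const_mul 2)
  have hi : Integrable (fun x => ‖f t x + g t x‖ ^ 2) := hbi.mono'
    (((continuous_slice cf t).add (continuous_slice cg t)).norm.pow 2).aestronglyMeasurable
    (Eventually.of_forall fun x => by rw [Real.norm_of_nonneg (by positivity)]; exact hb x)
  refine ⟨hi, (integral_mono hi hbi hb).trans ?_⟩
  simp only [Pi.add_apply]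
  rw [integral_add ((hK t ht).1.const_mul 2) ((hL t ht).1.const_mul 2), integral_const_mul,
    integral_const_mul]
  linarith [(hK t ht).2, (hL t ht).2]

theorem L2Bdd.neg {τ : ℝ} {f : ℝ → ℝ × ℝ → ℂ} (hf : L2Bdd τ f) :
    L2Bdd τ (fun t x => -f t x) := by
  simpa [L2Bdd] using hf

theorem L2Bdd.conj {τ : ℝ} {f : ℝ → ℝ × ℝ → ℂ} (hf : L2Bdd τ f) :
    L2Bdd τ (fun t x => conj (f t x)) := by
  simpa [L2Bdd] using hf

theorem L1Bdd.mono {τ τ' : ℝ} {f : ℝ → ℝ × ℝ → ℂ} (hf : L1Bdd τ f) (h : τ' ≤ τ) : L1Bdd τ' f :=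
  hf.imp fun _ hK t ht => hK t ⟨ht.1, ht.2.trans h⟩

theorem L2Bdd.mono {τ τ' : ℝ} {f : ℝ → ℝ × ℝ → ℂ} (hf : L2Bdd τ f) (h : τ' ≤ τ) : L2Bdd τ' f :=
  hf.imp fun _ hK t ht => hK t ⟨ht.1, ht.2.trans h⟩

theorem L1Bdd.balance {τ : ℝ} {q qt P P' S S' Q : ℝ → ℝ × ℝ → ℂ}
    (hq : Continuous (uncurry q)) (hqt : Continuous (uncurry qt))
    (hP : Continuous (uncurry P)) (hP' : Continuous (uncurry P'))
    (hS : Continuous (uncurry S)) (hS' : Continuous (uncurry S'))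
    (hQ : Continuous (uncurry Q))
    (dq : ∀ t ∈ Ioo 0 τ, ∀ x, HasDerivAt (fun s => q s x) (qt t x) t)
    (dP : ∀ t a b, HasDerivAt (fun a => P t (a, b)) (P' t (a, b)) a)
    (dS : ∀ t a b, HasDerivAt (fun b => S t (a, b)) (S' t (a, b)) b)
    (heq : ∀ t ∈ Icc 0 τ, ∀ x, qt t x = P' t x + S' t x + Q t x)
    (iq : L1Bdd τ q) (iP : L1Bdd τ P) (iS : L1Bdd τ S) (iQ : L1Bdd τ Q)
    {t : ℝ} (ht : t ∈ Icc 0 τ) :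
    (∫ x, q t x) - ∫ x, q 0 x = ∫ s in (0 : ℝ)..t, ∫ x, Q s x := by
  obtain ⟨K₀, h₀⟩ := iq
  obtain ⟨K₁, h₁⟩ := iP
  obtain ⟨K₂, h₂⟩ := iS
  obtain ⟨K₃, h₃⟩ := iQ
  exact balance_law (K := max K₁ (max K₂ K₃)) hq hqt hP hP' hS hS' hQ dq dP dS heq
    (fun t ht => (h₀ t ht).1)
    (fun t ht => (h₁ t ht).1) (fun t ht => (h₁ t ht).2.trans (le_max_left _ _))
    (fun t ht => (h₂ t ht).1)
    (fun t ht => (h₂ t ht).2.trans ((le_max_left _ _).trans (le_max_right _ _)))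
    (fun t ht => (h₃ t ht).1)
    (fun t ht => (h₃ t ht).2.trans ((le_max_right _ _).trans (le_max_right _ _))) ht

/-! ### Regular functions on a time slab -/

/-- `u` is `C¹` in time on `(0, τ)` and `C²` in space, with the indicated derivatives, all of them
continuous. -/
structure Reg (τ : ℝ) (u ut ua ub uaa ubb : ℝ → ℝ × ℝ → ℂ) : Prop where
  cu : Continuous (uncurry u)
  cut : Continuous (uncurry ut)
  cua : Continuous (uncurry ua)
  cub : Continuous (uncurry ub)
  cuaa : Continuous (uncurry uaa)
  cubb : Continuous (uncurry ubb)
  dt : ∀ t ∈ Ioo 0 τ, ∀ x, HasDerivAt (fun s => u s x) (ut t x) t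
  da : ∀ t a b, HasDerivAt (fun a => u t (a, b)) (ua t (a, b)) a
  db : ∀ t a b, HasDerivAt (fun b => u t (a, b)) (ub t (a, b)) b
  daa : ∀ t a b, HasDerivAt (fun a => ua t (a, b)) (uaa t (a, b)) a
  dbb : ∀ t a b, HasDerivAt (fun b => ub t (a, b)) (ubb t (a, b)) b

/-- `u ∈ L^∞(0, τ; H¹)` solves `∂ₜ u = (i/2) Δu - i N`. -/
structure Schro (τ : ℝ) (u ut ua ub uaa ubb N : ℝ → ℝ × ℝ → ℂ) : Prop
    extends Reg τ u ut ua ub uaa ubb where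
  cN : Continuous (uncurry N)
  bu : L2Bdd τ u
  bua : L2Bdd τ ua
  bub : L2Bdd τ ub
  pde : ∀ t ∈ Icc 0 τ, ∀ x,
    ut t x = Complex.I / 2 * (uaa t x + ubb t x) - Complex.I * N t x

/-- The `L²` identity for the Schrödinger equation. -/
theorem Schro.integral_sq {τ : ℝ} {u ut ua ub uaa ubb N : ℝ → ℝ × ℝ → ℂ}
    (h : Schro τ u ut ua ub uaa ubb N) (hN : L1Bdd τ (fun t x => N t x * conj (u t x)))
    {t : ℝ} (ht : t ∈ Icc 0 τ) :
    (∫ x, ‖u t x‖ ^ 2) - ∫ x, ‖u 0 x‖ ^ 2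
      = ∫ s in (0 : ℝ)..t, ∫ x, 2 * (N s x * conj (u s x)).im := by
  have cc : ∀ {f : ℝ → ℝ × ℝ → ℂ}, Continuous (uncurry f) →
      Continuous (uncurry fun t x => conj (f t x)) := fun hf => Complex.continuous_conj.comp hf
  have hcd : ∀ {f : ℝ → ℂ} {f' : ℂ} {s : ℝ}, HasDerivAt f f' s →
      HasDerivAt (fun s => conj (f s)) (conj f') s := fun hf => by
    simpa using hf.star
  have bdd : ∀ {f : ℝ → ℝ × ℝ → ℂ}, Continuous (uncurry f) → L2Bdd τ f →
      L1Bdd τ (fun t x => Complex.I / 2 * (f t x * conj (u t x)) +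
        -(Complex.I / 2) * (u t x * conj (f t x))) := fun cf bf =>
    ((bf.mul h.bu.conj cf (cc h.cu)).const_mul _).add
      ((h.bu.mul bf.conj h.cu (cc cf)).const_mul _)
  have cont : ∀ {f g : ℝ → ℝ × ℝ → ℂ}, Continuous (uncurry f) → Continuous (uncurry g) →
      Continuous (uncurry fun t x => Complex.I / 2 * (f t x * conj (g t x)) +
        -(Complex.I / 2) * (g t x * conj (f t x))) := fun cf cg =>
    (continuous_const.mul (cf.mul (cc cg))).add (continuous_const.mul (cg.mul (cc cf)))
  have cNu : Continuous (uncurry fun t x => N t x * conj (u t x)) := h.cN.mul (cc h.cu)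
  have cQ : Continuous (uncurry fun t x => -Complex.I * (N t x * conj (u t x))
      + Complex.I * conj (N t x * conj (u t x))) :=
    (continuous_const.mul cNu).add (continuous_const.mul (cc cNu))
  have bN' : L1Bdd τ (fun t x => conj (N t x * conj (u t x))) :=
    hN.of_norm_le (cc cNu) (fun t _ x => by rw [RCLike.norm_conj])
  -- Density |u|², flux (i/2)(ū∇u - u∇ū), source -iNū plus its conjugate, that is 2 Im(Nū).
  have key := L1Bdd.balance (τ := τ)
    (q := fun t x => u t x * conj (u t x))
    (qt := fun t x => ut t x * conj (u t x) + u t x * conj (ut t x))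
    (P := fun t x => Complex.I / 2 * (ua t x * conj (u t x)) +
        -(Complex.I / 2) * (u t x * conj (ua t x)))
    (P' := fun t x => Complex.I / 2 * (uaa t x * conj (u t x)) +
        -(Complex.I / 2) * (u t x * conj (uaa t x)))
    (S := fun t x => Complex.I / 2 * (ub t x * conj (u t x)) +
        -(Complex.I / 2) * (u t x * conj (ub t x)))
    (S' := fun t x => Complex.I / 2 * (ubb t x * conj (u t x)) +
        -(Complex.I / 2) * (u t x * conj (ubb t x)))
    (Q := fun t x => -Complex.I * (N t x * conj (u t x))
      + Complex.I * conj (N t x * conj (u t x)))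
    (h.cu.mul (cc h.cu)) ((h.cut.mul (cc h.cu)).add (h.cu.mul (cc h.cut)))
    (cont h.cua h.cu) (cont h.cuaa h.cu) (cont h.cub h.cu) (cont h.cubb h.cu) cQ
    (fun t ht x => (h.dt t ht x).mul (hcd (h.dt t ht x)))
    (fun t a b => by
      have := (((h.daa t a b).mul (hcd (h.da t a b))).const_mul (Complex.I / 2)).add
        (((h.da t a b).mul (hcd (h.daa t a b))).const_mul (-(Complex.I / 2)))
      exact this.congr_deriv (by ring))
    (fun t a b => by
      have := (((h.dbb t a b).mul (hcd (h.db t a b))).const_mul (Complex.I / 2)).add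
        (((h.db t a b).mul (hcd (h.dbb t a b))).const_mul (-(Complex.I / 2)))
      exact this.congr_deriv (by ring))
    (fun t ht x => by
      have hI : conj (Complex.I / 2) = -(Complex.I / 2) := by simp [map_ofNat]; ring
      rw [h.pde t ht x]
      simp only [map_sub, map_mul, map_add, hI, Complex.conj_I, Complex.conj_conj]
      ring)
    (h.bu.mul h.bu.conj h.cu (cc h.cu)) (bdd h.cua h.bua) (bdd h.cub h.bub)
    ((hN.const_mul _).add (bN'.const_mul _)) ht
  have e1 : ∀ t x, u t x * conj (u t x) = ((‖u t x‖ ^ 2 : ℝ) : ℂ) := fun t x => by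
    rw [Complex.mul_conj, Complex.normSq_eq_norm_sq]
  have e2 : ∀ t x, -Complex.I * (N t x * conj (u t x)) + Complex.I * conj (N t x * conj (u t x))
      = ((2 * (N t x * conj (u t x)).im : ℝ) : ℂ) := fun t x => by
    apply Complex.ext <;> (simp; try ring)
  simp_rw [e1, e2, integral_complex_ofReal] at key
  rw [intervalIntegral.integral_ofReal] at key
  exact_mod_cast key

/-! ### Duhamel's formula against the regularised kernel -/

/-- A Gaussian majorant. -/
def gaussMaj (c : ℝ) (x : ℝ × ℝ) : ℝ := Real.exp (-c * x.1 ^ 2) * Real.exp (-c * x.2 ^ 2)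

theorem integrable_gaussMaj {c : ℝ} (hc : 0 < c) : Integrable (gaussMaj c) :=
  (integrable_exp_neg_mul_sq hc).mul_prod (integrable_exp_neg_mul_sq hc)

/-- Half of the Gaussian exponent absorbs the quadratic factor. -/
theorem sq_mul_exp_le {c : ℝ} (hc : 0 < c) (r : ℝ) :
    r ^ 2 * Real.exp (-(2 * c) * r ^ 2) ≤ c⁻¹ * Real.exp (-c * r ^ 2) := by
  have h1 : c * r ^ 2 ≤ Real.exp (c * r ^ 2) := by linarith [Real.add_one_le_exp (c * r ^ 2)]
  have h2 : Real.exp (-(2 * c) * r ^ 2) = Real.exp (-c * r ^ 2) * Real.exp (-c * r ^ 2) := by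
    rw [← Real.exp_add]; ring_nf
  have h3 : Real.exp (c * r ^ 2) * Real.exp (-c * r ^ 2) = 1 := by
    rw [← Real.exp_add]; simp
  have h4 := Real.exp_pos (-c * r ^ 2)
  rw [h2, ← mul_assoc]
  refine mul_le_mul_of_nonneg_right ?_ h4.le
  rw [inv_eq_one_div, le_div_iff₀ hc, ← h3]
  nlinarith

/-- Uniform Gaussian bounds for the kernels with `Re z = ε` and `|Im z| ≤ R`. -/
theorem exists_kern_majorant {ε : ℝ} (hε : 0 < ε) (R : ℝ) : ∃ C c : ℝ, 0 < c ∧ 0 ≤ C ∧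
    ∀ z : ℂ, z.re = ε → |z.im| ≤ R → ∀ x : ℝ × ℝ,
      ‖kern z x‖ ^ 2 ≤ C * gaussMaj c x ∧ ‖(x.1 : ℂ) / z * kern z x‖ ^ 2 ≤ C * gaussMaj c x
        ∧ ‖(x.2 : ℂ) / z * kern z x‖ ^ 2 ≤ C * gaussMaj c x := by
  set A := ((2 * Real.pi * ε)⁻¹) ^ 2 with hA
  set c := ε / (2 * (ε ^ 2 + R ^ 2)) with hc
  have hc0 : 0 < c := by positivity
  have hA0 : 0 ≤ A := by positivity
  set C := A + A * (ε ^ 2)⁻¹ * c⁻¹ with hC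
  refine ⟨C, c, hc0, by positivity, fun z hz hzR x => ?_⟩
  have hn : ε ≤ ‖z‖ := by rw [← hz]; exact Complex.re_le_norm z
  have hn0 : 0 < ‖z‖ := hε.trans_le hn
  have hsq : Complex.normSq z ≤ ε ^ 2 + R ^ 2 := by
    rw [Complex.normSq_apply, hz]
    have := abs_nonneg z.im
    nlinarith [sq_abs z.im, pow_le_pow_left₀ this hzR 2]
  have hsq0 : 0 < Complex.normSq z := by rw [Complex.normSq_eq_norm_sq]; positivity
  have hcz : c ≤ z.re / (2 * Complex.normSq z) := by
    rw [hc, hz]; gcongr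
  have hg : ∀ r, ‖gauss z r‖ ^ 2 ≤ Real.exp (-(2 * c) * r ^ 2) := by
    intro r
    rw [norm_gauss, ← Real.exp_nat_mul]
    apply Real.exp_le_exp.2
    push_cast
    nlinarith [mul_le_mul_of_nonneg_right hcz (sq_nonneg r)]
  have hg' : ∀ r : ℝ, Real.exp (-(2 * c) * r ^ 2) ≤ Real.exp (-c * r ^ 2) := fun r => by
    apply Real.exp_le_exp.2; nlinarith [mul_nonneg hc0.le (sq_nonneg r)]
  have hk : ‖kern z x‖ ^ 2 ≤ A * (Real.exp (-(2 * c) * x.1 ^ 2) * Real.exp (-(2 * c) * x.2 ^ 2)) := by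
    rw [norm_kern_eq, mul_pow, mul_pow]
    have : ((2 * Real.pi * ‖z‖)⁻¹) ^ 2 ≤ A := by rw [hA]; gcongr
    have h1 := hg x.1
    have h2 := hg x.2
    gcongr
  have hM : 0 ≤ gaussMaj c x := by unfold gaussMaj; positivity
  have hzi : (‖z‖ ^ 2)⁻¹ ≤ (ε ^ 2)⁻¹ := by gcongr
  refine ⟨?_, ?_, ?_⟩
  · calc _ ≤ A * gaussMaj c x := hk.trans (by
          unfold gaussMaj
          have h1 := hg' x.1
          have h2 := hg' x.2
          gcongr)
      _ ≤ C * gaussMaj c x := by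
          apply mul_le_mul_of_nonneg_right _ hM
          rw [hC]; linarith [show 0 ≤ A * (ε ^ 2)⁻¹ * c⁻¹ by positivity]
  · rw [norm_mul, mul_pow, norm_div, Complex.norm_real, Real.norm_eq_abs, div_pow, sq_abs]
    calc _ ≤ x.1 ^ 2 * (ε ^ 2)⁻¹ *
          (A * (Real.exp (-(2 * c) * x.1 ^ 2) * Real.exp (-(2 * c) * x.2 ^ 2))) := by
          rw [div_eq_mul_inv]; gcongr
      _ = A * (ε ^ 2)⁻¹ * ((x.1 ^ 2 * Real.exp (-(2 * c) * x.1 ^ 2))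
          * Real.exp (-(2 * c) * x.2 ^ 2)) := by ring
      _ ≤ A * (ε ^ 2)⁻¹ * ((c⁻¹ * Real.exp (-c * x.1 ^ 2)) * Real.exp (-c * x.2 ^ 2)) := by
          have h1 := sq_mul_exp_le hc0 x.1
          have h2 := hg' x.2
          gcongr
      _ = A * (ε ^ 2)⁻¹ * c⁻¹ * gaussMaj c x := by unfold gaussMaj; ring
      _ ≤ C * gaussMaj c x := by
          apply mul_le_mul_of_nonneg_right _ hM
          rw [hC]; linarith
  · rw [norm_mul, mul_pow, norm_div, Complex.norm_real, Real.norm_eq_abs, div_pow, sq_abs]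
    calc _ ≤ x.2 ^ 2 * (ε ^ 2)⁻¹ *
          (A * (Real.exp (-(2 * c) * x.1 ^ 2) * Real.exp (-(2 * c) * x.2 ^ 2))) := by
          rw [div_eq_mul_inv]; gcongr
      _ = A * (ε ^ 2)⁻¹ * (Real.exp (-(2 * c) * x.1 ^ 2)
          * (x.2 ^ 2 * Real.exp (-(2 * c) * x.2 ^ 2))) := by ring
      _ ≤ A * (ε ^ 2)⁻¹ * (Real.exp (-c * x.1 ^ 2) * (c⁻¹ * Real.exp (-c * x.2 ^ 2))) := by
          have h1 := sq_mul_exp_le hc0 x.2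
          have h2 := hg' x.1
          gcongr
      _ = A * (ε ^ 2)⁻¹ * c⁻¹ * gaussMaj c x := by unfold gaussMaj; ring
      _ ≤ C * gaussMaj c x := by
          apply mul_le_mul_of_nonneg_right _ hM
          rw [hC]; linarith

/-! ### Derivatives of the kernel in space and in complex time. -/

theorem kern_hasDerivAt_fst {z : ℂ} (hz : z ≠ 0) (x : ℝ × ℝ) (a b : ℝ) :
    HasDerivAt (fun a => kern z (x - (a, b)))
      (((x.1 - a : ℝ) : ℂ) / z * kern z (x - (a, b))) a := by
  have h1 : HasDerivAt (fun a : ℝ => ((x.1 - a : ℝ) : ℂ)) (-1) a := by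
    simpa using ((hasDerivAt_id a).const_sub x.1).ofReal_comp
  have h2 : HasDerivAt (fun a : ℝ => -((x.1 - a : ℝ) : ℂ) ^ 2 / (2 * z))
      (((x.1 - a : ℝ) : ℂ) / z) a := by
    refine HasDerivAt.congr_deriv (((h1.pow 2).neg).div_const (2 * z)) ?_
    field_simp
    simp
  have h3 := ((h2.cexp).mul_const (gauss z (x.2 - b))).const_mul ((2 * Real.pi * z)⁻¹)
  have h4 : (fun a => kern z (x - (a, b))) = fun y => (2 * (Real.pi : ℂ) * z)⁻¹ *
      (Complex.exp (-((x.1 - y : ℝ) : ℂ) ^ 2 / (2 * z)) * gauss z (x.2 - b)) := rfl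
  rw [h4]
  refine h3.congr_deriv ?_
  simp only [kern, gauss, Prod.fst_sub, Prod.snd_sub]
  ring

theorem kern_hasDerivAt_snd {z : ℂ} (hz : z ≠ 0) (x : ℝ × ℝ) (a b : ℝ) :
    HasDerivAt (fun b => kern z (x - (a, b)))
      (((x.2 - b : ℝ) : ℂ) / z * kern z (x - (a, b))) b := by
  have h := kern_hasDerivAt_fst hz (x.2, x.1) b a
  have e : (fun b => kern z (x - (a, b))) = fun b => kern z ((x.2, x.1) - (b, a)) := by
    ext b; simp only [kern, Prod.fst_sub, Prod.snd_sub]; ring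
  rw [e]
  refine h.congr_deriv ?_
  · simp only [kern, Prod.fst_sub, Prod.snd_sub]; ring

/-- Complex time moves with velocity -i in `s`; compared with the space derivatives, the bracket is
half the Laplacian of the kernel divided by the kernel, so the kernel solves the adjoint Schrödinger
equation. -/
theorem kern_hasDerivAt_time {ε : ℝ} (hε : 0 < ε) (t s : ℝ) (w : ℝ × ℝ) :
    HasDerivAt (fun s : ℝ => kern (ε + Complex.I * (t - s : ℝ)) w)
      (-Complex.I * (-(1 / (ε + Complex.I * (t - s : ℝ)))
        + (w.1 ^ 2 + w.2 ^ 2) / (2 * (ε + Complex.I * (t - s : ℝ)) ^ 2))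
        * kern (ε + Complex.I * (t - s : ℝ)) w) s := by
  set z : ℂ := ε + Complex.I * (t - s : ℝ) with hz
  have z0 : z ≠ 0 := ne_zero_of_re_pos (by simp [hz, hε])
  have pi0 : (Real.pi : ℂ) ≠ 0 := by exact_mod_cast Real.pi_ne_zero
  have h1 : HasDerivAt (fun s : ℝ => (ε + Complex.I * (t - s : ℝ) : ℂ)) (-Complex.I) s := by
    have := (((hasDerivAt_id s).const_sub t).ofReal_comp.const_mul Complex.I).const_add (ε : ℂ)
    simpa using this
  have h2 : ∀ r : ℝ, HasDerivAt (fun s : ℝ => gauss (ε + Complex.I * (t - s : ℝ)) r)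
      (-Complex.I * (r ^ 2 / (2 * z ^ 2)) * gauss z r) s := by
    intro r
    have h3 : HasDerivAt (fun s : ℝ => -(r : ℂ) ^ 2 / (2 * (ε + Complex.I * (t - s : ℝ))))
        (-Complex.I * (r ^ 2 / (2 * z ^ 2))) s := by
      have := (hasDerivAt_const s (-(r : ℂ) ^ 2)).div (h1.const_mul 2)
        (mul_ne_zero two_ne_zero z0)
      refine HasDerivAt.congr_deriv this ?_
      rw [← hz]
      field_simp
      ring
    refine HasDerivAt.congr_deriv h3.cexp ?_
    rw [← hz, gauss]; ring
  have h4 : HasDerivAt (fun s : ℝ => (2 * Real.pi * (ε + Complex.I * (t - s : ℝ)) : ℂ)⁻¹)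
      (Complex.I / z * (2 * Real.pi * z)⁻¹) s := by
    have := (h1.const_mul (2 * Real.pi : ℂ)).inv (by rw [← hz]; simp [z0])
    refine HasDerivAt.congr_deriv this ?_
    rw [← hz]
    field_simp
  refine HasDerivAt.congr_deriv (h4.mul ((h2 w.1).mul (h2 w.2))) ?_
  rw [← hz]
  simp only [kern]
  field_simp
  ring

/-- The complex time `ε + i (t - s)`. -/
def cplxTime (ε t s : ℝ) : ℂ := ε + Complex.I * (t - s : ℝ)

theorem cplxTime_re (ε t s : ℝ) : (cplxTime ε t s).re = ε := by simp [cplxTime]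

theorem cplxTime_im (ε t s : ℝ) : (cplxTime ε t s).im = t - s := by simp [cplxTime]

theorem cplxTime_ne_zero {ε : ℝ} (hε : 0 < ε) (t s : ℝ) : cplxTime ε t s ≠ 0 :=
  ne_zero_of_re_pos (by rwa [cplxTime_re])

theorem cplxTime_self (ε t : ℝ) : cplxTime ε t t = ε := by simp [cplxTime]

theorem cplxTime_continuous (ε : ℝ) : Continuous fun p : ℝ × ℝ => cplxTime ε p.1 p.2 := by
  unfold cplxTime; fun_prop

theorem kern_cplxTime_continuous {ε : ℝ} (hε : 0 < ε) :
    Continuous fun p : (ℝ × ℝ) × (ℝ × ℝ) => kern (cplxTime ε p.1.1 p.1.2) p.2 := by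
  have hz : Continuous fun p : (ℝ × ℝ) × (ℝ × ℝ) => cplxTime ε p.1.1 p.1.2 :=
    (cplxTime_continuous ε).comp continuous_fst
  have h0 : ∀ p : (ℝ × ℝ) × (ℝ × ℝ), cplxTime ε p.1.1 p.1.2 ≠ 0 := fun p => cplxTime_ne_zero hε _ _
  unfold kern gauss
  refine ((continuous_const.mul hz).inv₀ fun p => ?_).mul (.mul ?_ ?_)
  · simp [h0 p, Real.pi_ne_zero]
  · refine Complex.continuous_exp.comp (Continuous.div (by fun_prop) (by fun_prop) fun p => ?_)
    simp [h0 p]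
  · refine Complex.continuous_exp.comp (Continuous.div (by fun_prop) (by fun_prop) fun p => ?_)
    simp [h0 p]

theorem l2Bdd_of_sq_le_gaussMaj {τ C c : ℝ} (hc : 0 < c) {k : ℝ → ℝ × ℝ → ℂ}
    (hk : Continuous (uncurry k)) (x : ℝ × ℝ)
    (h : ∀ s ∈ Icc 0 τ, ∀ y, ‖k s y‖ ^ 2 ≤ C * gaussMaj c (x - y)) : L2Bdd τ k := by
  refine ⟨∫ y, C * gaussMaj c (x - y), fun s hs => ?_⟩
  have hi : Integrable fun y => C * gaussMaj c (x - y) :=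
    ((integrable_gaussMaj hc).comp_sub_left x).const_mul C
  have hi' : Integrable fun y => ‖k s y‖ ^ 2 := hi.mono'
    ((continuous_slice hk s).norm.pow 2).aestronglyMeasurable
    (Eventually.of_forall fun y => by rw [Real.norm_of_nonneg (by positivity)]; exact h s hs y)
  exact ⟨hi', integral_mono hi' hi (h s hs)⟩

theorem L1Bdd.bdd_mul {τ c : ℝ} {k f : ℝ → ℝ × ℝ → ℂ} (hf : L1Bdd τ f)
    (cf : Continuous (uncurry f)) (ck : Continuous (uncurry k))
    (hk : ∀ t ∈ Icc 0 τ, ∀ x, ‖k t x‖ ≤ c) :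
    L1Bdd τ (fun t x => k t x * f t x) := by
  refine (hf.const_mul (c : ℂ)).of_norm_le (ck.mul cf) fun t ht x => ?_
  rw [norm_mul, norm_mul, Complex.norm_real]
  exact mul_le_mul_of_nonneg_right ((hk t ht x).trans (le_abs_self c)) (norm_nonneg _)

theorem Reg.mono {τ τ' : ℝ} {u ut ua ub uaa ubb : ℝ → ℝ × ℝ → ℂ}
    (h : Reg τ u ut ua ub uaa ubb) (hτ : τ' ≤ τ) : Reg τ' u ut ua ub uaa ubb :=
  { h with dt := fun t ht x => h.dt t ⟨ht.1, ht.2.trans_le hτ⟩ x }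

theorem Schro.mono {τ τ' : ℝ} {u ut ua ub uaa ubb N : ℝ → ℝ × ℝ → ℂ}
    (h : Schro τ u ut ua ub uaa ubb N) (hτ : τ' ≤ τ) : Schro τ' u ut ua ub uaa ubb N :=
  { h.toReg.mono hτ with
    cN := h.cN
    bu := h.bu.mono hτ
    bua := h.bua.mono hτ
    bub := h.bub.mono hτ
    pde := fun t ht x => h.pde t ⟨ht.1, ht.2.trans hτ⟩ x }

/-- Pairing of a solution with a solution of the adjoint equation. -/
theorem Schro.green {τ : ℝ} {u ut ua ub uaa ubb N k ks ka kb kaa kbb : ℝ → ℝ × ℝ → ℂ}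
    (h : Schro τ u ut ua ub uaa ubb N) (hk : Reg τ k ks ka kb kaa kbb)
    (bk : L2Bdd τ k) (bka : L2Bdd τ ka) (bkb : L2Bdd τ kb)
    (adj : ∀ s x, ks s x = -Complex.I / 2 * (kaa s x + kbb s x))
    (bkN : L1Bdd τ (fun s y => k s y * N s y)) {t : ℝ} (ht : t ∈ Icc 0 τ) :
    (∫ y, k t y * u t y) - ∫ y, k 0 y * u 0 y
      = ∫ s in (0 : ℝ)..t, ∫ y, -Complex.I * (k s y * N s y) := by
  have bPS : ∀ {f g : ℝ → ℝ × ℝ → ℂ}, Continuous (uncurry f) → Continuous (uncurry g) →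
      L2Bdd τ f → L2Bdd τ g → L1Bdd τ (fun s y => Complex.I / 2 * (k s y * f s y - g s y * u s y)) :=
    fun cf cg bf bg => ((bk.mul bf hk.cu cf).sub (bg.mul h.bu cg h.cu)).const_mul _
  exact L1Bdd.balance (τ := τ)
    (q := fun s y => k s y * u s y)
    (qt := fun s y => ks s y * u s y + k s y * ut s y)
    (P := fun s y => Complex.I / 2 * (k s y * ua s y - ka s y * u s y))
    (P' := fun s y => Complex.I / 2 * (k s y * uaa s y - kaa s y * u s y))
    (S := fun s y => Complex.I / 2 * (k s y * ub s y - kb s y * u s y))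
    (S' := fun s y => Complex.I / 2 * (k s y * ubb s y - kbb s y * u s y))
    (Q := fun s y => -Complex.I * (k s y * N s y))
    (hk.cu.mul h.cu) ((hk.cut.mul h.cu).add (hk.cu.mul h.cut))
    (continuous_const.mul ((hk.cu.mul h.cua).sub (hk.cua.mul h.cu)))
    (continuous_const.mul ((hk.cu.mul h.cuaa).sub (hk.cuaa.mul h.cu)))
    (continuous_const.mul ((hk.cu.mul h.cub).sub (hk.cub.mul h.cu)))
    (continuous_const.mul ((hk.cu.mul h.cubb).sub (hk.cubb.mul h.cu)))
    (continuous_const.mul (hk.cu.mul h.cN))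
    (fun s hs y => (hk.dt s hs y).mul (h.dt s hs y))
    (fun s a b => by
      refine HasDerivAt.congr_deriv ((((hk.da s a b).mul (h.daa s a b)).sub
        ((hk.daa s a b).mul (h.da s a b))).const_mul (Complex.I / 2)) ?_
      ring)
    (fun s a b => by
      refine HasDerivAt.congr_deriv ((((hk.db s a b).mul (h.dbb s a b)).sub
        ((hk.dbb s a b).mul (h.db s a b))).const_mul (Complex.I / 2)) ?_
      ring)
    (fun s hs y => by rw [h.pde s hs y, adj]; ring)
    (bk.mul h.bu hk.cu h.cu) (bPS h.cua hk.cua h.bua bka) (bPS h.cub hk.cub h.bub bkb)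
    (bkN.const_mul _) ht

/-- The backward kernel `K_{ε + i(t - s)}(x - y)` as a function of `(s, y)`. -/
def bkern (ε t : ℝ) (x : ℝ × ℝ) (s : ℝ) (y : ℝ × ℝ) : ℂ := kern (cplxTime ε t s) (x - y)

/-- The derivative of `bkern` in the first variable. -/
def bkernA (ε t : ℝ) (x : ℝ × ℝ) (s : ℝ) (y : ℝ × ℝ) : ℂ :=
  ((x.1 - y.1 : ℝ) : ℂ) / cplxTime ε t s * bkern ε t x s y

/-- The derivative of `bkern` in the second variable. -/
def bkernB (ε t : ℝ) (x : ℝ × ℝ) (s : ℝ) (y : ℝ × ℝ) : ℂ :=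
  ((x.2 - y.2 : ℝ) : ℂ) / cplxTime ε t s * bkern ε t x s y

/-- The second derivative of `bkern` in the first variable. -/
def bkernAA (ε t : ℝ) (x : ℝ × ℝ) (s : ℝ) (y : ℝ × ℝ) : ℂ :=
  -(1 / cplxTime ε t s) * bkern ε t x s y
    + ((x.1 - y.1 : ℝ) : ℂ) / cplxTime ε t s * bkernA ε t x s y

/-- The second derivative of `bkern` in the second variable. -/
def bkernBB (ε t : ℝ) (x : ℝ × ℝ) (s : ℝ) (y : ℝ × ℝ) : ℂ :=
  -(1 / cplxTime ε t s) * bkern ε t x s y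
    + ((x.2 - y.2 : ℝ) : ℂ) / cplxTime ε t s * bkernB ε t x s y

/-- The time derivative is recorded in the form -(i/2)Δ, so that the adjoint equation required by
`Schro.green` holds by definition. -/
theorem bkern_reg {ε : ℝ} (hε : 0 < ε) (t : ℝ) (x : ℝ × ℝ) (τ : ℝ) :
    Reg τ (bkern ε t x) (fun s y => -Complex.I / 2 * (bkernAA ε t x s y + bkernBB ε t x s y))
      (bkernA ε t x) (bkernB ε t x) (bkernAA ε t x) (bkernBB ε t x) := by
  have z0 : ∀ s, cplxTime ε t s ≠ 0 := cplxTime_ne_zero hε t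
  have zc : Continuous (cplxTime ε t) :=
    (cplxTime_continuous ε).comp (by fun_prop : Continuous fun s : ℝ => (t, s))
  have czf : Continuous fun p : ℝ × ℝ × ℝ => cplxTime ε t p.1 := zc.comp continuous_fst
  have ck : Continuous (uncurry (bkern ε t x)) := by
    have h1 : Continuous fun p : ℝ × ℝ × ℝ => ((t, p.1), x - p.2) := by fun_prop
    have h := (kern_cplxTime_continuous hε).comp h1
    exact h
  have cl1 : Continuous fun p : ℝ × ℝ × ℝ => ((x.1 - p.2.1 : ℝ) : ℂ) / cplxTime ε t p.1 :=
    Continuous.div (by fun_prop) czf fun p => z0 p.1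
  have cl2 : Continuous fun p : ℝ × ℝ × ℝ => ((x.2 - p.2.2 : ℝ) : ℂ) / cplxTime ε t p.1 :=
    Continuous.div (by fun_prop) czf fun p => z0 p.1
  have cka : Continuous (uncurry (bkernA ε t x)) := cl1.mul ck
  have ckb : Continuous (uncurry (bkernB ε t x)) := cl2.mul ck
  have ckaa : Continuous (uncurry (bkernAA ε t x)) :=
    ((continuous_const.div czf fun p => z0 p.1).neg.mul ck).add (cl1.mul cka)
  have ckbb : Continuous (uncurry (bkernBB ε t x)) :=
    ((continuous_const.div czf fun p => z0 p.1).neg.mul ck).add (cl2.mul ckb)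
  have dka : ∀ s a b, HasDerivAt (fun a => bkern ε t x s (a, b)) (bkernA ε t x s (a, b)) a :=
    fun s a b => kern_hasDerivAt_fst (z0 s) x a b
  have dkb : ∀ s a b, HasDerivAt (fun b => bkern ε t x s (a, b)) (bkernB ε t x s (a, b)) b :=
    fun s a b => kern_hasDerivAt_snd (z0 s) x a b
  have dl : ∀ (s r a : ℝ), HasDerivAt (fun a : ℝ => ((r - a : ℝ) : ℂ) / cplxTime ε t s)
      (-(1 / cplxTime ε t s)) a := by
    intro s r a
    have h1 : HasDerivAt (fun a : ℝ => ((r - a : ℝ) : ℂ)) (-1) a := by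
      simpa using ((hasDerivAt_id a).const_sub r).ofReal_comp
    exact (h1.div_const (cplxTime ε t s)).congr_deriv (by ring)
  refine ⟨ck, continuous_const.mul (ckaa.add ckbb), cka, ckb, ckaa, ckbb, fun s _ y => ?_, dka, dkb,
    fun s a b => (dl s x.1 a).mul (dka s a b), fun s a b => (dl s x.2 b).mul (dkb s a b)⟩
  refine HasDerivAt.congr_deriv (kern_hasDerivAt_time hε t s (x - y)) ?_
  have e : (ε + Complex.I * (t - s : ℝ) : ℂ) = cplxTime ε t s := rfl
  have := z0 s
  rw [e]
  simp only [bkernAA, bkernBB, bkernA, bkernB, bkern, Prod.fst_sub, Prod.snd_sub]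
  field_simp
  ring

theorem norm_bkern_le {ε : ℝ} (hε : 0 < ε) (t : ℝ) (x : ℝ × ℝ) (s : ℝ) (y : ℝ × ℝ) :
    ‖bkern ε t x s y‖ ≤ (2 * Real.pi * ε)⁻¹ := by
  refine (norm_kern_le (by rwa [cplxTime_re]) _).trans ?_
  have : ε ≤ ‖cplxTime ε t s‖ := by
    have := Complex.re_le_norm (cplxTime ε t s)
    rwa [cplxTime_re] at this
  gcongr

theorem bkern_l2Bdd {ε : ℝ} (hε : 0 < ε) (t : ℝ) (x : ℝ × ℝ) :
    L2Bdd t (bkern ε t x) ∧ L2Bdd t (bkernA ε t x) ∧ L2Bdd t (bkernB ε t x) := by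
  obtain ⟨C, c, hc, -, hmaj⟩ := exists_kern_majorant hε t
  have zim : ∀ s ∈ Icc 0 t, |(cplxTime ε t s).im| ≤ t := by
    intro s hs
    rw [cplxTime_im, abs_le]; constructor <;> linarith [hs.1, hs.2]
  have hr := bkern_reg hε t x 0
  exact ⟨l2Bdd_of_sq_le_gaussMaj hc hr.cu x fun s hs y =>
      (hmaj _ (cplxTime_re _ _ _) (zim s hs) (x - y)).1,
    l2Bdd_of_sq_le_gaussMaj hc hr.cua x fun s hs y =>
      (hmaj _ (cplxTime_re _ _ _) (zim s hs) (x - y)).2.1,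
    l2Bdd_of_sq_le_gaussMaj hc hr.cub x fun s hs y =>
      (hmaj _ (cplxTime_re _ _ _) (zim s hs) (x - y)).2.2⟩

/-- The regularised kernel is both square integrable and bounded; the first pairs with the L² part
of the source, the second with the L¹ part. -/
theorem bkern_mul_l1Bdd {ε : ℝ} (hε : 0 < ε) {t : ℝ} (x : ℝ × ℝ) {N₁ N₂ : ℝ → ℝ × ℝ → ℂ}
    (cN₁ : Continuous (uncurry N₁)) (cN₂ : Continuous (uncurry N₂))
    (bN₁ : L2Bdd t N₁) (bN₂ : L1Bdd t N₂) :
    L1Bdd t (fun s y => bkern ε t x s y * N₁ s y) ∧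
      L1Bdd t (fun s y => bkern ε t x s y * N₂ s y) :=
  ⟨(bkern_l2Bdd hε t x).1.mul bN₁ (bkern_reg hε t x 0).cu cN₁,
    bN₂.bdd_mul cN₂ (bkern_reg hε t x 0).cu fun s _ y => norm_bkern_le hε t x s y⟩

theorem L1Bdd.intervalIntegrable {τ : ℝ} {f : ℝ → ℝ × ℝ → ℂ} (hf : L1Bdd τ f)
    (cf : Continuous (uncurry f)) (hτ : 0 ≤ τ) :
    IntervalIntegrable (fun s => ∫ x, f s x) volume 0 τ := by
  obtain ⟨K, hK⟩ := hf
  rw [intervalIntegrable_iff_integrableOn_Ioc_of_le hτ]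
  refine Measure.integrableOn_of_bounded (M := K) (by simp)
    (cf.stronglyMeasurable.integral_prod_right').aestronglyMeasurable ?_
  filter_upwards [ae_restrict_mem measurableSet_Ioc] with s hs
  exact (norm_integral_le_integral_norm _).trans (hK s ⟨hs.1.le, hs.2⟩).2

/-- Duhamel's formula, regularised by the heat kernel at time `ε`. -/
theorem Schro.duhamel {τ : ℝ} {u ut ua ub uaa ubb N N₁ N₂ : ℝ → ℝ × ℝ → ℂ}
    (h : Schro τ u ut ua ub uaa ubb N) (hN : ∀ t x, N t x = N₁ t x + N₂ t x)
    (cN₁ : Continuous (uncurry N₁)) (cN₂ : Continuous (uncurry N₂))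
    (bN₁ : L2Bdd τ N₁) (bN₂ : L1Bdd τ N₂) {ε : ℝ} (hε : 0 < ε)
    {t : ℝ} (ht : t ∈ Icc 0 τ) (x : ℝ × ℝ) :
    ∫ y, kern ε (x - y) * u t y = (∫ y, bkern ε t x 0 y * u 0 y)
      - Complex.I * (∫ s in (0 : ℝ)..t, ∫ y, bkern ε t x s y * N₁ s y)
      - Complex.I * ∫ s in (0 : ℝ)..t, ∫ y, bkern ε t x s y * N₂ s y := by
  obtain ⟨i₁, i₂⟩ := bkern_mul_l1Bdd hε x cN₁ cN₂ (bN₁.mono ht.2) (bN₂.mono ht.2)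
  obtain ⟨b₁, b₂, b₃⟩ := bkern_l2Bdd hε t x
  have hr := bkern_reg hε t x t
  have iN : L1Bdd t (fun s y => bkern ε t x s y * N s y) := by
    simpa only [hN, mul_add] using i₁.add i₂
  have key := (h.mono ht.2).green hr b₁ b₂ b₃ (fun s x => rfl) iN (t := t) ⟨ht.1, le_rfl⟩
  have e1 : ∫ s in (0 : ℝ)..t, ∫ y, -Complex.I * (bkern ε t x s y * N s y)
      = -Complex.I * ((∫ s in (0 : ℝ)..t, ∫ y, bkern ε t x s y * N₁ s y)
        + ∫ s in (0 : ℝ)..t, ∫ y, bkern ε t x s y * N₂ s y) := by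
    simp_rw [integral_const_mul]
    rw [intervalIntegral.integral_const_mul, ← intervalIntegral.integral_add
      (i₁.intervalIntegrable (hr.cu.mul cN₁) ht.1) (i₂.intervalIntegrable (hr.cu.mul cN₂) ht.1)]
    congr 1
    refine intervalIntegral.integral_congr fun s hs => ?_
    rw [uIcc_of_le ht.1] at hs
    obtain ⟨K₁, hK₁⟩ := i₁
    obtain ⟨K₂, hK₂⟩ := i₂
    rw [← integral_add (hK₁ s hs).1 (hK₂ s hs).1]
    simp_rw [hN, mul_add]
  -- At the final time the complex time is the real number ε, so the left side is `u t` smoothed by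
  -- the heat kernel.
  have e2 : ∀ y, bkern ε t x t y = kern ε (x - y) := fun y => by rw [bkern, cplxTime_self]
  simp_rw [e1, e2] at key
  rw [sub_eq_iff_eq_add] at key
  rw [key]
  ring

/-! ### The weakly singular time kernel -/

/-- The truncated kernel `|r|^{-1/2}` on `0 < |r| ≤ τ`. -/
def timeKern (τ r : ℝ) : ℝ := (Ioc 0 τ).indicator (fun r : ℝ => r ^ (-(1 / 2) : ℝ)) |r|

theorem timeKern_nonneg (τ r : ℝ) : 0 ≤ timeKern τ r :=
  indicator_nonneg (fun _ hr => Real.rpow_nonneg hr.1.le _) _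

/-- Twice ∫₀^τ r^{-1/2} dr. This √τ is the source of the smallness on short intervals. -/
theorem integral_timeKern {τ : ℝ} (hτ : 0 < τ) : ∫ r, timeKern τ r = 4 * √τ := by
  unfold timeKern
  rw [integral_comp_abs (f := (Ioc 0 τ).indicator fun r : ℝ => r ^ (-(1 / 2) : ℝ)),
    setIntegral_indicator measurableSet_Ioc,
    inter_eq_self_of_subset_right Ioc_subset_Ioi_self, ← intervalIntegral.integral_of_le hτ.le,
    integral_rpow (Or.inl (by norm_num)), Real.sqrt_eq_rpow]
  norm_num
  ring

/-- The integral of a non-integrable function is 0 by convention, so a nonzero value proves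
integrability. -/
theorem integrable_timeKern {τ : ℝ} (hτ : 0 < τ) : Integrable (timeKern τ) := by
  refine Integrable.of_integral_ne_zero ?_
  rw [integral_timeKern hτ]
  positivity

theorem inv_sqrt_le_timeKern {τ t s : ℝ} (ht : t ∈ Icc 0 τ) (hs : s ∈ Icc 0 τ) (hts : t ≠ s) :
    (√|t - s|)⁻¹ = timeKern τ (t - s) := by
  have h0 : 0 < |t - s| := abs_pos.2 (sub_ne_zero.2 hts)
  have h1 : |t - s| ≤ τ := by rw [abs_le]; constructor <;> linarith [ht.1, ht.2, hs.1, hs.2]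
  rw [timeKern, indicator_of_mem (show |t - s| ∈ Ioc 0 τ from ⟨h0, h1⟩), Real.rpow_neg h0.le,
    Real.sqrt_eq_rpow]

/-- A Schur test in time. -/
theorem norm_integral_timeKern_le {τ s : ℝ} (hτ : 0 < τ) (hs : 0 ≤ s) {C : ℝ} (hC : 0 ≤ C)
    {F : ℝ → ℝ → ℂ} {Y Z : ℝ → ℝ} (hY : IntegrableOn Y (Ioc 0 τ)) (hZ : IntegrableOn Z (Ioc 0 τ))
    (hY0 : ∀ t ∈ Ioc 0 τ, 0 ≤ Y t) (hZ0 : ∀ t ∈ Ioc 0 τ, 0 ≤ Z t)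
    (hF : ∀ t ∈ Ioc s τ, ∀ t' ∈ Ioc s τ, t ≠ t' →
      ‖F t t'‖ ≤ C * timeKern τ (t - t') * ((Y t + Z t') / 2)) :
    ‖∫ t in Ioc s τ, ∫ t' in Ioc s τ, F t t'‖
      ≤ 2 * C * √τ * ((∫ t in Ioc 0 τ, Y t) + ∫ t in Ioc 0 τ, Z t) := by
  have sub : Ioc s τ ⊆ Ioc 0 τ := Ioc_subset_Ioc_left hs
  -- Extension by zero turns the majorant into a convolution integrand on the whole line; its total
  -- mass is (C/2)·4√τ times the sum of the two integrals.
  obtain ⟨Y', hY'⟩ : ∃ Y' : ℝ → ℝ, Y' = (Ioc 0 τ).indicator Y := ⟨_, rfl⟩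
  obtain ⟨Z', hZ'⟩ : ∃ Z' : ℝ → ℝ, Z' = (Ioc 0 τ).indicator Z := ⟨_, rfl⟩
  have iY : Integrable Y' := by rw [hY']; exact hY.integrable_indicator measurableSet_Ioc
  have iZ : Integrable Z' := by rw [hZ']; exact hZ.integrable_indicator measurableSet_Ioc
  have eY : ∫ t, Y' t = ∫ t in Ioc 0 τ, Y t := by rw [hY', integral_indicator measurableSet_Ioc]
  have eZ : ∫ t, Z' t = ∫ t in Ioc 0 τ, Z t := by rw [hZ', integral_indicator measurableSet_Ioc]
  have nY : ∀ t, 0 ≤ Y' t := by rw [hY']; exact indicator_nonneg hY0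
  have nZ : ∀ t, 0 ≤ Z' t := by rw [hZ']; exact indicator_nonneg hZ0
  have ik := integrable_timeKern hτ
  have ksymm : ∀ r r', timeKern τ (r - r') = timeKern τ (r' - r) := fun r r' => by
    rw [timeKern, timeKern, abs_sub_comm]
  have A2 : Integrable (fun q : ℝ × ℝ => Z' q.2 * timeKern τ (q.1 - q.2)) (volume.prod volume) :=
    iZ.convolution_integrand (ContinuousLinearMap.mul ℝ ℝ) ik
  have A1 : Integrable (fun q : ℝ × ℝ => Y' q.1 * timeKern τ (q.1 - q.2)) (volume.prod volume) := by
    have := (iY.convolution_integrand (ContinuousLinearMap.mul ℝ ℝ) ik (μ := volume)).swap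
    refine this.congr (Eventually.of_forall fun q => ?_)
    simp only [comp_apply, Prod.fst_swap, Prod.snd_swap, ContinuousLinearMap.mul_apply']
    rw [ksymm]
  have I1 : ∫ q : ℝ × ℝ, Y' q.1 * timeKern τ (q.1 - q.2) ∂(volume.prod volume)
      = (∫ t in Ioc 0 τ, Y t) * (4 * √τ) := by
    rw [integral_prod _ A1]
    simp_rw [integral_const_mul, integral_sub_left_eq_self (timeKern τ) volume]
    rw [integral_mul_const, eY, integral_timeKern hτ]
  have I2 : ∫ q : ℝ × ℝ, Z' q.2 * timeKern τ (q.1 - q.2) ∂(volume.prod volume)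
      = (∫ t in Ioc 0 τ, Z t) * (4 * √τ) := by
    rw [integral_prod_symm _ A2]
    simp_rw [integral_const_mul, integral_sub_right_eq_self (timeKern τ)]
    rw [integral_mul_const, eZ, integral_timeKern hτ]
  have iB := (A1.add A2).const_mul (C / 2)
  have nB : ∀ t t', 0 ≤ C / 2 * (Y' t * timeKern τ (t - t') + Z' t' * timeKern τ (t - t')) :=
    fun t t' => mul_nonneg (by positivity) (add_nonneg
      (mul_nonneg (nY t) (timeKern_nonneg _ _)) (mul_nonneg (nZ t') (timeKern_nonneg _ _)))
  have key : ∀ᵐ t, t ∈ Ioc s τ → ‖∫ t' in Ioc s τ, F t t'‖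
      ≤ ∫ t', C / 2 * (Y' t * timeKern τ (t - t') + Z' t' * timeKern τ (t - t')) := by
    filter_upwards [iB.prod_right_ae] with t ht hts
    refine le_trans (norm_integral_le_of_norm_le
      (g := fun t' => C / 2 * (Y' t * timeKern τ (t - t') + Z' t' * timeKern τ (t - t')))
      ht.integrableOn ?_) (setIntegral_le_integral ht (Eventually.of_forall (nB t)))
    -- The hypothesis says nothing on the diagonal, which is negligible.
    have hne : ∀ᵐ t' : ℝ ∂volume.restrict (Ioc s τ), t' ≠ t :=
      ae_restrict_of_ae (Measure.ae_ne volume t)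
    filter_upwards [ae_restrict_mem measurableSet_Ioc, hne] with t' ht' hne
    refine (hF t hts t' ht' hne.symm).trans (le_of_eq ?_)
    rw [hY', hZ', indicator_of_mem (sub hts), indicator_of_mem (sub ht')]
    ring
  have iB' : Integrable fun t => ∫ t', C / 2 * (Y' t * timeKern τ (t - t')
      + Z' t' * timeKern τ (t - t')) := iB.integral_prod_left
  calc _ ≤ ∫ t in Ioc s τ, ∫ t', C / 2 * (Y' t * timeKern τ (t - t')
      + Z' t' * timeKern τ (t - t')) := by
        refine norm_integral_le_of_norm_le iB'.integrableOn ?_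
        exact (ae_restrict_iff' measurableSet_Ioc).2 key
    _ ≤ ∫ t, ∫ t', C / 2 * (Y' t * timeKern τ (t - t') + Z' t' * timeKern τ (t - t')) :=
        setIntegral_le_integral iB' (Eventually.of_forall fun t => integral_nonneg (nB t))
    _ = ∫ q : ℝ × ℝ, C / 2 * (Y' q.1 * timeKern τ (q.1 - q.2) + Z' q.2 * timeKern τ (q.1 - q.2))
          ∂(volume.prod volume) := (integral_prod _ iB).symm
    _ = _ := by
        rw [integral_const_mul, integral_add A1 A2, I1, I2]; ring

/-! ### Pairings with the regularised propagator -/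

/-- The pairing `⟨h, K_{ε + i(t - s)} * g⟩` (bilinear). -/
def pairing (ε t s : ℝ) (h g : ℝ × ℝ → ℂ) : ℂ := ∫ x, h x * ∫ y, bkern ε t x s y * g y

/-- The L² norm of the kernel sees only the real part ε of the complex time. It is finite for each
ε, which justifies Fubini, but diverges as ε → 0 and must not enter the final estimates. -/
theorem integral_norm_bkern_sq {ε : ℝ} (hε : 0 < ε) (t : ℝ) (x : ℝ × ℝ) (s : ℝ) :
    Integrable (fun y => ‖bkern ε t x s y‖ ^ 2) ∧
      ∫ y, ‖bkern ε t x s y‖ ^ 2 = (4 * Real.pi * ε)⁻¹ := by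
  have hz : 0 < (cplxTime ε t s).re := by rwa [cplxTime_re]
  have hn : 0 < ‖cplxTime ε t s‖ := norm_pos_iff.2 (cplxTime_ne_zero hε t s)
  refine ⟨(integrable_norm_kern_sq hz).comp_sub_left x, ?_⟩
  have e0 : ∫ y, ‖bkern ε t x s y‖ ^ 2 = ∫ y, ‖kern (cplxTime ε t s) y‖ ^ 2 :=
    integral_sub_left_eq_self (fun y => ‖kern (cplxTime ε t s) y‖ ^ 2) volume x
  have e1 : ∫ r, ‖gauss (cplxTime ε t s) r‖ ^ 2 = √(Real.pi * ‖cplxTime ε t s‖ ^ 2 / ε) := by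
    have : ∀ r, ‖gauss (cplxTime ε t s) r‖ ^ 2
        = Real.exp (-(ε / ‖cplxTime ε t s‖ ^ 2) * r ^ 2) := by
      intro r
      rw [norm_gauss, ← Real.exp_nat_mul, cplxTime_re, Complex.normSq_eq_norm_sq]
      congr 1
      push_cast
      field_simp
    simp_rw [this]
    rw [integral_gaussian, div_div_eq_mul_div]
  rw [e0]
  have e2 : ∀ y : ℝ × ℝ, ‖kern (cplxTime ε t s) y‖ ^ 2
      = ((2 * Real.pi * ‖cplxTime ε t s‖)⁻¹) ^ 2 *
        (‖gauss (cplxTime ε t s) y.1‖ ^ 2 * ‖gauss (cplxTime ε t s) y.2‖ ^ 2) := fun y => by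
    rw [norm_kern_eq]; ring
  simp_rw [e2]
  rw [integral_const_mul, Measure.volume_eq_prod,
    integral_prod_mul (fun r => ‖gauss (cplxTime ε t s) r‖ ^ 2)
      (fun r => ‖gauss (cplxTime ε t s) r‖ ^ 2), e1, Real.mul_self_sqrt (by positivity)]
  field_simp
  ring

theorem norm_integral_bkern_le_of_sq {ε : ℝ} (hε : 0 < ε) (t : ℝ) (x : ℝ × ℝ) (s : ℝ)
    {g : ℝ × ℝ → ℂ} (hg : Continuous g) (hg2 : Integrable fun y => ‖g y‖ ^ 2) :
    ‖∫ y, bkern ε t x s y * g y‖ ≤ √((4 * Real.pi * ε)⁻¹) * √(∫ y, ‖g y‖ ^ 2) := by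
  obtain ⟨i, e⟩ := integral_norm_bkern_sq hε t x s
  refine (norm_integral_le_integral_norm _).trans ?_
  have := integral_norm_mul_le
    (continuous_slice (bkern_reg hε t x 0).cu s).aestronglyMeasurable hg.aestronglyMeasurable i hg2
  rwa [e] at this

theorem norm_integral_bkern_le_of_integrable {ε : ℝ} (hε : 0 < ε) (t : ℝ) (x : ℝ × ℝ) (s : ℝ)
    {g : ℝ × ℝ → ℂ} (hgi : Integrable g) :
    ‖∫ y, bkern ε t x s y * g y‖ ≤ (2 * Real.pi * ε)⁻¹ * ∫ y, ‖g y‖ := by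
  rw [← integral_const_mul]
  refine norm_integral_le_of_norm_le (hgi.norm.const_mul _) (Eventually.of_forall fun y => ?_)
  rw [norm_mul]
  gcongr
  exact norm_bkern_le hε t x s y

theorem bkern_continuous {ε : ℝ} (hε : 0 < ε) :
    Continuous fun p : ((ℝ × ℝ) × (ℝ × ℝ)) × (ℝ × ℝ) => bkern ε p.1.1.1 p.1.2 p.1.1.2 p.2 := by
  have h1 : Continuous fun p : ((ℝ × ℝ) × (ℝ × ℝ)) × (ℝ × ℝ) => (p.1.1, p.1.2 - p.2) := by fun_prop
  have h := (kern_cplxTime_continuous hε).comp h1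
  exact h

theorem bkern_integral_stronglyMeasurable {ε : ℝ} (hε : 0 < ε) {g : ℝ → ℝ × ℝ → ℂ}
    (hg : Continuous (uncurry g)) :
    StronglyMeasurable fun p : (ℝ × ℝ) × (ℝ × ℝ) =>
      ∫ y, bkern ε p.1.1 p.2 p.1.2 y * g p.1.2 y := by
  have h1 : Continuous fun p : ((ℝ × ℝ) × (ℝ × ℝ)) × (ℝ × ℝ) => (p.1.1.2, p.2) := by fun_prop
  have h2 := (bkern_continuous hε).mul (hg.comp h1)
  have h3 := h2.stronglyMeasurable.integral_prod_right' (ν := (volume : Measure (ℝ × ℝ)))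
  exact h3

theorem pairing_stronglyMeasurable {ε : ℝ} (hε : 0 < ε) {h g : ℝ → ℝ × ℝ → ℂ}
    (hh : Continuous (uncurry h)) (hg : Continuous (uncurry g)) :
    StronglyMeasurable fun p : ℝ × ℝ => pairing ε p.1 p.2 (h p.1) (g p.2) := by
  have h1 : Continuous fun p : (ℝ × ℝ) × (ℝ × ℝ) => (p.1.1, p.2) := by fun_prop
  have h2 := (hh.comp h1).stronglyMeasurable.mul (bkern_integral_stronglyMeasurable hε hg)
  have h3 := h2.integral_prod_right' (ν := (volume : Measure (ℝ × ℝ)))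
  exact h3

theorem norm_pairing_le {ε t s C : ℝ} {h g : ℝ × ℝ → ℂ} (hh : Integrable h)
    (hC : ∀ x, ‖∫ y, bkern ε t x s y * g y‖ ≤ C) :
    ‖pairing ε t s h g‖ ≤ C * ∫ x, ‖h x‖ := by
  rw [← integral_const_mul]
  refine norm_integral_le_of_norm_le (hh.norm.const_mul _) (Eventually.of_forall fun x => ?_)
  rw [norm_mul, mul_comm]
  exact mul_le_mul_of_nonneg_right (hC x) (norm_nonneg _)

/-- Exchange of the space and time integrals in a Duhamel term. -/
theorem integral_mul_duhamel {ε t a b C : ℝ} (hε : 0 < ε) {h : ℝ × ℝ → ℂ}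
    (hh : Continuous h) (hhi : Integrable h) {g : ℝ → ℝ × ℝ → ℂ} (hg : Continuous (uncurry g))
    (hC : ∀ s ∈ Ioc a b, ∀ x, ‖∫ y, bkern ε t x s y * g s y‖ ≤ C) :
    Integrable (fun x => h x * ∫ s in Ioc a b, ∫ y, bkern ε t x s y * g s y) ∧
    ∫ x, h x * (∫ s in Ioc a b, ∫ y, bkern ε t x s y * g s y)
      = ∫ s in Ioc a b, pairing ε t s h (g s) := by
  have hm : StronglyMeasurable fun p : (ℝ × ℝ) × ℝ =>
      h p.1 * ∫ y, bkern ε t p.1 p.2 y * g p.2 y := by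
    have h1 : Measurable fun p : (ℝ × ℝ) × ℝ => ((t, p.2), p.1) := by fun_prop
    have h2 := (bkern_integral_stronglyMeasurable hε hg).comp_measurable h1
    have h3 : StronglyMeasurable fun p : (ℝ × ℝ) × ℝ => h p.1 :=
      (hh.comp continuous_fst).stronglyMeasurable
    exact h3.mul h2
  have hi : Integrable (fun p : (ℝ × ℝ) × ℝ => h p.1 * ∫ y, bkern ε t p.1 p.2 y * g p.2 y)
      (volume.prod (volume.restrict (Ioc a b))) := by
    have i1 : Integrable (fun p : (ℝ × ℝ) × ℝ => ‖h p.1‖ * C)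
        (volume.prod (volume.restrict (Ioc a b))) :=
      hhi.norm.mul_prod (integrable_const C)
    refine i1.mono' hm.aestronglyMeasurable ?_
    have := (Measure.quasiMeasurePreserving_snd (μ := (volume : Measure (ℝ × ℝ)))).ae
      (ae_restrict_mem (μ := (volume : Measure ℝ)) (measurableSet_Ioc (a := a) (b := b)))
    filter_upwards [this] with p hp
    rw [norm_mul]
    exact mul_le_mul_of_nonneg_left (hC p.2 hp p.1) (norm_nonneg _)
  have e : ∀ x, h x * (∫ s in Ioc a b, ∫ y, bkern ε t x s y * g s y)
      = ∫ s in Ioc a b, h x * ∫ y, bkern ε t x s y * g s y := fun x =>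
    (integral_const_mul (h x) (fun s => ∫ y, bkern ε t x s y * g s y)).symm
  simp_rw [e]
  exact ⟨hi.integral_prod_left, integral_integral_swap hi⟩

/-! ### Weighted mixed-norm data -/

/-- The pointwise bound `|H|² ≤ v(t, x₁) p(t, x)` with `v ∈ L^∞(0, τ; L¹(ℝ))`. -/
structure Mixed (τ m : ℝ) (H : ℝ → ℝ × ℝ → ℂ) (v : ℝ → ℝ → ℝ) (p : ℝ → ℝ × ℝ → ℝ) : Prop where
  cont : Continuous (uncurry H)
  int : ∀ t ∈ Icc 0 τ, Integrable (H t)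
  v_nonneg : ∀ t ∈ Icc 0 τ, ∀ a, 0 ≤ v t a
  v_int : ∀ t ∈ Icc 0 τ, Integrable (v t)
  v_le : ∀ t ∈ Icc 0 τ, ∫ a, v t a ≤ m
  p_nonneg : ∀ t ∈ Icc 0 τ, ∀ x, 0 ≤ p t x
  p_int : ∀ t ∈ Icc 0 τ, Integrable (p t)
  bound : ∀ t ∈ Icc 0 τ, ∀ᵐ a, ∀ b, ‖H t (a, b)‖ ^ 2 ≤ v t a * p t (a, b)

theorem Mixed.conj {τ m : ℝ} {H : ℝ → ℝ × ℝ → ℂ} {v : ℝ → ℝ → ℝ} {p : ℝ → ℝ × ℝ → ℝ}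
    (hH : Mixed τ m H v p) : Mixed τ m (fun t x => conj (H t x)) v p :=
  { hH with
    cont := Complex.continuous_conj.comp hH.cont
    int := fun t ht => by
      refine (hH.int t ht).norm.mono' ?_ (Eventually.of_forall fun x => by simp)
      exact (Complex.continuous_conj.comp (continuous_slice hH.cont t)).aestronglyMeasurable
    bound := by simpa using hH.bound }

/-- For z = ε + i(t-s) one has 2π‖z‖ ≥ |t-s| whatever ε is, which gives the singular factor; the two
weights give m√P√P', bounded by the arithmetic mean to suit the Schur test. -/
theorem Mixed.norm_pairing_le {τ m : ℝ} {H G : ℝ → ℝ × ℝ → ℂ} {v v' : ℝ → ℝ → ℝ}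
    {p p' : ℝ → ℝ × ℝ → ℝ} (hH : Mixed τ m H v p) (hG : Mixed τ m G v' p') {ε : ℝ} (hε : 0 < ε)
    {t s : ℝ} (ht : t ∈ Icc 0 τ) (hs : s ∈ Icc 0 τ) (hts : t ≠ s) :
    ‖pairing ε t s (H t) (G s)‖
      ≤ m * timeKern τ (t - s) * (((∫ x, p t x) + ∫ x, p' s x) / 2) := by
  have hm : 0 ≤ m := (integral_nonneg (hH.v_nonneg t ht)).trans (hH.v_le t ht)
  have h1 := norm_integral_kern_le (z := cplxTime ε t s) (by rwa [cplxTime_re])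
    (continuous_slice hH.cont t) (hH.int t ht) (continuous_slice hG.cont s) (hG.int s hs)
    (hH.v_nonneg t ht) (hH.v_int t ht) (hG.v_nonneg s hs) (hG.v_int s hs)
    (hH.p_nonneg t ht) (hH.p_int t ht) (hG.p_nonneg s hs) (hG.p_int s hs)
    (hH.bound t ht) (hG.bound s hs)
  have P0 : 0 ≤ ∫ x, p t x := integral_nonneg (hH.p_nonneg t ht)
  have P0' : 0 ≤ ∫ x, p' s x := integral_nonneg (hG.p_nonneg s hs)
  have hr : 0 < |t - s| := abs_pos.2 (sub_ne_zero.2 hts)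
  have hz : |t - s| ≤ 2 * Real.pi * ‖cplxTime ε t s‖ := by
    have h2 := Complex.abs_im_le_norm (cplxTime ε t s)
    rw [cplxTime_im] at h2
    nlinarith [Real.pi_gt_three, norm_nonneg (cplxTime ε t s)]
  refine h1.trans ?_
  rw [← inv_sqrt_le_timeKern ht hs hts]
  have h3 : (√(2 * Real.pi * ‖cplxTime ε t s‖))⁻¹ ≤ (√|t - s|)⁻¹ := by
    have : 0 < √|t - s| := Real.sqrt_pos.2 hr
    gcongr
  have h4 : √((∫ a, v t a) * ∫ x, p t x) * √((∫ a, v' s a) * ∫ x, p' s x)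
      ≤ m * (((∫ x, p t x) + ∫ x, p' s x) / 2) := by
    have h5 : √((∫ a, v t a) * ∫ x, p t x) ≤ √(m * ∫ x, p t x) :=
      Real.sqrt_le_sqrt (mul_le_mul_of_nonneg_right (hH.v_le t ht) P0)
    have h6 : √((∫ a, v' s a) * ∫ x, p' s x) ≤ √(m * ∫ x, p' s x) :=
      Real.sqrt_le_sqrt (mul_le_mul_of_nonneg_right (hG.v_le s hs) P0')
    have h7 : 0 ≤ m * ∫ x, p t x := by positivity
    have h8 : 0 ≤ m * ∫ x, p' s x := by positivity
    nlinarith [mul_le_mul h5 h6 (Real.sqrt_nonneg _) (Real.sqrt_nonneg _),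
      sq_nonneg (√(m * ∫ x, p t x) - √(m * ∫ x, p' s x)), Real.sq_sqrt h7, Real.sq_sqrt h8]
  calc _ ≤ (√|t - s|)⁻¹ * (m * (((∫ x, p t x) + ∫ x, p' s x) / 2)) :=
        mul_le_mul h3 h4 (by positivity) (by positivity)
    _ = _ := by ring

/-- The group law behind T T*: in the sum of one complex time and the conjugate of the other, `s`
cancels and the real parts add up to 2ε. -/
theorem integral_bkern_mul_conj {ε : ℝ} (hε : 0 < ε) (s t t' : ℝ) (x x' : ℝ × ℝ) :
    ∫ y, bkern ε t x s y * conj (bkern ε t' x' s y) = bkern (2 * ε) t x t' x' := by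
  have h := kern_conv (z := cplxTime ε t s) (w := conj (cplxTime ε t' s))
    (by rwa [cplxTime_re]) (by rwa [Complex.conj_re, cplxTime_re]) x x'
  have e : cplxTime ε t s + conj (cplxTime ε t' s) = cplxTime (2 * ε) t t' := by
    apply Complex.ext
    · simp [cplxTime_re]; ring
    · simp [cplxTime_im]
  rw [e] at h
  rw [bkern, ← h]
  congr 1; ext y
  rw [bkern, bkern, kern_conj, kern_sub_comm (conj _) x' y]

/-- The homogeneous estimate, by duality. -/
theorem Mixed.sq_norm_integral_pairing_le {τ m : ℝ} (hτ : 0 < τ) {H : ℝ → ℝ × ℝ → ℂ}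
    {v : ℝ → ℝ → ℝ} {p : ℝ → ℝ × ℝ → ℝ} (hH : Mixed τ m H v p) {k : Set (ℝ × ℝ)}
    (hk : IsCompact k) (hHk : ∀ t x, x ∉ k → H t x = 0)
    (hY : IntegrableOn (fun t => ∫ x, p t x) (Ioc 0 τ)) {ε : ℝ} (hε : 0 < ε) {s : ℝ}
    (hs : s ∈ Icc 0 τ) {g : ℝ × ℝ → ℂ} (hg : Continuous g)
    (hg2 : Integrable fun x => ‖g x‖ ^ 2) :
    ‖∫ t in Ioc s τ, pairing ε t s (H t) g‖ ^ 2
      ≤ (∫ x, ‖g x‖ ^ 2) * (4 * m * √τ * ∫ t in Ioc 0 τ, ∫ x, p t x) := by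
  have hm : 0 ≤ m := (integral_nonneg (hH.v_nonneg s hs)).trans (hH.v_le s hs)
  have sub : ∀ t ∈ Ioc s τ, t ∈ Icc 0 τ := fun t ht => ⟨hs.1.trans ht.1.le, ht.2⟩
  have iH : Integrable (uncurry H) ((volume.restrict (Ioc s τ)).prod volume) :=
    integrable_prod_of_eq_zero_off_compact hH.cont hk hHk s τ
  have mk : StronglyMeasurable (uncurry fun (q : ℝ × ℝ × ℝ) (y : ℝ × ℝ) => bkern ε q.1 q.2 s y) := by
    have h1 : Continuous fun w : (ℝ × ℝ × ℝ) × (ℝ × ℝ) => (((w.1.1, s), w.1.2), w.2) := by fun_prop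
    have h2 := ((bkern_continuous hε).comp h1).stronglyMeasurable
    exact h2
  -- T T* with (t, x) as the input variable and the position at time `s` as the output variable.
  have hT := sq_norm_integral_kernel_le (μ := (volume.restrict (Ioc s τ)).prod volume)
    (ν := (volume : Measure (ℝ × ℝ))) mk (fun q => (integral_norm_bkern_sq hε q.1 q.2 s).1)
    (fun q => (integral_norm_bkern_sq hε q.1 q.2 s).2.le) hH.cont.stronglyMeasurable iH
    hg.stronglyMeasurable hg2
  have gm : StronglyMeasurable fun q : ℝ × ℝ × ℝ => ∫ y, bkern ε q.1 q.2 s y * g y := by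
    have h1 : Measurable fun q : ℝ × ℝ × ℝ => ((q.1, s), q.2) := by fun_prop
    have hg' : Continuous (uncurry fun (_ : ℝ) (x : ℝ × ℝ) => g x) := hg.comp continuous_snd
    have h2 := (bkern_integral_stronglyMeasurable hε hg').comp_measurable h1
    exact h2
  have e1 : ∫ q, uncurry H q * (∫ y, bkern ε q.1 q.2 s y * g y)
      ∂((volume.restrict (Ioc s τ)).prod volume) = ∫ t in Ioc s τ, pairing ε t s (H t) g := by
    have hi : Integrable (fun q : ℝ × ℝ × ℝ => uncurry H q * ∫ y, bkern ε q.1 q.2 s y * g y)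
        ((volume.restrict (Ioc s τ)).prod volume) :=
      iH.mul_bdd gm.aestronglyMeasurable
        (Eventually.of_forall fun q => norm_integral_bkern_le_of_sq hε q.1 q.2 s hg hg2)
    rw [integral_prod _ hi]
    rfl
  have hε2 : 0 < 2 * ε := by positivity
  have hHc := hH.conj
  have L1 : ∃ C, ∀ t ∈ Icc 0 τ, ∫ x, ‖H t x‖ ≤ C := by
    have hc : Continuous fun t => ∫ x in k, ‖H t x‖ :=
      continuous_parametric_integral_of_continuous hH.cont.norm hk
    obtain ⟨C, hC⟩ := isCompact_Icc.exists_bound_of_continuousOn (s := Icc 0 τ) hc.continuousOn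
    refine ⟨C, fun t ht => ?_⟩
    rw [← setIntegral_eq_integral_of_forall_compl_eq_zero (s := k)
      (fun x hx => by rw [hHk t x hx, norm_zero])]
    exact (le_abs_self _).trans (hC t ht)
  obtain ⟨C, hC⟩ := L1
  have bC : ∀ t, ∀ t' ∈ Ioc s τ, ∀ x, ‖∫ x', bkern (2 * ε) t x t' x' * conj (H t' x')‖
      ≤ (2 * Real.pi * (2 * ε))⁻¹ * C := by
    intro t t' ht' x
    refine (norm_integral_bkern_le_of_integrable hε2 t x t' (hHc.int t' (sub t' ht'))).trans ?_
    simp only [RCLike.norm_conj]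
    exact mul_le_mul_of_nonneg_left (hC t' (sub t' ht')) (by positivity)
  have e2 : ∫ q, ∫ q', uncurry H q * conj (uncurry H q') *
      (∫ y, bkern ε q.1 q.2 s y * conj (bkern ε q'.1 q'.2 s y))
      ∂((volume.restrict (Ioc s τ)).prod volume) ∂((volume.restrict (Ioc s τ)).prod volume)
      = ∫ t in Ioc s τ, ∫ t' in Ioc s τ, pairing (2 * ε) t t' (H t) (fun x => conj (H t' x)) := by
    simp_rw [integral_bkern_mul_conj hε]
    have inner : ∀ q : ℝ × ℝ × ℝ, ∫ q' : ℝ × ℝ × ℝ, uncurry H q * conj (uncurry H q')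
        * bkern (2 * ε) q.1 q.2 q'.1 q'.2 ∂((volume.restrict (Ioc s τ)).prod volume)
        = uncurry H q * ∫ t' in Ioc s τ, ∫ x', bkern (2 * ε) q.1 q.2 t' x' * conj (H t' x') := by
      intro q
      have i1 : Integrable (fun q' : ℝ × ℝ × ℝ => bkern (2 * ε) q.1 q.2 q'.1 q'.2
          * conj (uncurry H q')) ((volume.restrict (Ioc s τ)).prod volume) :=
        integrable_prod_of_eq_zero_off_compact ((bkern_reg hε2 q.1 q.2 0).cu.mul hHc.cont) hk
          (fun t x hx => by simp [uncurry, hHk t x hx]) s τ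
      have i2 := integral_prod _ i1
      simp only [uncurry] at i2 ⊢
      rw [← i2, ← integral_const_mul]
      congr 1; ext q'; ring
    simp_rw [inner]
    have im : StronglyMeasurable fun q : ℝ × ℝ × ℝ =>
        ∫ t' in Ioc s τ, ∫ x', bkern (2 * ε) q.1 q.2 t' x' * conj (H t' x') := by
      have h1 : Measurable fun w : (ℝ × ℝ × ℝ) × ℝ => ((w.1.1, w.2), w.1.2) := by fun_prop
      have h2 := (bkern_integral_stronglyMeasurable hε2 hHc.cont).comp_measurable h1
      have h3 := h2.integral_prod_right' (ν := volume.restrict (Ioc s τ))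
      exact h3
    have ib : ∀ q : ℝ × ℝ × ℝ, ‖∫ t' in Ioc s τ, ∫ x', bkern (2 * ε) q.1 q.2 t' x' * conj (H t' x')‖
        ≤ (2 * Real.pi * (2 * ε))⁻¹ * C * volume.real (Ioc s τ) := fun q =>
      norm_setIntegral_le_of_norm_le_const (by simp) (fun t' ht' => bC q.1 t' ht' q.2)
    have hi : Integrable (fun q : ℝ × ℝ × ℝ => uncurry H q * ∫ t' in Ioc s τ, ∫ x',
        bkern (2 * ε) q.1 q.2 t' x' * conj (H t' x')) ((volume.restrict (Ioc s τ)).prod volume) :=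
      iH.mul_bdd im.aestronglyMeasurable (Eventually.of_forall ib)
    rw [integral_prod _ hi]
    refine setIntegral_congr_fun measurableSet_Ioc fun t ht => ?_
    exact (integral_mul_duhamel hε2 (continuous_slice hH.cont t) (hH.int t (sub t ht)) hHc.cont
      (fun t' ht' x => bC t t' ht' x)).2
  rw [e1, e2] at hT
  refine hT.trans (mul_le_mul_of_nonneg_left ?_ (integral_nonneg fun x => sq_nonneg _))
  have hp0 : ∀ t ∈ Ioc 0 τ, 0 ≤ ∫ x, p t x := fun t ht =>
    integral_nonneg (hH.p_nonneg t ⟨ht.1.le, ht.2⟩)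
  -- Both roles of the Schur test are played by the same function of time, which doubles 2m√τ to
  -- 4m√τ.
  refine (norm_integral_timeKern_le hτ hs.1 hm hY hY hp0 hp0 fun t ht t' ht' hne =>
    hH.norm_pairing_le hHc hε2 (sub t ht) (sub t' ht') hne).trans (le_of_eq ?_)
  ring

/-! ### Removal of the regularisation -/

theorem integral_gauss_ofReal {ε : ℝ} (hε : 0 < ε) : ∫ r, ‖gauss ε r‖ = √(2 * Real.pi * ε) := by
  simp_rw [norm_gauss, Complex.normSq_ofReal, Complex.ofReal_re]
  rw [integral_gaussian]
  congr 1
  field_simp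

theorem gauss_ofReal (ε r : ℝ) : gauss ε r = (‖gauss ε r‖ : ℂ) := by
  rw [gauss]
  have : (-(r : ℂ) ^ 2 / (2 * ε)) = ((-r ^ 2 / (2 * ε) : ℝ) : ℂ) := by push_cast; ring
  rw [this, ← Complex.ofReal_exp, Complex.norm_real, Real.norm_of_nonneg (Real.exp_pos _).le]

theorem kern_ofReal {ε : ℝ} (hε : 0 < ε) (x : ℝ × ℝ) : kern ε x = (‖kern ε x‖ : ℂ) := by
  rw [norm_kern_eq, kern, gauss_ofReal ε x.1, gauss_ofReal ε x.2]
  simp only [Complex.norm_real, norm_norm, Real.norm_of_nonneg hε.le]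
  push_cast
  ring

theorem integrable_kern_ofReal {ε : ℝ} (hε : 0 < ε) : Integrable (fun x => ‖kern ε x‖) := by
  simp_rw [norm_kern_eq]
  have h : 0 < (ε : ℂ).re := by simpa using hε
  exact ((integrable_norm_gauss h).mul_prod (integrable_norm_gauss h)).const_mul _

theorem integral_norm_kern_ofReal {ε : ℝ} (hε : 0 < ε) : ∫ x, ‖kern ε x‖ = 1 := by
  simp_rw [norm_kern_eq]
  rw [integral_const_mul, Measure.volume_eq_prod,
    integral_prod_mul (fun r => ‖gauss ε r‖) (fun r => ‖gauss ε r‖), integral_gauss_ofReal hε,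
    Real.mul_self_sqrt (by positivity), Complex.norm_real, Real.norm_of_nonneg hε.le]
  field_simp

/-- The correlation `w ↦ ∫ h(x) u(x - w) dx`. -/
def correl (h u : ℝ × ℝ → ℂ) (w : ℝ × ℝ) : ℂ := ∫ x, h x * u (x - w)

theorem correl_bound {h u : ℝ × ℝ → ℂ} (hh : Continuous h) (hu : Continuous u)
    (h2 : Integrable fun x => ‖h x‖ ^ 2) (u2 : Integrable fun x => ‖u x‖ ^ 2) (w : ℝ × ℝ) :
    Integrable (fun x => h x * u (x - w)) ∧
      ∫ x, ‖h x * u (x - w)‖ ≤ √(∫ x, ‖h x‖ ^ 2) * √(∫ x, ‖u x‖ ^ 2) := by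
  have hus : Continuous fun x => u (x - w) := by fun_prop
  have u2s : Integrable fun x => ‖u (x - w)‖ ^ 2 := u2.comp_sub_right w
  have := integral_norm_mul_le hh.aestronglyMeasurable hus.aestronglyMeasurable h2 u2s
    (μ := volume)
  rw [integral_sub_right_eq_self (fun x => ‖u x‖ ^ 2) w] at this
  exact ⟨integrable_mul_of_sq hh.aestronglyMeasurable hus.aestronglyMeasurable h2 u2s, this⟩

/-- Substituting w = x - y moves the convolution onto the correlation of `h` and `u`, so the limit ε
→ 0 becomes continuity of the correlation at 0. -/
theorem integral_mul_kern_eq_correl {ε : ℝ} (hε : 0 < ε) {h u : ℝ × ℝ → ℂ} (hh : Continuous h)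
    (hu : Continuous u) (h2 : Integrable fun x => ‖h x‖ ^ 2)
    (u2 : Integrable fun x => ‖u x‖ ^ 2) :
    ∫ x, h x * ∫ y, kern ε (x - y) * u y = ∫ w, kern ε w * correl h u w := by
  have kc := kern_continuous (ε : ℂ)
  have hF : Continuous fun q : (ℝ × ℝ) × (ℝ × ℝ) => kern ε q.1 * (h q.2 * u (q.2 - q.1)) := by
    fun_prop
  have hi : Integrable (fun q : (ℝ × ℝ) × (ℝ × ℝ) => kern ε q.1 * (h q.2 * u (q.2 - q.1)))
      (volume.prod volume) := by
    refine integrable_prod_of_norm_integral_le hF.stronglyMeasurable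
      (b := fun w => ‖kern ε w‖ * (√(∫ x, ‖h x‖ ^ 2) * √(∫ x, ‖u x‖ ^ 2)))
      (fun w => ((correl_bound hh hu h2 u2 w).1.const_mul (kern ε w)))
      ((integrable_kern_ofReal hε).mul_const _) (fun w => ?_)
    simp only [norm_mul (kern (ε : ℂ) w)]
    rw [integral_const_mul]
    exact mul_le_mul_of_nonneg_left (correl_bound hh hu h2 u2 w).2 (norm_nonneg _)
  calc _ = ∫ x, ∫ w, kern ε w * (h x * u (x - w)) := by
        congr 1; ext x
        rw [← integral_sub_left_eq_self (fun y => kern ε (x - y) * u y) volume x,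
          ← integral_const_mul]
        congr 1; ext w
        rw [sub_sub_cancel]; ring
    _ = ∫ w, ∫ x, kern ε w * (h x * u (x - w)) := (integral_integral_swap hi).symm
    _ = _ := by simp_rw [integral_const_mul]; rfl

/-- The heat kernel is positive with mass 1 and Cauchy–Schwarz bounds every value of the
correlation, hence uniformity in ε. -/
theorem norm_integral_mul_kern_le {ε : ℝ} (hε : 0 < ε) {h u : ℝ × ℝ → ℂ} (hh : Continuous h)
    (hu : Continuous u) (h2 : Integrable fun x => ‖h x‖ ^ 2)
    (u2 : Integrable fun x => ‖u x‖ ^ 2) :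
    ‖∫ x, h x * ∫ y, kern ε (x - y) * u y‖ ≤ √(∫ x, ‖h x‖ ^ 2) * √(∫ x, ‖u x‖ ^ 2) := by
  rw [integral_mul_kern_eq_correl hε hh hu h2 u2]
  have := norm_integral_le_of_norm_le (f := fun w => kern ε w * correl h u w)
    ((integrable_kern_ofReal hε).mul_const (√(∫ x, ‖h x‖ ^ 2) * √(∫ x, ‖u x‖ ^ 2)))
    (Eventually.of_forall fun w => by
      rw [norm_mul]
      exact mul_le_mul_of_nonneg_left ((norm_integral_le_integral_norm _).trans
        (correl_bound hh hu h2 u2 w).2) (norm_nonneg _))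
  rwa [integral_mul_const, integral_norm_kern_ofReal hε, one_mul] at this

/-- A sequence of regularisation parameters. -/
def epsSeq (n : ℕ) : ℝ := (((n : ℝ) + 1)⁻¹) ^ 2

theorem epsSeq_pos (n : ℕ) : 0 < epsSeq n := by unfold epsSeq; positivity

/-- Parabolic scaling: length δ corresponds to time δ². This is why `epsSeq` is defined as a square.
-/
theorem kern_scale {δ : ℝ} (hδ : 0 < δ) (w : ℝ × ℝ) :
    kern ((δ ^ 2 : ℝ) : ℂ) (δ • w) = ((δ ^ 2 : ℝ) : ℂ)⁻¹ * kern 1 w := by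
  have hd : (δ : ℂ) ≠ 0 := by exact_mod_cast hδ.ne'
  have e : ∀ r : ℝ, gauss ((δ ^ 2 : ℝ) : ℂ) (δ * r) = gauss 1 r := by
    intro r
    rw [gauss, gauss]
    congr 1
    push_cast
    field_simp
  simp only [kern, Prod.smul_fst, Prod.smul_snd, smul_eq_mul, e]
  push_cast
  field_simp

/-- After rescaling, the kernel is fixed and the argument of the correlation shrinks to 0, so
dominated convergence applies. Compact support of `h` makes the correlation a continuous parametric
integral. -/
theorem tendsto_integral_mul_kern {h u : ℝ × ℝ → ℂ} (hh : Continuous h)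
    (hu : Continuous u) (h2 : Integrable fun x => ‖h x‖ ^ 2)
    (u2 : Integrable fun x => ‖u x‖ ^ 2) {k : Set (ℝ × ℝ)} (hk : IsCompact k)
    (hhk : ∀ x, x ∉ k → h x = 0) :
    Tendsto (fun n => ∫ x, h x * ∫ y, kern (epsSeq n) (x - y) * u y) atTop
      (𝓝 (∫ x, h x * u x)) := by
  have ec : ∀ w, correl h u w = ∫ x in k, h x * u (x - w) := fun w =>
    (setIntegral_eq_integral_of_forall_compl_eq_zero fun x hx => by
      rw [hhk x hx, zero_mul]).symm
  have cc : Continuous (correl h u) := by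
    have h1 : Continuous (uncurry fun (w x : ℝ × ℝ) => h x * u (x - w)) := by
      simp only [uncurry_def]
      fun_prop
    have := continuous_parametric_integral_of_continuous h1 hk (μ := volume)
    rw [show correl h u = fun w => ∫ x in k, h x * u (x - w) from funext ec]
    exact this
  have hs : ∀ n, ∫ x, h x * ∫ y, kern (epsSeq n) (x - y) * u y
      = ∫ w, kern 1 w * correl h u (((n : ℝ) + 1)⁻¹ • w) := by
    intro n
    have hδ : (0 : ℝ) < ((n : ℝ) + 1)⁻¹ := by positivity
    rw [integral_mul_kern_eq_correl (epsSeq_pos n) hh hu h2 u2]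
    have h3 := Measure.integral_comp_smul (volume : Measure (ℝ × ℝ))
      (fun w => kern (epsSeq n) w * correl h u w) (((n : ℝ) + 1)⁻¹)
    have h4 : Module.finrank ℝ (ℝ × ℝ) = 2 := by simp
    rw [h4, abs_of_pos (by positivity)] at h3
    simp only [epsSeq] at h3 ⊢
    simp_rw [kern_scale hδ, mul_assoc] at h3
    rw [integral_const_mul, Complex.real_smul, Complex.ofReal_inv] at h3
    have h5 : (((((n : ℝ) + 1)⁻¹) ^ 2 : ℝ) : ℂ)⁻¹ ≠ 0 :=
      inv_ne_zero (by exact_mod_cast (pow_pos hδ 2).ne')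
    exact (mul_left_cancel₀ h5 h3).symm
  simp_rw [hs]
  have k1 : ∫ w, kern 1 w = 1 := by
    have h1 : ∀ w, kern 1 w = ((‖kern (1 : ℝ) w‖ : ℝ) : ℂ) := fun w => by
      rw [← kern_ofReal one_pos w]; simp
    simp_rw [h1]
    rw [integral_complex_ofReal, integral_norm_kern_ofReal one_pos]; simp
  have e0 : ∫ x, h x * u x = ∫ w, kern 1 w * correl h u 0 := by
    rw [integral_mul_const, k1, one_mul]
    simp [correl]
  rw [e0]
  have ik : Integrable fun x => ‖kern 1 x‖ := by simpa using integrable_kern_ofReal one_pos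
  refine tendsto_integral_of_dominated_convergence
    (fun w => ‖kern 1 w‖ * (√(∫ x, ‖h x‖ ^ 2) * √(∫ x, ‖u x‖ ^ 2))) (fun n => ?_)
    (ik.mul_const _) (fun n => Eventually.of_forall fun w => ?_) (Eventually.of_forall fun w => ?_)
  · have := kern_continuous 1
    exact Continuous.aestronglyMeasurable (by fun_prop)
  · rw [norm_mul]
    exact mul_le_mul_of_nonneg_left ((norm_integral_le_integral_norm _).trans
        (correl_bound hh hu h2 u2 _).2) (norm_nonneg _)
  · refine Tendsto.const_mul _ ((cc.tendsto 0).comp ?_)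
    have h1 : Tendsto (fun n : ℕ => ((n : ℝ) + 1)⁻¹) atTop (𝓝 0) := by
      have := tendsto_one_div_add_atTop_nhds_zero_nat (𝕜 := ℝ)
      simpa using this
    simpa using h1.smul_const w

/-! ### Integrals over a triangle -/

theorem integral_triangle_eq {τ : ℝ} (Φ : ℝ → ℝ → ℂ) :
    ∫ t in Ioc 0 τ, ∫ s in Ioc 0 t, Φ t s
      = ∫ t in Ioc 0 τ, ∫ s in Ioc 0 τ, (Iic t).indicator (Φ t) s := by
  refine setIntegral_congr_fun measurableSet_Ioc fun t ht => ?_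
  rw [setIntegral_indicator measurableSet_Iic]
  congr 2
  ext s
  simp only [mem_Ioc, mem_inter_iff, mem_Iic]
  constructor
  · rintro ⟨h1, h2⟩; exact ⟨⟨h1, h2.trans ht.2⟩, h2⟩
  · rintro ⟨⟨h1, _⟩, h3⟩; exact ⟨h1, h3⟩

/-- After the exchange the inner integral runs over times later than `s` with the source at `s`
fixed, which is a homogeneous problem started at time `s`. The bound `C` serves only Fubini. -/
theorem integral_triangle_swap {τ C : ℝ} {Φ : ℝ → ℝ → ℂ} (hΦ : StronglyMeasurable (uncurry Φ))
    (hC : ∀ t ∈ Icc 0 τ, ∀ s ∈ Icc 0 τ, ‖Φ t s‖ ≤ C) :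
    ∫ t in Ioc 0 τ, ∫ s in Ioc 0 t, Φ t s = ∫ s in Ioc 0 τ, ∫ t in Ioc s τ, Φ t s := by
  rw [integral_triangle_eq]
  have hm : StronglyMeasurable (fun q : ℝ × ℝ => (Iic q.1).indicator (Φ q.1) q.2) := by
    have : (fun q : ℝ × ℝ => (Iic q.1).indicator (Φ q.1) q.2)
        = {q : ℝ × ℝ | q.2 ≤ q.1}.indicator (uncurry Φ) := by
      ext q; simp [indicator, uncurry]
    rw [this]
    exact hΦ.indicator (measurableSet_le measurable_snd measurable_fst)
  have hi : Integrable (fun q : ℝ × ℝ => (Iic q.1).indicator (Φ q.1) q.2)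
      ((volume.restrict (Ioc 0 τ)).prod (volume.restrict (Ioc 0 τ))) := by
    refine Integrable.of_bound hm.aestronglyMeasurable C ?_
    rw [Measure.prod_restrict]
    filter_upwards [ae_restrict_mem (measurableSet_Ioc.prod measurableSet_Ioc)] with q hq
    exact (norm_indicator_le_norm_self _ _).trans
      (hC _ ⟨hq.1.1.le, hq.1.2⟩ _ ⟨hq.2.1.le, hq.2.2⟩)
  rw [integral_integral_swap hi]
  refine setIntegral_congr_fun measurableSet_Ioc fun s hs => ?_
  have e : ∀ t, (Iic t).indicator (Φ t) s = (Ici s).indicator (fun t => Φ t s) t := by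
    intro t; simp [indicator]
  simp_rw [e]
  rw [setIntegral_indicator measurableSet_Ici]
  have : Ioc 0 τ ∩ Ici s = Icc s τ := by
    ext t
    simp only [mem_inter_iff, mem_Ioc, mem_Ici, mem_Icc]
    constructor
    · rintro ⟨⟨_, h2⟩, h3⟩; exact ⟨h3, h2⟩
    · rintro ⟨h1, h2⟩; exact ⟨⟨hs.1.trans_le h1, h2⟩, h1⟩
  rw [this, integral_Icc_eq_integral_Ioc]

/-! ### The smoothing estimate -/

theorem pairing_self (ε t : ℝ) (h g : ℝ × ℝ → ℂ) :
    pairing ε t t h g = ∫ x, h x * ∫ y, kern ε (x - y) * g y := by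
  simp only [pairing, bkern, cplxTime_self]

theorem integral_sub_sub {α : Type*} [MeasurableSpace α] {μ : Measure α} {f g k : α → ℂ}
    (hf : Integrable f μ) (hg : Integrable g μ) (hk : Integrable k μ) :
    ∫ x, (f x - g x - k x) ∂μ = (∫ x, f x ∂μ) - (∫ x, g x ∂μ) - ∫ x, k x ∂μ := by
  have h := integral_sub (hf.sub hg) hk
  rw [← integral_sub hf hg]
  exact h

theorem bkern_bound_of_l2Bdd {τ : ℝ} {g : ℝ → ℝ × ℝ → ℂ} (hg : Continuous (uncurry g))
    (bg : L2Bdd τ g) {ε : ℝ} (hε : 0 < ε) :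
    ∃ C, ∀ t, ∀ s ∈ Icc 0 τ, ∀ x, ‖∫ y, bkern ε t x s y * g s y‖ ≤ C := by
  obtain ⟨K, hK⟩ := bg
  refine ⟨√((4 * Real.pi * ε)⁻¹) * √K, fun t s hs x => ?_⟩
  exact (norm_integral_bkern_le_of_sq hε t x s (continuous_slice hg s) (hK s hs).1).trans
    (mul_le_mul_of_nonneg_left (Real.sqrt_le_sqrt (hK s hs).2) (Real.sqrt_nonneg _))

theorem bkern_bound_of_l1Bdd {τ : ℝ} {g : ℝ → ℝ × ℝ → ℂ}
    (bg : L1Bdd τ g) {ε : ℝ} (hε : 0 < ε) :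
    ∃ C, ∀ t, ∀ s ∈ Icc 0 τ, ∀ x, ‖∫ y, bkern ε t x s y * g s y‖ ≤ C := by
  obtain ⟨K, hK⟩ := bg
  refine ⟨(2 * Real.pi * ε)⁻¹ * K, fun t s hs x => ?_⟩
  exact (norm_integral_bkern_le_of_integrable hε t x s (hK s hs).1).trans
    (mul_le_mul_of_nonneg_left (hK s hs).2 (by positivity))

theorem exists_integral_norm_le {τ : ℝ} {H : ℝ → ℝ × ℝ → ℂ} (hH : Continuous (uncurry H))
    {k : Set (ℝ × ℝ)} (hk : IsCompact k) (hHk : ∀ t x, x ∉ k → H t x = 0) :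
    ∃ C, ∀ t ∈ Icc 0 τ, ∫ x, ‖H t x‖ ≤ C := by
  have hc : Continuous fun t => ∫ x in k, ‖H t x‖ :=
    continuous_parametric_integral_of_continuous hH.norm hk
  obtain ⟨C, hC⟩ := isCompact_Icc.exists_bound_of_continuousOn (s := Icc 0 τ) hc.continuousOn
  refine ⟨C, fun t ht => ?_⟩
  rw [← setIntegral_eq_integral_of_forall_compl_eq_zero (s := k)
    (fun x hx => by rw [hHk t x hx, norm_zero])]
  exact (le_abs_self _).trans (hC t ht)

theorem exists_norm_pairing_le {τ C : ℝ} {H g : ℝ → ℝ × ℝ → ℂ} (hH : Continuous (uncurry H))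
    {k : Set (ℝ × ℝ)} (hk : IsCompact k) (hHk : ∀ t x, x ∉ k → H t x = 0) {ε : ℝ}
    (hC : ∀ t, ∀ s ∈ Icc 0 τ, ∀ x, ‖∫ y, bkern ε t x s y * g s y‖ ≤ C) :
    ∃ C', 0 ≤ C' ∧ ∀ t ∈ Icc 0 τ, ∀ s ∈ Icc 0 τ, ‖pairing ε t s (H t) (g s)‖ ≤ C' := by
  obtain ⟨D, hD⟩ := exists_integral_norm_le (τ := τ) hH hk hHk
  refine ⟨|C| * |D|, by positivity, fun t ht s hs => ?_⟩
  refine (norm_pairing_le (integrable_of_eq_zero_off_compact (continuous_slice hH t) hk (hHk t))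
    (hC t s hs)).trans ?_
  exact mul_le_mul (le_abs_self C) ((hD t ht).trans (le_abs_self _))
    (integral_nonneg fun _ => norm_nonneg _) (abs_nonneg _)

/-- Duhamel's formula tested against `H`, with the time integrals pulled outside so that each term
is an integral of pairings. -/
theorem Schro.pairing_duhamel {τ : ℝ} {u ut ua ub uaa ubb N N₁ N₂ : ℝ → ℝ × ℝ → ℂ}
    (h : Schro τ u ut ua ub uaa ubb N) (hN : ∀ t x, N t x = N₁ t x + N₂ t x)
    (cN₁ : Continuous (uncurry N₁)) (cN₂ : Continuous (uncurry N₂))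
    (bN₁ : L2Bdd τ N₁) (bN₂ : L1Bdd τ N₂) {H : ℝ × ℝ → ℂ} (cH : Continuous H)
    (iH : Integrable H) {ε : ℝ} (hε : 0 < ε) {t : ℝ} (ht : t ∈ Icc 0 τ) :
    pairing ε t t H (u t) = pairing ε t 0 H (u 0)
      - Complex.I * (∫ s in Ioc 0 t, pairing ε t s H (N₁ s))
      - Complex.I * ∫ s in Ioc 0 t, pairing ε t s H (N₂ s) := by
  have hτ : 0 ≤ τ := ht.1.trans ht.2
  obtain ⟨C₁, h₁⟩ := bkern_bound_of_l2Bdd cN₁ bN₁ hε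
  obtain ⟨C₂, h₂⟩ := bkern_bound_of_l1Bdd bN₂ hε
  obtain ⟨C₀, h₀⟩ := bkern_bound_of_l2Bdd h.cu h.bu hε
  have sub : ∀ s ∈ Ioc 0 t, s ∈ Icc 0 τ := fun s hs => ⟨hs.1.le, hs.2.trans ht.2⟩
  have d₁ := integral_mul_duhamel hε cH iH cN₁ (fun s hs x => h₁ t s (sub s hs) x)
  have d₂ := integral_mul_duhamel hε cH iH cN₂ (fun s hs x => h₂ t s (sub s hs) x)
  have m₀ : StronglyMeasurable fun x : ℝ × ℝ => ∫ y, bkern ε t x 0 y * u 0 y := by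
    have h1 : Measurable fun x : ℝ × ℝ => (((t, 0) : ℝ × ℝ), x) := by fun_prop
    have h2 := (bkern_integral_stronglyMeasurable hε h.cu).comp_measurable h1
    exact h2
  have d₀ : Integrable fun x => H x * ∫ y, bkern ε t x 0 y * u 0 y :=
    iH.mul_bdd m₀.aestronglyMeasurable
      (Eventually.of_forall fun x => h₀ t 0 (left_mem_Icc.2 hτ) x)
  rw [pairing_self, ← d₁.2, ← d₂.2, pairing, ← integral_const_mul, ← integral_const_mul,
    ← integral_sub_sub d₀ (d₁.1.const_mul _) (d₂.1.const_mul _)]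
  congr 1
  ext x
  rw [h.duhamel hN cN₁ cN₂ bN₁ bN₂ hε ht x, intervalIntegral.integral_of_le ht.1,
    intervalIntegral.integral_of_le ht.1]
  ring

/-- The Schur test bounds the kernel in absolute value, so the restriction s ≤ t costs nothing: the
indicator only decreases the norm. -/
theorem norm_integral_triangle_pairing_le {τ m : ℝ} (hτ : 0 < τ) {H G : ℝ → ℝ × ℝ → ℂ}
    {v v' : ℝ → ℝ → ℝ} {p p' : ℝ → ℝ × ℝ → ℝ} (hH : Mixed τ m H v p) (hG : Mixed τ m G v' p')
    (hY : IntegrableOn (fun t => ∫ x, p t x) (Ioc 0 τ))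
    (hZ : IntegrableOn (fun t => ∫ x, p' t x) (Ioc 0 τ)) {ε : ℝ} (hε : 0 < ε) :
    ‖∫ t in Ioc 0 τ, ∫ s in Ioc 0 t, pairing ε t s (H t) (G s)‖
      ≤ 2 * m * √τ * ((∫ t in Ioc 0 τ, ∫ x, p t x) + ∫ t in Ioc 0 τ, ∫ x, p' t x) := by
  have h0 : (0 : ℝ) ∈ Icc 0 τ := left_mem_Icc.2 hτ.le
  have hm : 0 ≤ m := (integral_nonneg (hH.v_nonneg 0 h0)).trans (hH.v_le 0 h0)
  rw [integral_triangle_eq (fun t s => pairing ε t s (H t) (G s))]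
  refine norm_integral_timeKern_le hτ le_rfl hm hY hZ
    (fun t ht => integral_nonneg (hH.p_nonneg t ⟨ht.1.le, ht.2⟩))
    (fun t ht => integral_nonneg (hG.p_nonneg t ⟨ht.1.le, ht.2⟩)) fun t ht s hs hne => ?_
  exact (norm_indicator_le_norm_self _ _).trans
    (hH.norm_pairing_le hG hε ⟨ht.1.le, ht.2⟩ ⟨hs.1.le, hs.2⟩ hne)

/-- Duhamel splits the pairing in three. The initial datum falls under the homogeneous estimate. The
L² source `N₁` is, after exchanging the time integrals, a superposition over `s` of homogeneous
problems and costs τ n₁. The weighted source `N₂` uses the mixed-norm bound on both sides. The right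
side is free of ε. -/
theorem Schro.norm_integral_pairing_le {τ m n₁ : ℝ} (hτ : 0 < τ)
    {u ut ua ub uaa ubb N N₁ N₂ : ℝ → ℝ × ℝ → ℂ}
    (h : Schro τ u ut ua ub uaa ubb N) (hN : ∀ t x, N t x = N₁ t x + N₂ t x)
    (cN₁ : Continuous (uncurry N₁)) (iN₁ : ∀ t ∈ Icc 0 τ, Integrable fun x => ‖N₁ t x‖ ^ 2)
    (hn₁ : 0 ≤ n₁) (bN₁ : ∀ t ∈ Icc 0 τ, ∫ x, ‖N₁ t x‖ ^ 2 ≤ n₁ ^ 2)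
    (bN₂ : L1Bdd τ N₂) {H : ℝ → ℝ × ℝ → ℂ} {v v' : ℝ → ℝ → ℝ} {p p' : ℝ → ℝ × ℝ → ℝ}
    (hH : Mixed τ m H v p) (hG : Mixed τ m N₂ v' p')
    {k : Set (ℝ × ℝ)} (hk : IsCompact k) (hHk : ∀ t x, x ∉ k → H t x = 0)
    (hY : IntegrableOn (fun t => ∫ x, p t x) (Ioc 0 τ))
    (hZ : IntegrableOn (fun t => ∫ x, p' t x) (Ioc 0 τ)) {ε : ℝ} (hε : 0 < ε) :
    ‖∫ t in Ioc 0 τ, pairing ε t t (H t) (u t)‖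
      ≤ (√(∫ x, ‖u 0 x‖ ^ 2) + τ * n₁) * √(4 * m * √τ * ∫ t in Ioc 0 τ, ∫ x, p t x)
        + 2 * m * √τ * ((∫ t in Ioc 0 τ, ∫ x, p t x) + ∫ t in Ioc 0 τ, ∫ x, p' t x) := by
  have cN₂ := hG.cont
  have L2 : L2Bdd τ N₁ := ⟨n₁ ^ 2, fun t ht => ⟨iN₁ t ht, bN₁ t ht⟩⟩
  have h0 : (0 : ℝ) ∈ Icc 0 τ := left_mem_Icc.2 hτ.le
  have sub : ∀ t ∈ Ioc 0 τ, t ∈ Icc 0 τ := fun t ht => ⟨ht.1.le, ht.2⟩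
  set A := 4 * m * √τ * ∫ t in Ioc 0 τ, ∫ x, p t x with hA
  obtain ⟨C₁, h₁⟩ := bkern_bound_of_l2Bdd cN₁ L2 hε
  obtain ⟨C₂, h₂⟩ := bkern_bound_of_l1Bdd bN₂ hε
  obtain ⟨C₀, h₀⟩ := bkern_bound_of_l2Bdd h.cu h.bu hε
  obtain ⟨D₁, D₁0, e₁⟩ := exists_norm_pairing_le hH.cont hk hHk h₁
  obtain ⟨D₂, D₂0, e₂⟩ := exists_norm_pairing_le hH.cont hk hHk h₂
  obtain ⟨D₀, D₀0, e₀⟩ := exists_norm_pairing_le hH.cont hk hHk h₀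
  have mt : ∀ {g : ℝ → ℝ × ℝ → ℂ}, Continuous (uncurry g) → StronglyMeasurable
      fun t => ∫ s in Ioc 0 τ, (Iic t).indicator (fun s => pairing ε t s (H t) (g s)) s := by
    intro g hg
    have hm : StronglyMeasurable
        (fun q : ℝ × ℝ => (Iic q.1).indicator (fun s => pairing ε q.1 s (H q.1) (g s)) q.2) := by
      have : (fun q : ℝ × ℝ => (Iic q.1).indicator (fun s => pairing ε q.1 s (H q.1) (g s)) q.2)
          = {q : ℝ × ℝ | q.2 ≤ q.1}.indicator
            (fun q => pairing ε q.1 q.2 (H q.1) (g q.2)) := by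
        ext q; simp [indicator]
      rw [this]
      exact (pairing_stronglyMeasurable hε hH.cont hg).indicator
        (measurableSet_le measurable_snd measurable_fst)
    have h3 := hm.integral_prod_right' (ν := volume.restrict (Ioc 0 τ))
    exact h3
  have io : ∀ {g : ℝ → ℝ × ℝ → ℂ} {D : ℝ}, Continuous (uncurry g) → 0 ≤ D →
      (∀ t ∈ Icc 0 τ, ∀ s ∈ Icc 0 τ, ‖pairing ε t s (H t) (g s)‖ ≤ D) →
      IntegrableOn (fun t => ∫ s in Ioc 0 t, pairing ε t s (H t) (g s)) (Ioc 0 τ) := by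
    intro g D hg hD hb
    have m1 : AEStronglyMeasurable (fun t => ∫ s in Ioc 0 t, pairing ε t s (H t) (g s))
        (volume.restrict (Ioc 0 τ)) := by
      refine (mt hg).aestronglyMeasurable.congr ?_
      filter_upwards [ae_restrict_mem measurableSet_Ioc] with t ht
      rw [setIntegral_indicator measurableSet_Iic]
      congr 2
      ext s
      simp only [mem_Ioc, mem_inter_iff, mem_Iic]
      exact ⟨fun q => ⟨q.1.1, q.2⟩, fun q => ⟨⟨q.1, q.2.trans ht.2⟩, q.2⟩⟩
    refine Integrable.of_bound m1 (D * τ) ?_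
    filter_upwards [ae_restrict_mem measurableSet_Ioc] with t ht
    refine (norm_setIntegral_le_of_norm_le_const (C := D) (by simp) fun s hs =>
      hb t (sub t ht) s ⟨hs.1.le, hs.2.trans ht.2⟩).trans ?_
    have : volume.real (Ioc 0 t) = t := by simp [ht.1.le]
    rw [this]
    exact mul_le_mul_of_nonneg_left ht.2 hD
  have i₀ : IntegrableOn (fun t => pairing ε t 0 (H t) (u 0)) (Ioc 0 τ) := by
    have h1 : Measurable fun t : ℝ => ((t, 0) : ℝ × ℝ) := by fun_prop
    have h2 := (pairing_stronglyMeasurable hε hH.cont h.cu).comp_measurable h1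
    refine Measure.integrableOn_of_bounded (M := D₀) (by simp) h2.aestronglyMeasurable ?_
    filter_upwards [ae_restrict_mem measurableSet_Ioc] with t ht
    exact e₀ t (sub t ht) 0 h0
  have i₁ := io cN₁ D₁0 e₁
  have i₂ := io cN₂ D₂0 e₂
  have key : ∫ t in Ioc 0 τ, pairing ε t t (H t) (u t)
      = (∫ t in Ioc 0 τ, pairing ε t 0 (H t) (u 0))
        - Complex.I * (∫ t in Ioc 0 τ, ∫ s in Ioc 0 t, pairing ε t s (H t) (N₁ s))
        - Complex.I * ∫ t in Ioc 0 τ, ∫ s in Ioc 0 t, pairing ε t s (H t) (N₂ s) := by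
    rw [← integral_const_mul, ← integral_const_mul, 
      ← integral_sub_sub i₀ (i₁.const_mul _) (i₂.const_mul _)]
    exact setIntegral_congr_fun measurableSet_Ioc fun t ht =>
      h.pairing_duhamel hN cN₁ cN₂ L2 bN₂ (continuous_slice hH.cont t) (hH.int t (sub t ht)) hε
        (sub t ht)
  -- The square root of the duality bound, for an arbitrary starting time; it is used with s = 0 for
  -- the datum and with every `s` for `N₁`.
  have hom : ∀ {s : ℝ} {g : ℝ × ℝ → ℂ} {r : ℝ}, s ∈ Icc 0 τ → Continuous g →
      (Integrable fun x => ‖g x‖ ^ 2) → 0 ≤ r → ∫ x, ‖g x‖ ^ 2 ≤ r ^ 2 →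
      ‖∫ t in Ioc s τ, pairing ε t s (H t) g‖ ≤ r * √A := by
    intro s g r hs hg hg2 hr hb
    have h3 := hH.sq_norm_integral_pairing_le hτ hk hHk hY hε hs hg hg2
    rw [← hA] at h3
    have hA0 : 0 ≤ A := by
      have hm : 0 ≤ m := (integral_nonneg (hH.v_nonneg s hs)).trans (hH.v_le s hs)
      have := setIntegral_nonneg measurableSet_Ioc (μ := volume)
        (fun t (ht : t ∈ Ioc 0 τ) => integral_nonneg (μ := volume) (hH.p_nonneg t (sub t ht)))
      positivity
    refine abs_le_of_sq_le_sq' ?_ (by positivity) |>.2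
    rw [mul_pow, Real.sq_sqrt hA0]
    exact h3.trans (mul_le_mul_of_nonneg_right hb hA0)
  have T1 : ‖∫ t in Ioc 0 τ, pairing ε t 0 (H t) (u 0)‖ ≤ √(∫ x, ‖u 0 x‖ ^ 2) * √A := by
    obtain ⟨K, hK⟩ := h.bu
    refine hom h0 (continuous_slice h.cu 0) (hK 0 h0).1 (Real.sqrt_nonneg _) ?_
    rw [Real.sq_sqrt (integral_nonneg fun x => sq_nonneg _)]
  have T3 : ‖∫ t in Ioc 0 τ, ∫ s in Ioc 0 t, pairing ε t s (H t) (N₁ s)‖ ≤ τ * n₁ * √A := by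
    rw [integral_triangle_swap (Φ := fun t s => pairing ε t s (H t) (N₁ s))
      (pairing_stronglyMeasurable hε hH.cont cN₁) e₁]
    refine (norm_setIntegral_le_of_norm_le_const (C := n₁ * √A) (by simp) fun s hs =>
      hom (sub s hs) (continuous_slice cN₁ s) (iN₁ s (sub s hs)) hn₁ (bN₁ s (sub s hs))).trans ?_
    have : volume.real (Ioc 0 τ) = τ := by simp [hτ.le]
    rw [this]
    exact le_of_eq (by ring)
  have T2 := norm_integral_triangle_pairing_le hτ hH hG hY hZ hε
  rw [key]
  refine (norm_sub_le _ _).trans ?_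
  refine (add_le_add_left (norm_sub_le _ _) _).trans ?_
  simp only [norm_mul, Complex.norm_I, one_mul]
  linarith

/-- Passage to ε → 0: the bound is uniform in ε, and the heat-smoothed pairings converge to the
plain one for each time. -/
theorem Schro.norm_integral_mul_le {τ m n₁ : ℝ} (hτ : 0 < τ)
    {u ut ua ub uaa ubb N N₁ N₂ : ℝ → ℝ × ℝ → ℂ}
    (h : Schro τ u ut ua ub uaa ubb N) (hN : ∀ t x, N t x = N₁ t x + N₂ t x)
    (cN₁ : Continuous (uncurry N₁)) (iN₁ : ∀ t ∈ Icc 0 τ, Integrable fun x => ‖N₁ t x‖ ^ 2)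
    (hn₁ : 0 ≤ n₁) (bN₁ : ∀ t ∈ Icc 0 τ, ∫ x, ‖N₁ t x‖ ^ 2 ≤ n₁ ^ 2)
    (bN₂ : L1Bdd τ N₂) {H : ℝ → ℝ × ℝ → ℂ} {v v' : ℝ → ℝ → ℝ} {p p' : ℝ → ℝ × ℝ → ℝ}
    (hH : Mixed τ m H v p) (hG : Mixed τ m N₂ v' p')
    {k : Set (ℝ × ℝ)} (hk : IsCompact k) (hHk : ∀ t x, x ∉ k → H t x = 0)
    (hY : IntegrableOn (fun t => ∫ x, p t x) (Ioc 0 τ))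
    (hZ : IntegrableOn (fun t => ∫ x, p' t x) (Ioc 0 τ)) :
    ‖∫ t in Ioc 0 τ, ∫ x, H t x * u t x‖
      ≤ (√(∫ x, ‖u 0 x‖ ^ 2) + τ * n₁) * √(4 * m * √τ * ∫ t in Ioc 0 τ, ∫ x, p t x)
        + 2 * m * √τ * ((∫ t in Ioc 0 τ, ∫ x, p t x) + ∫ t in Ioc 0 τ, ∫ x, p' t x) := by
  have H2c : Continuous (uncurry fun t x => H t x * H t x) := hH.cont.mul hH.cont
  obtain ⟨D, hD⟩ := exists_integral_norm_le (τ := τ) H2c hk (fun t x hx => by simp [hHk t x hx])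
  obtain ⟨K, hK⟩ := h.bu
  have iH2 : ∀ t, Integrable fun x => ‖H t x‖ ^ 2 := fun t => by
    have := (integrable_of_eq_zero_off_compact (continuous_slice H2c t) hk
      (fun x hx => by simp [hHk t x hx])).norm
    simpa [sq] using this
  have lim : Tendsto (fun n => ∫ t in Ioc 0 τ, pairing (epsSeq n) t t (H t) (u t)) atTop
      (𝓝 (∫ t in Ioc 0 τ, ∫ x, H t x * u t x)) := by
    refine tendsto_integral_of_dominated_convergence (fun _ => √D * √K) (fun n => ?_)
      (integrableOn_const (by simp)) (fun n => ?_) ?_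
    · have h1 : Measurable fun t : ℝ => ((t, t) : ℝ × ℝ) := by fun_prop
      have h2 := (pairing_stronglyMeasurable (epsSeq_pos n) hH.cont h.cu).comp_measurable h1
      exact h2.aestronglyMeasurable
    · filter_upwards [ae_restrict_mem measurableSet_Ioc] with t ht
      have ht' : t ∈ Icc 0 τ := ⟨ht.1.le, ht.2⟩
      rw [pairing_self]
      refine (norm_integral_mul_kern_le (epsSeq_pos n) (continuous_slice hH.cont t)
        (continuous_slice h.cu t) (iH2 t) (hK t ht').1).trans ?_
      have hd := hD t ht'
      simp only [norm_mul, ← pow_two ‖_‖] at hd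
      exact mul_le_mul (Real.sqrt_le_sqrt hd) (Real.sqrt_le_sqrt (hK t ht').2)
        (Real.sqrt_nonneg _) (Real.sqrt_nonneg _)
    · filter_upwards [ae_restrict_mem measurableSet_Ioc] with t ht
      simp only [pairing_self]
      exact tendsto_integral_mul_kern (continuous_slice hH.cont t) (continuous_slice h.cu t)
        (iH2 t) (hK t ⟨ht.1.le, ht.2⟩).1 hk (hHk t)
  exact le_of_tendsto lim.norm (Eventually.of_forall fun n =>
    h.norm_integral_pairing_le hτ hN cN₁ iN₁ hn₁ bN₁ bN₂ hH hG hk hHk hY hZ (epsSeq_pos n))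

/-! ### The weighted space-time estimate and the `L²` bound on short time intervals -/

theorem integrableOn_integral_of_l1Bdd {τ : ℝ} (hτ : 0 ≤ τ) {F : ℝ → ℝ × ℝ → ℝ}
    (hF : Continuous (uncurry F)) (bF : L1Bdd τ fun t x => (F t x : ℂ)) :
    IntegrableOn (fun t => ∫ x, F t x) (Ioc 0 τ) := by
  have h1 := bF.intervalIntegrable (Complex.continuous_ofReal.comp hF) hτ
  rw [intervalIntegrable_iff_integrableOn_Ioc_of_le hτ] at h1
  have h2 := h1.re
  refine h2.congr (Eventually.of_forall fun t => ?_)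
  simp only [integral_complex_ofReal]
  exact Complex.ofReal_re _

/-- A nonnegative weight `W` dominated on lines by an integrable function, `W(t, a, b) ≤ v(t, a)`. -/
structure Weight (τ m : ℝ) (W : ℝ → ℝ × ℝ → ℝ) (v : ℝ → ℝ → ℝ) : Prop where
  cont : Continuous (uncurry W)
  nonneg : ∀ t x, 0 ≤ W t x
  v_nonneg : ∀ t ∈ Icc 0 τ, ∀ a, 0 ≤ v t a
  v_int : ∀ t ∈ Icc 0 τ, Integrable (v t)
  v_le : ∀ t ∈ Icc 0 τ, ∫ a, v t a ≤ m
  le : ∀ t ∈ Icc 0 τ, ∀ᵐ a, ∀ b, W t (a, b) ≤ v t a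

/-- In |N|² ≤ W · c² W|u|² one factor W is bounded by its line majorant and the other is kept in the
density. -/
theorem Weight.mixed {τ m c : ℝ} {W : ℝ → ℝ × ℝ → ℝ} {v : ℝ → ℝ → ℝ} (h : Weight τ m W v)
    {u N : ℝ → ℝ × ℝ → ℂ} (cN : Continuous (uncurry N))
    (iN : ∀ t ∈ Icc 0 τ, Integrable (N t)) (hN : ∀ t ∈ Icc 0 τ, ∀ x, ‖N t x‖ ≤ c * W t x * ‖u t x‖)
    (iu : ∀ t ∈ Icc 0 τ, Integrable fun x => W t x * ‖u t x‖ ^ 2) :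
    Mixed τ m N v (fun t x => c ^ 2 * (W t x * ‖u t x‖ ^ 2)) where
  cont := cN
  int := iN
  v_nonneg := h.v_nonneg
  v_int := h.v_int
  v_le := h.v_le
  p_nonneg := fun t _ x => by have := h.nonneg t x; positivity
  p_int := fun t ht => (iu t ht).const_mul _
  bound := fun t ht => by
    filter_upwards [h.le t ht] with a ha b
    have h1 := hN t ht (a, b)
    have h2 := ha b
    have h3 := h.nonneg t (a, b)
    have h4 : ‖N t (a, b)‖ ^ 2 ≤ (c * W t (a, b) * ‖u t (a, b)‖) ^ 2 :=
      pow_le_pow_left₀ (norm_nonneg _) h1 2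
    refine h4.trans ?_
    have h5 : 0 ≤ c ^ 2 * (W t (a, b) * ‖u t (a, b)‖ ^ 2) := by positivity
    have h6 := mul_le_mul_of_nonneg_right h2 h5
    linarith [h6, (by ring : (c * W t (a, b) * ‖u t (a, b)‖) ^ 2
      = W t (a, b) * (c ^ 2 * (W t (a, b) * ‖u t (a, b)‖ ^ 2)))]

/-- The test function is the cutoff of Wū, chosen so that its pairing with `u` is the cutoff
integral of W|u|². The cutoff supplies compact support and, being at most 1, does not spoil the
bound. -/
theorem Weight.mixed_cutoff {τ m : ℝ} {W : ℝ → ℝ × ℝ → ℝ} {v : ℝ → ℝ → ℝ} (h : Weight τ m W v)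
    {u : ℝ → ℝ × ℝ → ℂ} (cu : Continuous (uncurry u))
    (iu : ∀ t ∈ Icc 0 τ, Integrable fun x => W t x * ‖u t x‖ ^ 2) (n : ℕ) :
    Mixed τ m (fun t x => (cutoff n x : ℂ) * ((W t x : ℂ) * conj (u t x))) v
      (fun t x => cutoff n x * (W t x * ‖u t x‖ ^ 2)) := by
  have cχ : Continuous fun q : ℝ × ℝ × ℝ => cutoff n q.2 :=
    (cutoff_continuous n).comp continuous_snd
  have cH : Continuous (uncurry fun t x => (cutoff n x : ℂ) * ((W t x : ℂ) * conj (u t x))) :=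
    (Complex.continuous_ofReal.comp cχ).mul
      ((Complex.continuous_ofReal.comp h.cont).mul (Complex.continuous_conj.comp cu))
  refine ⟨cH, fun t ht => ?_, h.v_nonneg, h.v_int, h.v_le, fun t _ x => ?_, fun t ht => ?_,
    fun t ht => ?_⟩
  · exact integrable_of_eq_zero_off_compact (continuous_slice cH t) (cutBox_isCompact n)
      (fun x hx => by simp [cutoff_eq_zero hx])
  · have := h.nonneg t x
    have := cutoff_nonneg n x
    positivity
  · refine (iu t ht).bdd_mul (c := 1) (cutoff_continuous n).aestronglyMeasurable
      (Eventually.of_forall fun x => ?_)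
    rw [Real.norm_eq_abs, abs_of_nonneg (cutoff_nonneg n x)]
    exact cutoff_le_one n x
  · filter_upwards [h.le t ht] with a ha b
    have h2 := ha b
    have h3 := h.nonneg t (a, b)
    have h7 := cutoff_nonneg n (a, b)
    have h8 := cutoff_le_one n (a, b)
    rw [norm_mul, norm_mul, RCLike.norm_conj, Complex.norm_real, Complex.norm_real,
      Real.norm_of_nonneg h3, Real.norm_of_nonneg h7]
    calc (cutoff n (a, b) * (W t (a, b) * ‖u t (a, b)‖)) ^ 2
        = cutoff n (a, b) * W t (a, b) * (cutoff n (a, b) * (W t (a, b) * ‖u t (a, b)‖ ^ 2)) := by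
          ring
      _ ≤ 1 * v t a * (cutoff n (a, b) * (W t (a, b) * ‖u t (a, b)‖ ^ 2)) := by
          refine mul_le_mul_of_nonneg_right ?_ (by positivity)
          exact mul_le_mul h8 h2 h3 zero_le_one
      _ = _ := by ring

/-- Testing the smoothing estimate with the cutoff of Wū reproduces the left side on the right, once
under a square root and once with a coefficient of order √τ; both are absorbed for small τ. The
cutoff is removed by dominated convergence, the finiteness of the integral being assumed. -/
theorem Schro.weighted_le {τ m c n₁ : ℝ} (hτ : 0 < τ)
    {u ut ua ub uaa ubb N N₁ N₂ : ℝ → ℝ × ℝ → ℂ} {W : ℝ → ℝ × ℝ → ℝ} {v : ℝ → ℝ → ℝ}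
    (h : Schro τ u ut ua ub uaa ubb N) (hN : ∀ t x, N t x = N₁ t x + N₂ t x)
    (cN₁ : Continuous (uncurry N₁)) (iN₁ : ∀ t ∈ Icc 0 τ, Integrable fun x => ‖N₁ t x‖ ^ 2)
    (hn₁ : 0 ≤ n₁) (bN₁ : ∀ t ∈ Icc 0 τ, ∫ x, ‖N₁ t x‖ ^ 2 ≤ n₁ ^ 2)
    (cN₂ : Continuous (uncurry N₂)) (bN₂ : L1Bdd τ N₂) (hW : Weight τ m W v)
    (hN₂ : ∀ t ∈ Icc 0 τ, ∀ x, ‖N₂ t x‖ ≤ c * W t x * ‖u t x‖)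
    (bW : L1Bdd τ fun t x => ((W t x * ‖u t x‖ ^ 2 : ℝ) : ℂ)) :
    ∫ t in Ioc 0 τ, ∫ x, W t x * ‖u t x‖ ^ 2
      ≤ (√(∫ x, ‖u 0 x‖ ^ 2) + τ * n₁)
          * √(4 * m * √τ * ∫ t in Ioc 0 τ, ∫ x, W t x * ‖u t x‖ ^ 2)
        + 2 * m * √τ * (1 + c ^ 2) * ∫ t in Ioc 0 τ, ∫ x, W t x * ‖u t x‖ ^ 2 := by
  have h0 : (0 : ℝ) ∈ Icc 0 τ := left_mem_Icc.2 hτ.le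
  have hm : 0 ≤ m := (integral_nonneg (hW.v_nonneg 0 h0)).trans (hW.v_le 0 h0)
  have cF : Continuous (uncurry fun t x => W t x * ‖u t x‖ ^ 2) := by
    have h1 := hW.cont
    have h2 := h.cu
    have h3 := h1.mul (h2.norm.pow 2)
    exact h3
  have iF : ∀ t ∈ Icc 0 τ, Integrable fun x => W t x * ‖u t x‖ ^ 2 := by
    obtain ⟨K, hK⟩ := bW
    intro t ht
    have := (hK t ht).1.re
    exact this
  have hZ0 := integrableOn_integral_of_l1Bdd hτ.le cF bW
  have hG := hW.mixed cN₂ (fun t ht => by obtain ⟨K, hK⟩ := bN₂; exact (hK t ht).1) hN₂ iF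
  set A := ∫ t in Ioc 0 τ, ∫ x, W t x * ‖u t x‖ ^ 2 with hA
  have hp' : ∫ t in Ioc 0 τ, ∫ x, c ^ 2 * (W t x * ‖u t x‖ ^ 2) = c ^ 2 * A := by
    simp only [integral_const_mul]
    rfl
  have hZ : IntegrableOn (fun t => ∫ x, c ^ 2 * (W t x * ‖u t x‖ ^ 2)) (Ioc 0 τ) := by
    simp only [integral_const_mul]
    exact hZ0.const_mul _
  have key : ∀ n, ‖∫ t in Ioc 0 τ, ∫ x, (cutoff n x : ℂ) * ((W t x * ‖u t x‖ ^ 2 : ℝ) : ℂ)‖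
      ≤ (√(∫ x, ‖u 0 x‖ ^ 2) + τ * n₁) * √(4 * m * √τ * A) + 2 * m * √τ * (1 + c ^ 2) * A := by
    intro n
    have hH := hW.mixed_cutoff h.cu iF n
    have bp : L1Bdd τ fun t x => ((cutoff n x * (W t x * ‖u t x‖ ^ 2) : ℝ) : ℂ) := by
      refine bW.of_norm_le ?_ fun t _ x => ?_
      · have h1 := Complex.continuous_ofReal.comp
          (((cutoff_continuous n).comp (continuous_snd (X := ℝ))).mul cF)
        exact h1
      · rw [Complex.ofReal_mul]
        exact norm_cutoff_mul_le n x _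
    have cp : Continuous (uncurry fun t x => cutoff n x * (W t x * ‖u t x‖ ^ 2)) := by
      have h1 := ((cutoff_continuous n).comp (continuous_snd (X := ℝ))).mul cF
      exact h1
    have hY := integrableOn_integral_of_l1Bdd hτ.le cp bp
    have hb := h.norm_integral_mul_le hτ hN cN₁ iN₁ hn₁ bN₁ bN₂ hH hG (cutBox_isCompact n)
      (fun t x hx => by simp [cutoff_eq_zero hx]) hY hZ
    rw [hp'] at hb
    have hle : ∫ t in Ioc 0 τ, ∫ x, cutoff n x * (W t x * ‖u t x‖ ^ 2) ≤ A := by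
      refine setIntegral_mono_on hY hZ0 measurableSet_Ioc fun t ht => ?_
      have ht' : t ∈ Icc 0 τ := ⟨ht.1.le, ht.2⟩
      refine integral_mono (hH.p_int t ht') (iF t ht') fun x => ?_
      have := hW.nonneg t x
      exact mul_le_of_le_one_left (by positivity) (cutoff_le_one n x)
    have e : ∀ t x, (cutoff n x : ℂ) * ((W t x : ℂ) * conj (u t x)) * u t x
        = (cutoff n x : ℂ) * ((W t x * ‖u t x‖ ^ 2 : ℝ) : ℂ) := by
      intro t x
      have := Complex.conj_mul' (u t x)
      push_cast
      rw [← this]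
      ring
    simp only [e] at hb
    refine hb.trans ?_
    have hL : 0 ≤ √(∫ x, ‖u 0 x‖ ^ 2) + τ * n₁ := by positivity
    have hs : √(4 * m * √τ * ∫ t in Ioc 0 τ, ∫ x, cutoff n x * (W t x * ‖u t x‖ ^ 2))
        ≤ √(4 * m * √τ * A) :=
      Real.sqrt_le_sqrt (mul_le_mul_of_nonneg_left hle (by positivity))
    have h1 := mul_le_mul_of_nonneg_left hs hL
    have h2 : 2 * m * √τ * ((∫ t in Ioc 0 τ, ∫ x, cutoff n x * (W t x * ‖u t x‖ ^ 2)) + c ^ 2 * A)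
        ≤ 2 * m * √τ * (A + c ^ 2 * A) :=
      mul_le_mul_of_nonneg_left (by linarith) (by positivity)
    linarith
  have lim : Tendsto (fun n : ℕ =>
      ∫ t in Ioc 0 τ, ∫ x, (cutoff n x : ℂ) * ((W t x * ‖u t x‖ ^ 2 : ℝ) : ℂ)) atTop
      (𝓝 (∫ t in Ioc 0 τ, ∫ x, ((W t x * ‖u t x‖ ^ 2 : ℝ) : ℂ))) := by
    obtain ⟨K, hK⟩ := bW
    refine tendsto_integral_of_dominated_convergence (fun _ => K) (fun n => ?_)
      (integrableOn_const (by simp)) (fun n => ?_) ?_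
    · have h1 := (Complex.continuous_ofReal.comp
          ((cutoff_continuous n).comp (continuous_snd (X := ℝ)))).mul
          (Complex.continuous_ofReal.comp cF)
      have h2 := h1.stronglyMeasurable.integral_prod_right' (ν := volume)
      exact h2.aestronglyMeasurable
    · filter_upwards [ae_restrict_mem measurableSet_Ioc] with t ht
      have ht' : t ∈ Icc 0 τ := ⟨ht.1.le, ht.2⟩
      refine (norm_integral_le_integral_norm _).trans (le_trans ?_ (hK t ht').2)
      refine integral_mono_of_nonneg (Eventually.of_forall fun x => norm_nonneg _)
        (hK t ht').1.norm (Eventually.of_forall fun x => norm_cutoff_mul_le n x _)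
    · filter_upwards [ae_restrict_mem measurableSet_Ioc] with t ht
      exact integral_cutoff_tendsto (hK t ⟨ht.1.le, ht.2⟩).1
  have hfin := le_of_tendsto lim.norm (Eventually.of_forall key)
  simp only [integral_complex_ofReal] at hfin
  rw [← hA, Complex.norm_real] at hfin
  exact (le_abs_self A).trans hfin

theorem le_of_quadratic_absorb {A L k : ℝ} (hA : 0 ≤ A) (hk : 0 ≤ k)
    (h : A ≤ L * √(4 * k * A) + 1 / 2 * A) : A ≤ 16 * k * L ^ 2 := by
  have h1 : A ≤ 2 * (L * √(4 * k * A)) := by linarith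
  have h2 : A ^ 2 ≤ (2 * (L * √(4 * k * A))) ^ 2 := pow_le_pow_left₀ hA h1 2
  have h3 : √(4 * k * A) ^ 2 = 4 * k * A := Real.sq_sqrt (by positivity)
  have h4 : A ^ 2 ≤ 16 * k * L ^ 2 * A := by
    calc A ^ 2 ≤ _ := h2
      _ = 4 * L ^ 2 * √(4 * k * A) ^ 2 := by ring
      _ = _ := by rw [h3]; ring
  rcases hA.eq_or_lt with h0 | h0
  · rw [← h0]; positivity
  · have : A * A ≤ (16 * k * L ^ 2) * A := by nlinarith
    exact le_of_mul_le_mul_right this h0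

/-- The smallness condition on the length of the time interval. -/
def ShortTime (m c τ : ℝ) : Prop :=
  0 < τ ∧ 2 * m * √τ * (1 + c ^ 2) ≤ 1 / 2 ∧ 512 * c * m * √τ ≤ 1 ∧ 16 * τ * c ≤ 1

theorem ShortTime.mono {m c τ τ' : ℝ} (h : ShortTime m c τ) (hm : 0 ≤ m) (hc : 0 ≤ c) (h0 : 0 < τ')
    (hle : τ' ≤ τ) : ShortTime m c τ' := by
  obtain ⟨_, h1, h2, h3⟩ := h
  have hs := Real.sqrt_le_sqrt hle
  refine ⟨h0, le_trans ?_ h1, le_trans ?_ h2, le_trans ?_ h3⟩ <;> gcongr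

/-- Every requirement is a coefficient times √τ or τ. With τ = D⁻², where D ≥ 1 dominates all the
coefficients, √τ = D⁻¹ and τ ≤ √τ. -/
theorem exists_shortTime {m c : ℝ} (hm : 0 ≤ m) (hc : 0 ≤ c) : ∃ τ, ShortTime m c τ := by
  set D := 1 + 4 * m * (1 + c ^ 2) + 512 * c * m + 16 * c with hD
  have hD1 : 1 ≤ D := by rw [hD]; nlinarith [mul_nonneg hc hm, sq_nonneg c, mul_nonneg hm (sq_nonneg c)]
  have hD0 : 0 < D := by linarith
  have hs : √((D⁻¹) ^ 2) = D⁻¹ := Real.sqrt_sq (by positivity)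
  have hi : D⁻¹ ≤ 1 := inv_le_one_of_one_le₀ hD1
  have key : ∀ y, y ≤ D → y * D⁻¹ ≤ 1 := fun y hy => by
    rw [← div_eq_mul_inv]; exact (div_le_one hD0).2 hy
  refine ⟨(D⁻¹) ^ 2, by positivity, ?_, ?_, ?_⟩
  · rw [hs]
    have := key (4 * m * (1 + c ^ 2)) (by rw [hD]; nlinarith [mul_nonneg hc hm])
    linarith
  · rw [hs]
    have := key (512 * c * m) (by rw [hD]; nlinarith [mul_nonneg hm (sq_nonneg c)])
    linarith
  · have := key (16 * c) (by rw [hD]; nlinarith [mul_nonneg hm (sq_nonneg c), mul_nonneg hc hm])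
    have h1 : (0 : ℝ) < D⁻¹ := by positivity
    nlinarith

/-- Here S is the supremum in time of the L² norm, and `h1`, `h2` are the last two conditions of
`ShortTime`. They reduce the hypothesis to S² ≤ X² + 2XS + S²/8 + (X + S/16)²/16, which rules out S
> 4X. -/
theorem sup_absorb {S X U g τ c k : ℝ} (hS : 0 ≤ S) (hX : 0 ≤ X)
    (hc : 0 ≤ c) (hτ : 0 ≤ τ) (hU : U ≤ X ^ 2) (hgX : τ * g ≤ X) (h1 : 16 * τ * c ≤ 1)
    (h2 : 512 * c * k ≤ 1)
    (h : S ^ 2 ≤ U + 2 * τ * (g + c * S) * S + 2 * c * (16 * k * (X + τ * (c * S)) ^ 2)) :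
    S ^ 2 ≤ 16 * X ^ 2 := by
  have a1 : τ * g * S ≤ X * S := mul_le_mul_of_nonneg_right hgX hS
  have a2 : 16 * τ * c * S ^ 2 ≤ 1 * S ^ 2 := mul_le_mul_of_nonneg_right h1 (sq_nonneg S)
  have a3 : τ * (c * S) ≤ S / 16 := by nlinarith
  have a4 : 0 ≤ τ * (c * S) := by positivity
  have a5 : (X + τ * (c * S)) ^ 2 ≤ (X + S / 16) ^ 2 :=
    pow_le_pow_left₀ (by positivity) (by linarith) 2
  have a6 : 512 * c * k * (X + τ * (c * S)) ^ 2 ≤ 1 * (X + S / 16) ^ 2 :=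
    mul_le_mul h2 a5 (sq_nonneg _) zero_le_one
  nlinarith [sq_nonneg (S - 4 * X), mul_nonneg hX hS]

/-- Minkowski's inequality in squared form: expand and apply Cauchy–Schwarz to the cross term. -/
theorem integral_sq_le_of_norm_le {g : ℝ × ℝ → ℝ} {f w : ℝ × ℝ → ℂ} {c S : ℝ} (cg : Continuous g)
    (g0 : ∀ x, 0 ≤ g x) (ig : Integrable fun x => g x ^ 2) (cf : Continuous f) (cw : Continuous w)
    (iw : Integrable fun x => ‖w x‖ ^ 2) (hc : 0 ≤ c) (hw : √(∫ x, ‖w x‖ ^ 2) ≤ S)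
    (h : ∀ x, ‖f x‖ ≤ g x + c * ‖w x‖) :
    Integrable (fun x => ‖f x‖ ^ 2) ∧
      ∫ x, ‖f x‖ ^ 2 ≤ (√(∫ x, g x ^ 2) + c * S) ^ 2 := by
  have ig' : Integrable fun x => ‖(g x : ℂ)‖ ^ 2 := by simpa using ig
  have cg' : Continuous fun x => (g x : ℂ) := Complex.continuous_ofReal.comp cg
  have igw := (integrable_mul_of_sq cg'.aestronglyMeasurable cw.aestronglyMeasurable ig' iw).norm
  have hcs := integral_norm_mul_le (μ := volume) cg'.aestronglyMeasurable cw.aestronglyMeasurable ig' iw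
  have e1 : ∀ x, ‖(g x : ℂ) * w x‖ = g x * ‖w x‖ := fun x => by
    rw [norm_mul, Complex.norm_real, Real.norm_of_nonneg (g0 x)]
  have e2 : ∀ x, ‖(g x : ℂ)‖ ^ 2 = g x ^ 2 := fun x => by simp
  simp only [e1] at igw hcs
  simp only [e2] at hcs
  have hle : ∀ x, ‖f x‖ ^ 2 ≤ g x ^ 2 + (2 * c) * (g x * ‖w x‖) + c ^ 2 * ‖w x‖ ^ 2 := fun x => by
    have := pow_le_pow_left₀ (norm_nonneg _) (h x) 2
    linarith [(by ring : (g x + c * ‖w x‖) ^ 2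
      = g x ^ 2 + (2 * c) * (g x * ‖w x‖) + c ^ 2 * ‖w x‖ ^ 2)]
  have ib : Integrable fun x => g x ^ 2 + (2 * c) * (g x * ‖w x‖) + c ^ 2 * ‖w x‖ ^ 2 :=
    (ig.add (igw.const_mul _)).add (iw.const_mul _)
  have hf : Integrable fun x => ‖f x‖ ^ 2 :=
    ib.mono' (cf.norm.pow 2).aestronglyMeasurable (Eventually.of_forall fun x => by
      rw [Real.norm_of_nonneg (sq_nonneg _)]; exact hle x)
  refine ⟨hf, (integral_mono hf ib hle).trans ?_⟩
  have e3 : ∫ x, (g x ^ 2 + (2 * c) * (g x * ‖w x‖) + c ^ 2 * ‖w x‖ ^ 2)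
      = (∫ x, g x ^ 2) + (2 * c) * (∫ x, g x * ‖w x‖) + c ^ 2 * ∫ x, ‖w x‖ ^ 2 := by
    have h1 := integral_add (ig.add (igw.const_mul (2 * c))) (iw.const_mul (c ^ 2))
    have h2 := integral_add ig (igw.const_mul (2 * c))
    simp only [Pi.add_apply, integral_const_mul] at h1 h2
    rw [h1, h2]
  rw [e3]
  have G0 : √(∫ x, g x ^ 2) ^ 2 = ∫ x, g x ^ 2 := Real.sq_sqrt (integral_nonneg fun x => sq_nonneg _)
  have W0 : √(∫ x, ‖w x‖ ^ 2) ^ 2 = ∫ x, ‖w x‖ ^ 2 :=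
    Real.sq_sqrt (integral_nonneg fun x => sq_nonneg _)
  have h5 : ∫ x, ‖w x‖ ^ 2 ≤ S ^ 2 := by
    rw [← W0]; exact pow_le_pow_left₀ (Real.sqrt_nonneg _) hw 2
  have h6 : ∫ x, g x * ‖w x‖ ≤ √(∫ x, g x ^ 2) * S :=
    hcs.trans (mul_le_mul_of_nonneg_left hw (Real.sqrt_nonneg _))
  have h7 := mul_le_mul_of_nonneg_left h6 (by positivity : 0 ≤ 2 * c)
  have h8 := mul_le_mul_of_nonneg_left h5 (sq_nonneg c)
  linarith [(by ring : (√(∫ x, g x ^ 2) + c * S) ^ 2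
    = √(∫ x, g x ^ 2) ^ 2 + 2 * c * (√(∫ x, g x ^ 2) * S) + c ^ 2 * S ^ 2)]

/-- In the L² identity the `N₁` part is bounded by Cauchy–Schwarz at each time, and the `N₂` part by
the space-time integral of W|u|² over the whole interval. -/
theorem Schro.integral_sq_le {τ c n₁ S : ℝ} (hτ : 0 ≤ τ)
    {u ut ua ub uaa ubb N N₁ N₂ : ℝ → ℝ × ℝ → ℂ} {W : ℝ → ℝ × ℝ → ℝ}
    (h : Schro τ u ut ua ub uaa ubb N) (hN : ∀ t x, N t x = N₁ t x + N₂ t x)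
    (cN₁ : Continuous (uncurry N₁)) (iN₁ : ∀ t ∈ Icc 0 τ, Integrable fun x => ‖N₁ t x‖ ^ 2)
    (hn₁ : 0 ≤ n₁) (bN₁ : ∀ t ∈ Icc 0 τ, ∫ x, ‖N₁ t x‖ ^ 2 ≤ n₁ ^ 2)
    (cN₂ : Continuous (uncurry N₂)) (cW : Continuous (uncurry W)) (W0 : ∀ t x, 0 ≤ W t x)
    (hc : 0 ≤ c) (hN₂ : ∀ t ∈ Icc 0 τ, ∀ x, ‖N₂ t x‖ ≤ c * W t x * ‖u t x‖)
    (bW : L1Bdd τ fun t x => ((W t x * ‖u t x‖ ^ 2 : ℝ) : ℂ))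
    (hS : ∀ t ∈ Icc 0 τ, √(∫ x, ‖u t x‖ ^ 2) ≤ S) {t : ℝ} (ht : t ∈ Icc 0 τ) :
    ∫ x, ‖u t x‖ ^ 2 ≤ (∫ x, ‖u 0 x‖ ^ 2) + 2 * τ * n₁ * S
      + 2 * c * ∫ t in Ioc 0 τ, ∫ x, W t x * ‖u t x‖ ^ 2 := by
  have h0 : (0 : ℝ) ∈ Icc 0 τ := left_mem_Icc.2 hτ
  have S0 : 0 ≤ S := (Real.sqrt_nonneg _).trans (hS 0 h0)
  have cF : Continuous (uncurry fun t x => W t x * ‖u t x‖ ^ 2) := by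
    have h3 := cW.mul (h.cu.norm.pow 2)
    exact h3
  have cuc : Continuous (uncurry fun t x => conj (u t x)) := by
    have h3 := Complex.continuous_conj.comp h.cu
    exact h3
  have iF : ∀ t ∈ Icc 0 τ, Integrable fun x => W t x * ‖u t x‖ ^ 2 := by
    obtain ⟨K, hK⟩ := bW
    intro t ht
    have := (hK t ht).1.re
    exact this
  have hu2 : ∀ t ∈ Icc 0 τ, Integrable fun x => ‖u t x‖ ^ 2 := by
    obtain ⟨K, hK⟩ := h.bu
    exact fun t ht => (hK t ht).1
  have L2 : L2Bdd τ N₁ := ⟨n₁ ^ 2, fun t ht => ⟨iN₁ t ht, bN₁ t ht⟩⟩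
  have hpt : ∀ s ∈ Icc 0 τ, ∀ x, ‖N₂ s x * conj (u s x)‖ ≤ c * (W s x * ‖u s x‖ ^ 2) := by
    intro s hs x
    rw [norm_mul, RCLike.norm_conj]
    have := mul_le_mul_of_nonneg_right (hN₂ s hs x) (norm_nonneg (u s x))
    linarith [(by ring : c * W s x * ‖u s x‖ * ‖u s x‖ = c * (W s x * ‖u s x‖ ^ 2))]
  have b1 : L1Bdd τ fun t x => N₁ t x * conj (u t x) := L2.mul h.bu.conj cN₁ cuc
  have b2 : L1Bdd τ fun t x => N₂ t x * conj (u t x) := by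
    refine (bW.const_mul c).of_norm_le (cN₂.mul cuc) fun s hs x => (hpt s hs x).trans ?_
    rw [← Complex.ofReal_mul, Complex.norm_real]
    exact le_abs_self _
  have bN : L1Bdd τ fun t x => N t x * conj (u t x) := by
    have h3 := b1.add b2
    have e : (fun t x => N t x * conj (u t x))
        = fun t x => N₁ t x * conj (u t x) + N₂ t x * conj (u t x) := by
      ext t x; rw [hN]; ring
    rw [e]; exact h3
  have id := h.integral_sq bN ht
  have hZ := integrableOn_integral_of_l1Bdd hτ cF bW
  have hZt : IntervalIntegrable (fun s => 2 * n₁ * S + 2 * c * ∫ x, W s x * ‖u s x‖ ^ 2)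
      volume 0 t := by
    have h3 : IntervalIntegrable (fun s => ∫ x, W s x * ‖u s x‖ ^ 2) volume 0 t := by
      rw [intervalIntegrable_iff_integrableOn_Ioc_of_le ht.1]
      exact hZ.mono_set (Ioc_subset_Ioc_right ht.2)
    exact intervalIntegrable_const.add (h3.const_mul _)
  have bd : ‖∫ s in (0 : ℝ)..t, ∫ x, 2 * (N s x * conj (u s x)).im‖
      ≤ ∫ s in (0 : ℝ)..t, (2 * n₁ * S + 2 * c * ∫ x, W s x * ‖u s x‖ ^ 2) := by
    refine intervalIntegral.norm_integral_le_of_norm_le ht.1 (Eventually.of_forall fun s hs => ?_)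
      hZt
    have hs' : s ∈ Icc 0 τ := ⟨hs.1.le, hs.2.trans ht.2⟩
    have cN₁s := continuous_slice cN₁ s
    have cus := continuous_slice cuc s
    have iu' : Integrable fun x => ‖conj (u s x)‖ ^ 2 := by simpa using hu2 s hs'
    have i1 : Integrable fun x => ‖N₁ s x * conj (u s x)‖ :=
      (integrable_mul_of_sq cN₁s.aestronglyMeasurable cus.aestronglyMeasurable (iN₁ s hs') iu').norm
    have k1 := integral_norm_mul_le cN₁s.aestronglyMeasurable cus.aestronglyMeasurable (iN₁ s hs') iu'
    have k2 : ∫ x, ‖N₁ s x * conj (u s x)‖ ≤ n₁ * S := by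
      refine k1.trans (mul_le_mul ?_ ?_ (Real.sqrt_nonneg _) hn₁)
      · exact Real.sqrt_le_iff.2 ⟨hn₁, bN₁ s hs'⟩
      · simpa using hS s hs'
    have ib : Integrable fun x => 2 * ‖N₁ s x * conj (u s x)‖ + 2 * c * (W s x * ‖u s x‖ ^ 2) :=
      (i1.const_mul 2).add ((iF s hs').const_mul (2 * c))
    refine (norm_integral_le_of_norm_le ib (Eventually.of_forall fun x => ?_)).trans ?_
    · rw [Real.norm_eq_abs, abs_mul, abs_two]
      have h5 := Complex.abs_im_le_norm (N s x * conj (u s x))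
      have h6 : ‖N s x * conj (u s x)‖ ≤ ‖N₁ s x * conj (u s x)‖ + ‖N₂ s x * conj (u s x)‖ := by
        rw [hN, add_mul]; exact norm_add_le _ _
      linarith [hpt s hs' x]
    · have h1 := integral_add (i1.const_mul 2) ((iF s hs').const_mul (2 * c))
      simp only [integral_const_mul] at h1
      rw [h1]
      linarith
  have hfin : ∫ s in (0 : ℝ)..t, (2 * n₁ * S + 2 * c * ∫ x, W s x * ‖u s x‖ ^ 2)
      ≤ 2 * τ * n₁ * S + 2 * c * ∫ t in Ioc 0 τ, ∫ x, W t x * ‖u t x‖ ^ 2 := by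
    have h3 : IntervalIntegrable (fun s => ∫ x, W s x * ‖u s x‖ ^ 2) volume 0 t := by
      rw [intervalIntegrable_iff_integrableOn_Ioc_of_le ht.1]
      exact hZ.mono_set (Ioc_subset_Ioc_right ht.2)
    rw [intervalIntegral.integral_add intervalIntegrable_const (h3.const_mul _),
      intervalIntegral.integral_const, intervalIntegral.integral_const_mul,
      intervalIntegral.integral_of_le ht.1]
    have h4 : ∫ s in Ioc 0 t, ∫ x, W s x * ‖u s x‖ ^ 2
        ≤ ∫ s in Ioc 0 τ, ∫ x, W s x * ‖u s x‖ ^ 2 := by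
      refine setIntegral_mono_set hZ (Eventually.of_forall fun s => ?_)
        (Ioc_subset_Ioc_right ht.2).eventuallyLE
      exact integral_nonneg fun x => mul_nonneg (W0 s x) (sq_nonneg _)
    have h5 := mul_le_mul_of_nonneg_left h4 (by positivity : 0 ≤ 2 * c)
    have h6 : (t - 0) * (2 * n₁ * S) ≤ τ * (2 * n₁ * S) :=
      mul_le_mul_of_nonneg_right (by linarith [ht.2]) (by positivity)
    simp only [smul_eq_mul]
    linarith
  have := le_abs_self (∫ s in (0 : ℝ)..t, ∫ x, 2 * (N s x * conj (u s x)).im)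
  rw [Real.norm_eq_abs] at bd
  linarith

/-- The `L²` bound on short time intervals. -/
theorem Schro.short_time_bound {τ m c : ℝ} (hc : 0 ≤ c) (hτ : ShortTime m c τ)
    {u ut ua ub uaa ubb N N₁ N₂ : ℝ → ℝ × ℝ → ℂ} {W : ℝ → ℝ × ℝ → ℝ} {v : ℝ → ℝ → ℝ}
    {g : ℝ × ℝ → ℝ}
    (h : Schro τ u ut ua ub uaa ubb N) (hN : ∀ t x, N t x = N₁ t x + N₂ t x)
    (cN₁ : Continuous (uncurry N₁)) (cg : Continuous g) (g0 : ∀ x, 0 ≤ g x)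
    (ig : Integrable fun x => g x ^ 2)
    (hN₁ : ∀ t ∈ Icc 0 τ, ∀ x, ‖N₁ t x‖ ≤ g x + c * ‖u t x‖)
    (cN₂ : Continuous (uncurry N₂)) (bN₂ : L1Bdd τ N₂) (hW : Weight τ m W v)
    (hN₂ : ∀ t ∈ Icc 0 τ, ∀ x, ‖N₂ t x‖ ≤ c * W t x * ‖u t x‖)
    (bW : L1Bdd τ fun t x => ((W t x * ‖u t x‖ ^ 2 : ℝ) : ℂ)) {t : ℝ} (ht : t ∈ Icc 0 τ) :
    ∫ x, ‖u t x‖ ^ 2 ≤ 16 * (√(∫ x, ‖u 0 x‖ ^ 2) + τ * √(∫ x, g x ^ 2)) ^ 2 := by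
  obtain ⟨τ0, s1, s2, s3⟩ := hτ
  have h0 : (0 : ℝ) ∈ Icc 0 τ := left_mem_Icc.2 τ0.le
  have hm : 0 ≤ m := (integral_nonneg (hW.v_nonneg 0 h0)).trans (hW.v_le 0 h0)
  obtain ⟨K, hK⟩ := id h.bu
  -- The supremum `B` is finite because the solution is bounded in L² a priori; otherwise it could
  -- not be absorbed.
  have bdd : BddAbove ((fun t => ∫ x, ‖u t x‖ ^ 2) '' Icc 0 τ) :=
    ⟨K, by rintro _ ⟨s, hs, rfl⟩; exact (hK s hs).2⟩
  set B := sSup ((fun t => ∫ x, ‖u t x‖ ^ 2) '' Icc 0 τ) with hB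
  have hBle : ∀ s ∈ Icc 0 τ, ∫ x, ‖u s x‖ ^ 2 ≤ B := fun s hs =>
    le_csSup bdd (mem_image_of_mem _ hs)
  have B0 : 0 ≤ B := (integral_nonneg fun x => sq_nonneg _).trans (hBle 0 h0)
  have hS : ∀ s ∈ Icc 0 τ, √(∫ x, ‖u s x‖ ^ 2) ≤ √B := fun s hs => Real.sqrt_le_sqrt (hBle s hs)
  have hn := fun s hs => integral_sq_le_of_norm_le cg g0 ig (continuous_slice cN₁ s)
    (continuous_slice h.cu s) (hK s hs).1 hc (hS s hs) (hN₁ s hs)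
  -- The L² bound on `N₁` is n₁ = ‖g‖ + c√B, so the unknown supremum appears on the right as well.
  have hn0 : 0 ≤ √(∫ x, g x ^ 2) + c * √B := by positivity
  have hA := h.weighted_le τ0 hN cN₁ (fun s hs => (hn s hs).1) hn0 (fun s hs => (hn s hs).2)
    cN₂ bN₂ hW hN₂ bW
  have hE := fun s hs => h.integral_sq_le τ0.le hN cN₁ (fun s hs => (hn s hs).1) hn0
    (fun s hs => (hn s hs).2) cN₂ hW.cont hW.nonneg hc hN₂ bW hS (t := s) hs
  have A0 : 0 ≤ ∫ t in Ioc 0 τ, ∫ x, W t x * ‖u t x‖ ^ 2 :=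
    integral_nonneg fun s => integral_nonneg fun x => mul_nonneg (hW.nonneg s x) (sq_nonneg _)
  generalize (∫ t in Ioc 0 τ, ∫ x, W t x * ‖u t x‖ ^ 2) = A at hA hE A0
  -- The first smallness condition gives the linear term coefficient at most 1/2, and the
  -- square-root term is then resolved.
  have hA' : A ≤ 16 * (m * √τ) *
      (√(∫ x, ‖u 0 x‖ ^ 2) + τ * (√(∫ x, g x ^ 2) + c * √B)) ^ 2 := by
    refine le_of_quadratic_absorb A0 (by positivity) ?_
    rw [← mul_assoc 4]
    have := mul_le_mul_of_nonneg_right s1 A0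
    linarith
  have hsup : B ≤ (∫ x, ‖u 0 x‖ ^ 2) + 2 * τ * (√(∫ x, g x ^ 2) + c * √B) * √B + 2 * c * A := by
    refine csSup_le ((nonempty_Icc.2 τ0.le).image _) ?_
    rintro _ ⟨s, hs, rfl⟩
    exact hE s hs
  have hX : 0 ≤ √(∫ x, ‖u 0 x‖ ^ 2) + τ * √(∫ x, g x ^ 2) := by positivity
  have hU : ∫ x, ‖u 0 x‖ ^ 2 ≤ (√(∫ x, ‖u 0 x‖ ^ 2) + τ * √(∫ x, g x ^ 2)) ^ 2 := by
    have h1 : ∫ x, ‖u 0 x‖ ^ 2 = √(∫ x, ‖u 0 x‖ ^ 2) ^ 2 :=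
      (Real.sq_sqrt (integral_nonneg fun x => sq_nonneg _)).symm
    conv_lhs => rw [h1]
    have : 0 ≤ τ * √(∫ x, g x ^ 2) := by positivity
    exact pow_le_pow_left₀ (Real.sqrt_nonneg _) (by linarith) 2
  have hgX : τ * √(∫ x, g x ^ 2) ≤ √(∫ x, ‖u 0 x‖ ^ 2) + τ * √(∫ x, g x ^ 2) := by
    linarith [Real.sqrt_nonneg (∫ x, ‖u 0 x‖ ^ 2)]
  have hs2 : √B ^ 2 = B := Real.sq_sqrt B0
  have hfin := sup_absorb (k := m * √τ) (Real.sqrt_nonneg B) hX hc τ0.le hU hgX s3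
    (by linarith) (by
      rw [hs2]
      have h1 := mul_le_mul_of_nonneg_left hA' (by positivity : 0 ≤ 2 * c)
      have e : √(∫ x, ‖u 0 x‖ ^ 2) + τ * √(∫ x, g x ^ 2) + τ * (c * √B)
        = √(∫ x, ‖u 0 x‖ ^ 2) + τ * (√(∫ x, g x ^ 2) + c * √B) := by ring
      rw [e]
      linarith)
  rw [hs2] at hfin
  exact (hBle t ht).trans hfin

/-! ### Suprema over lines -/

theorem norm_le_integral_norm_deriv {f f' : ℝ → ℂ} (h : ∀ b, HasDerivAt f (f' b) b)
    (hf : Integrable f) (hf' : Integrable f') (b : ℝ) : ‖f b‖ ≤ ∫ s, ‖f' s‖ := by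
  have h1 := tendsto_zero_of_hasDerivAt_of_integrableOn_Iic (a := b) (fun x _ => h x)
    hf'.integrableOn hf.integrableOn
  have h2 := integral_Iic_of_hasDerivAt_of_tendsto' (a := b) (fun x _ => h x) hf'.integrableOn h1
  rw [sub_zero] at h2
  rw [← h2]
  exact (norm_integral_le_integral_norm _).trans
    (setIntegral_le_integral hf'.norm (Eventually.of_forall fun _ => norm_nonneg _))

/-- The integral over vertical lines of `2 |ψ ψ_b|`, a bound for `|ψ|²` on that line. -/
def lineBound (ψ ψb : ℝ × ℝ → ℂ) (a : ℝ) : ℝ := 2 * ∫ b, ‖ψ (a, b) * ψb (a, b)‖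

theorem lineBound_nonneg (ψ ψb : ℝ × ℝ → ℂ) (a : ℝ) : 0 ≤ lineBound ψ ψb a :=
  mul_nonneg zero_le_two (integral_nonneg fun _ => norm_nonneg _)

/-- The derivative of |ψ|² along a vertical line is at most 2|ψ ψ_b|, so on almost every line its
integral bounds the supremum. Integrating in x₁ and applying Cauchy–Schwarz leaves only L² norms: an
anisotropic substitute for the missing embedding of H¹ in L^∞. -/
theorem lineBound_spec {ψ ψb : ℝ × ℝ → ℂ} (cψ : Continuous ψ) (cψb : Continuous ψb)
    (iψ : Integrable fun x => ‖ψ x‖ ^ 2) (iψb : Integrable fun x => ‖ψb x‖ ^ 2)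
    (h : ∀ a b, HasDerivAt (fun b => ψ (a, b)) (ψb (a, b)) b) :
    Integrable (lineBound ψ ψb) ∧
      ∫ a, lineBound ψ ψb a ≤ 2 * (√(∫ x, ‖ψ x‖ ^ 2) * √(∫ x, ‖ψb x‖ ^ 2)) ∧
      ∀ᵐ a, ∀ b, ‖ψ (a, b)‖ ^ 2 ≤ lineBound ψ ψb a := by
  have ip : Integrable fun x => ‖ψ x * ψb x‖ :=
    (integrable_mul_of_sq cψ.aestronglyMeasurable cψb.aestronglyMeasurable iψ iψb).norm
  have hcs := integral_norm_mul_le (μ := volume) cψ.aestronglyMeasurable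
    cψb.aestronglyMeasurable iψ iψb
  have ip' : Integrable (fun x => ‖ψ x * ψb x‖) ((volume : Measure ℝ).prod volume) := ip
  have iψ' : Integrable (fun x => ‖ψ x‖ ^ 2) ((volume : Measure ℝ).prod volume) := iψ
  refine ⟨(ip'.integral_prod_left).const_mul 2, ?_, ?_⟩
  · simp only [lineBound]
    rw [integral_const_mul]
    have e := integral_prod _ ip'
    rw [← e]
    exact mul_le_mul_of_nonneg_left hcs zero_le_two
  · filter_upwards [ip'.prod_right_ae, iψ'.prod_right_ae] with a ha ha' b
    have cs : Continuous fun b : ℝ => (a, b) := by fun_prop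
    have c1 : Continuous fun b => ψ (a, b) := cψ.comp cs
    have c2 : Continuous fun b => ψb (a, b) := cψb.comp cs
    have hd : ∀ b, HasDerivAt (fun b => ψ (a, b) * conj (ψ (a, b)))
        (ψb (a, b) * conj (ψ (a, b)) + ψ (a, b) * conj (ψb (a, b))) b := fun b =>
      (h a b).mul ((h a b).star)
    have hle : ∀ b, ‖ψb (a, b) * conj (ψ (a, b)) + ψ (a, b) * conj (ψb (a, b))‖
        ≤ 2 * ‖ψ (a, b) * ψb (a, b)‖ := fun b => by
      refine (norm_add_le _ _).trans (le_of_eq ?_)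
      simp only [norm_mul, RCLike.norm_conj]
      ring
    have i1 : Integrable fun b => ψ (a, b) * conj (ψ (a, b)) := by
      refine ha'.mono' (c1.mul (Complex.continuous_conj.comp c1)).aestronglyMeasurable
        (Eventually.of_forall fun b => le_of_eq ?_)
      rw [norm_mul, RCLike.norm_conj, sq]
    have i2 : Integrable fun b => ψb (a, b) * conj (ψ (a, b)) + ψ (a, b) * conj (ψb (a, b)) :=
      (ha.const_mul 2).mono' ((c2.mul (Complex.continuous_conj.comp c1)).add
        (c1.mul (Complex.continuous_conj.comp c2))).aestronglyMeasurable (Eventually.of_forall hle)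
    have h3 := norm_le_integral_norm_deriv hd i1 i2 b
    rw [norm_mul, RCLike.norm_conj, ← sq] at h3
    refine h3.trans ((integral_mono i2.norm (ha.const_mul 2) hle).trans (le_of_eq ?_))
    rw [integral_const_mul, lineBound]

/-- Reflection in the diagonal preserves the measure and exchanges the roles of the axes. -/
theorem lineBound_swap_spec {ψ ψa : ℝ × ℝ → ℂ} (cψ : Continuous ψ) (cψa : Continuous ψa)
    (iψ : Integrable fun x => ‖ψ x‖ ^ 2) (iψa : Integrable fun x => ‖ψa x‖ ^ 2)
    (h : ∀ a b, HasDerivAt (fun a => ψ (a, b)) (ψa (a, b)) a) :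
    Integrable (lineBound (ψ ∘ Prod.swap) (ψa ∘ Prod.swap)) ∧
      ∫ b, lineBound (ψ ∘ Prod.swap) (ψa ∘ Prod.swap) b
        ≤ 2 * (√(∫ x, ‖ψ x‖ ^ 2) * √(∫ x, ‖ψa x‖ ^ 2)) ∧
      ∀ᵐ b, ∀ a, ‖ψ (a, b)‖ ^ 2 ≤ lineBound (ψ ∘ Prod.swap) (ψa ∘ Prod.swap) b := by
  have h1 := lineBound_spec (ψ := ψ ∘ Prod.swap) (ψb := ψa ∘ Prod.swap) (cψ.comp continuous_swap)
    (cψa.comp continuous_swap) (iψ.swap) (iψa.swap) (fun a b => h b a)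
  have e : ∀ f : ℝ × ℝ → ℂ, ∫ x, ‖(f ∘ Prod.swap) x‖ ^ 2 = ∫ x, ‖f x‖ ^ 2 := fun f => by
    have := integral_prod_swap (μ := (volume : Measure ℝ)) (ν := (volume : Measure ℝ))
      (fun x => ‖f x‖ ^ 2)
    exact this
  rw [e, e] at h1
  exact h1

/-- A product `f g` is integrable if `f(a, b) ≤ v(a)` and `g(a, b) ≤ w(b)` with integrable `v, w`. -/
theorem integral_mul_le_of_lines {f g : ℝ × ℝ → ℝ} {v w : ℝ → ℝ} (cf : Continuous f)
    (cg : Continuous g) (f0 : ∀ x, 0 ≤ f x) (g0 : ∀ x, 0 ≤ g x) (iv : Integrable v)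
    (iw : Integrable w) (hf : ∀ᵐ a, ∀ b, f (a, b) ≤ v a) (hg : ∀ᵐ b, ∀ a, g (a, b) ≤ w b) :
    Integrable (fun x => f x * g x) ∧ ∫ x, f x * g x ≤ (∫ a, v a) * ∫ b, w b := by
  have ivw : Integrable (fun x : ℝ × ℝ => v x.1 * w x.2) := iv.mul_prod iw
  have h1 : ∀ᵐ x : ℝ × ℝ, ∀ b, f (x.1, b) ≤ v x.1 :=
    Measure.quasiMeasurePreserving_fst (μ := (volume : Measure ℝ)) (ν := (volume : Measure ℝ)) |>.ae hf
  have h2 : ∀ᵐ x : ℝ × ℝ, ∀ a, g (a, x.2) ≤ w x.2 :=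
    Measure.quasiMeasurePreserving_snd (μ := (volume : Measure ℝ)) (ν := (volume : Measure ℝ)) |>.ae hg
  have hle : ∀ᵐ x : ℝ × ℝ, f x * g x ≤ v x.1 * w x.2 := by
    filter_upwards [h1, h2] with x hx hx'
    exact mul_le_mul (hx x.2) (hx' x.1) (g0 _) ((f0 _).trans (hx x.2))
  have i : Integrable (fun x => f x * g x) := by
    refine ivw.mono' (cf.mul cg).aestronglyMeasurable ?_
    filter_upwards [hle] with x hx
    rwa [Real.norm_of_nonneg (mul_nonneg (f0 x) (g0 x))]
  refine ⟨i, (integral_mono_ae i ivw hle).trans (le_of_eq ?_)⟩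
  exact integral_prod_mul v w

/-! ### `H¹`-bounded families -/

/-- A continuous family with spatial derivatives, bounded in `H¹` by `K`. -/
structure H1Bdd (τ K : ℝ) (u ua ub : ℝ → ℝ × ℝ → ℂ) : Prop where
  cu : Continuous (uncurry u)
  cua : Continuous (uncurry ua)
  cub : Continuous (uncurry ub)
  da : ∀ t a b, HasDerivAt (fun a => u t (a, b)) (ua t (a, b)) a
  db : ∀ t a b, HasDerivAt (fun b => u t (a, b)) (ub t (a, b)) b
  iu : ∀ t ∈ Icc 0 τ, Integrable fun x => ‖u t x‖ ^ 2
  iua : ∀ t ∈ Icc 0 τ, Integrable fun x => ‖ua t x‖ ^ 2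
  iub : ∀ t ∈ Icc 0 τ, Integrable fun x => ‖ub t x‖ ^ 2
  bu : ∀ t ∈ Icc 0 τ, ∫ x, ‖u t x‖ ^ 2 ≤ K
  bua : ∀ t ∈ Icc 0 τ, ∫ x, ‖ua t x‖ ^ 2 ≤ K
  bub : ∀ t ∈ Icc 0 τ, ∫ x, ‖ub t x‖ ^ 2 ≤ K

theorem Schro.h1Bdd {τ : ℝ} {u ut ua ub uaa ubb N : ℝ → ℝ × ℝ → ℂ}
    (h : Schro τ u ut ua ub uaa ubb N) : ∃ K, H1Bdd τ K u ua ub := by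
  obtain ⟨K₁, h₁⟩ := h.bu
  obtain ⟨K₂, h₂⟩ := h.bua
  obtain ⟨K₃, h₃⟩ := h.bub
  exact ⟨max K₁ (max K₂ K₃), h.cu, h.cua, h.cub, h.da, h.db, fun t ht => (h₁ t ht).1,
    fun t ht => (h₂ t ht).1, fun t ht => (h₃ t ht).1,
    fun t ht => (h₁ t ht).2.trans (le_max_left _ _),
    fun t ht => (h₂ t ht).2.trans ((le_max_left _ _).trans (le_max_right _ _)),
    fun t ht => (h₃ t ht).2.trans ((le_max_right _ _).trans (le_max_right _ _))⟩

theorem H1Bdd.line {τ K : ℝ} {u ua ub : ℝ → ℝ × ℝ → ℂ} (h : H1Bdd τ K u ua ub) {t : ℝ}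
    (ht : t ∈ Icc 0 τ) :
    Integrable (lineBound (u t) (ub t)) ∧ ∫ a, lineBound (u t) (ub t) a ≤ 2 * K ∧
      ∀ᵐ a, ∀ b, ‖u t (a, b)‖ ^ 2 ≤ lineBound (u t) (ub t) a := by
  have hK : 0 ≤ K := (integral_nonneg fun x => sq_nonneg _).trans (h.bu t ht)
  obtain ⟨h1, h2, h3⟩ := lineBound_spec (continuous_slice h.cu t) (continuous_slice h.cub t)
    (h.iu t ht) (h.iub t ht) (h.db t)
  refine ⟨h1, h2.trans ?_, h3⟩
  have := mul_le_mul (Real.sqrt_le_sqrt (h.bu t ht)) (Real.sqrt_le_sqrt (h.bub t ht))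
    (Real.sqrt_nonneg _) (Real.sqrt_nonneg _)
  rw [Real.mul_self_sqrt hK] at this
  linarith

theorem H1Bdd.line_swap {τ K : ℝ} {u ua ub : ℝ → ℝ × ℝ → ℂ} (h : H1Bdd τ K u ua ub) {t : ℝ}
    (ht : t ∈ Icc 0 τ) :
    ∃ w : ℝ → ℝ, Integrable w ∧ ∫ b, w b ≤ 2 * K ∧ ∀ᵐ b, ∀ a, ‖u t (a, b)‖ ^ 2 ≤ w b := by
  have hK : 0 ≤ K := (integral_nonneg fun x => sq_nonneg _).trans (h.bu t ht)
  obtain ⟨h1, h2, h3⟩ := lineBound_swap_spec (continuous_slice h.cu t) (continuous_slice h.cua t)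
    (h.iu t ht) (h.iua t ht) (h.da t)
  refine ⟨_, h1, h2.trans ?_, h3⟩
  have := mul_le_mul (Real.sqrt_le_sqrt (h.bu t ht)) (Real.sqrt_le_sqrt (h.bua t ht))
    (Real.sqrt_nonneg _) (Real.sqrt_nonneg _)
  rw [Real.mul_self_sqrt hK] at this
  linarith

/-- Each of the two functions contributes 2K to the mass of the line majorant, which gives 4K. -/
theorem H1Bdd.weight {τ K : ℝ} {u ua ub w wa wb : ℝ → ℝ × ℝ → ℂ} (h : H1Bdd τ K u ua ub)
    (h' : H1Bdd τ K w wa wb) :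
    Weight τ (4 * K) (fun t x => ‖u t x‖ ^ 2 + ‖w t x‖ ^ 2)
      (fun t a => lineBound (u t) (ub t) a + lineBound (w t) (wb t) a) where
  cont := (h.cu.norm.pow 2).add (h'.cu.norm.pow 2)
  nonneg := fun t x => by positivity
  v_nonneg := fun t _ a => add_nonneg (lineBound_nonneg _ _ a) (lineBound_nonneg _ _ a)
  v_int := fun t ht => (h.line ht).1.add (h'.line ht).1
  v_le := fun t ht => by
    rw [integral_add (h.line ht).1 (h'.line ht).1]
    linarith [(h.line ht).2.1, (h'.line ht).2.1]
  le := fun t ht => by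
    filter_upwards [(h.line ht).2.2, (h'.line ht).2.2] with a h1 h2 b
    exact add_le_add (h1 b) (h2 b)

/-- The weight is controlled on vertical lines and |u|² on horizontal lines, so the product is
dominated by v(x₁)w(x₂), as in Ladyzhenskaya's inequality. -/
theorem Weight.l1Bdd_mul {τ m K : ℝ} {W : ℝ → ℝ × ℝ → ℝ} {v : ℝ → ℝ → ℝ} (hW : Weight τ m W v)
    {u ua ub : ℝ → ℝ × ℝ → ℂ} (h : H1Bdd τ K u ua ub) :
    L1Bdd τ fun t x => ((W t x * ‖u t x‖ ^ 2 : ℝ) : ℂ) := by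
  refine ⟨m * (2 * K), fun t ht => ?_⟩
  obtain ⟨w, iw, hw, hle⟩ := h.line_swap ht
  have cW : Continuous (W t) := hW.cont.comp (by fun_prop : Continuous fun x : ℝ × ℝ => (t, x))
  obtain ⟨h1, h2⟩ := integral_mul_le_of_lines (f := W t) (g := fun x => ‖u t x‖ ^ 2) cW
    ((continuous_slice h.cu t).norm.pow 2)
    (hW.nonneg t) (fun x => sq_nonneg _) (hW.v_int t ht) iw (hW.le t ht) hle
  refine ⟨h1.ofReal, ?_⟩
  have e : ∀ x, ‖((W t x * ‖u t x‖ ^ 2 : ℝ) : ℂ)‖ = W t x * ‖u t x‖ ^ 2 := fun x => by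
    rw [Complex.norm_real, Real.norm_of_nonneg (mul_nonneg (hW.nonneg t x) (sq_nonneg _))]
  simp only [e]
  have hv0 : 0 ≤ ∫ a, v t a := integral_nonneg (hW.v_nonneg t ht)
  have hK : 0 ≤ K := (integral_nonneg fun x => sq_nonneg _).trans (h.bu t ht)
  refine h2.trans ((mul_le_mul_of_nonneg_left hw hv0).trans
    (mul_le_mul_of_nonneg_right (hW.v_le t ht) (by positivity)))

/-! ### The power nonlinearity -/

/-- The nonlinearity `|z|^{2γ-2} z`. -/
def nl (γ : ℝ) (z : ℂ) : ℂ := ((‖z‖ ^ (2 * γ - 2) : ℝ) : ℂ) * z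

theorem nl_continuous {γ : ℝ} (hγ : 1 < γ) : Continuous (nl γ) := by
  have : Continuous fun z : ℂ => ‖z‖ ^ (2 * γ - 2) :=
    continuous_norm.rpow_const fun z => Or.inr (by linarith)
  exact (Complex.continuous_ofReal.comp this).mul continuous_id

/-- Used with p = 2γ-2; here γ ≤ 2 means that the nonlinearity is at most cubic. -/
theorem rpow_le_one_add_sq {r p : ℝ} (hr : 0 ≤ r) (hp : 0 ≤ p) (hp2 : p ≤ 2) :
    r ^ p ≤ 1 + r ^ 2 := by
  rcases le_total r 1 with h | h
  · have := Real.rpow_le_one hr h hp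
    nlinarith [sq_nonneg r]
  · have h1 := Real.rpow_le_rpow_of_exponent_le h hp2
    rw [Real.rpow_two] at h1
    linarith

/-- Bernoulli's inequality at s/r - 1 expresses convexity of the power p+1: r^{p+1} - s^{p+1} ≤
(p+1) r^p (r-s). Since s^{p+1} ≤ r s^p, the left side here is no larger, and p+1 ≤ 3. -/
theorem mul_rpow_sub_rpow_le {r s p : ℝ} (hs : 0 ≤ s) (hsr : s ≤ r) (hp : 0 ≤ p) (hp2 : p ≤ 2) :
    r * (r ^ p - s ^ p) ≤ 3 * (1 + r ^ 2) * (r - s) := by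
  rcases (hs.trans hsr).eq_or_lt with h0 | h0
  · have : s = 0 := le_antisymm (h0 ▸ hsr) hs
    rw [← h0, this]; simp
  · have hb := one_add_mul_self_le_rpow_one_add (s := s / r - 1) (p := p + 1)
      (by have : 0 ≤ s / r := by positivity
          linarith) (by linarith)
    rw [add_sub_cancel, Real.div_rpow hs h0.le, Real.rpow_add_one h0.ne'] at hb
    have hrp : 0 < r ^ p := Real.rpow_pos_of_pos h0 p
    have h1 : s ^ (p + 1) ≤ r * s ^ p := by
      rcases hs.eq_or_lt with hz | hz
      · rw [← hz, Real.zero_rpow (by linarith)]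
        exact mul_nonneg h0.le (Real.rpow_nonneg le_rfl _)
      · rw [Real.rpow_add_one hz.ne', mul_comm]
        exact mul_le_mul_of_nonneg_right hsr (Real.rpow_nonneg hs _)
    rw [le_div_iff₀ (by positivity)] at hb
    have h2 : (1 + (p + 1) * (s / r - 1)) * (r ^ p * r) = r ^ p * r + (p + 1) * r ^ p * (s - r) := by
      field_simp
    rw [h2] at hb
    have h3 := rpow_le_one_add_sq h0.le hp hp2
    have h4 : (p + 1) * r ^ p * (r - s) ≤ 3 * (1 + r ^ 2) * (r - s) := by
      refine mul_le_mul_of_nonneg_right ?_ (by linarith)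
      exact mul_le_mul (by linarith) h3 hrp.le (by norm_num)
    linarith

/-- With `z` of larger modulus, split the difference as |w|^p (z-w) + (|z|^p - |w|^p) z. The pieces
have constants 1 and 3, whence 4. -/
theorem norm_nl_sub_le {γ : ℝ} (hγ₁ : 1 < γ) (hγ₂ : γ ≤ 2) (z w : ℂ) :
    ‖nl γ z - nl γ w‖ ≤ 4 * (1 + (‖z‖ ^ 2 + ‖w‖ ^ 2)) * ‖z - w‖ := by
  wlog h : ‖w‖ ≤ ‖z‖ generalizing z w
  · have := this w z (le_of_not_ge h)
    rwa [norm_sub_rev, norm_sub_rev w z, add_comm (‖w‖ ^ 2)] at this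
  have hp : 0 ≤ 2 * γ - 2 := by linarith
  have hp2 : 2 * γ - 2 ≤ 2 := by linarith
  have e : nl γ z - nl γ w = ((‖w‖ ^ (2 * γ - 2) : ℝ) : ℂ) * (z - w)
      + ((‖z‖ ^ (2 * γ - 2) - ‖w‖ ^ (2 * γ - 2) : ℝ) : ℂ) * z := by
    simp only [nl]; push_cast; ring
  rw [e]
  refine (norm_add_le _ _).trans ?_
  have h1 : 0 ≤ ‖z‖ ^ (2 * γ - 2) - ‖w‖ ^ (2 * γ - 2) :=
    sub_nonneg.2 (Real.rpow_le_rpow (norm_nonneg _) h hp)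
  rw [norm_mul, norm_mul, Complex.norm_real, Complex.norm_real, Real.norm_of_nonneg h1,
    Real.norm_of_nonneg (Real.rpow_nonneg (norm_nonneg _) _)]
  have h2 := mul_rpow_sub_rpow_le (norm_nonneg w) h hp hp2
  have h3 := rpow_le_one_add_sq (norm_nonneg w) hp hp2
  have h4 : ‖z‖ - ‖w‖ ≤ ‖z - w‖ := norm_sub_norm_le z w
  have h5 := mul_le_mul_of_nonneg_right h3 (norm_nonneg (z - w))
  have h6 : 3 * (1 + ‖z‖ ^ 2) * (‖z‖ - ‖w‖) ≤ 3 * (1 + ‖z‖ ^ 2) * ‖z - w‖ :=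
    mul_le_mul_of_nonneg_left h4 (by positivity)
  nlinarith [mul_nonneg (sq_nonneg ‖w‖) (norm_nonneg (z - w)),
    mul_nonneg (sq_nonneg ‖z‖) (norm_nonneg (z - w))]

/-! ### Differences of solutions of the nonlinear Schrödinger equation -/

/-- Writing 1 = (1+W)⁻¹ + W(1+W)⁻¹ splits the nonlinear difference continuously into a part bounded
by 4|u|, put with the source into `N₁`, and a part bounded by 4W|u|, taken as `N₂`. This fixes c =
4, and `H1Bdd.weight` fixes m = 4K. -/
theorem diff_bound {γ τ K : ℝ} (hγ₁ : 1 < γ) (hγ₂ : γ ≤ 2) (hτ : ShortTime (4 * K) 4 τ)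
    {ψ ψa ψb φ φa φb ut ua ub uaa ubb : ℝ → ℝ × ℝ → ℂ} {g : ℝ × ℝ → ℂ}
    (hψ : H1Bdd τ K ψ ψa ψb) (hφ : H1Bdd τ K φ φa φb) (cg : Continuous g)
    (ig : Integrable fun x => ‖g x‖ ^ 2)
    (h : Schro τ (fun t x => ψ t x - φ t x) ut ua ub uaa ubb
      (fun t x => nl γ (ψ t x) - nl γ (φ t x) + Complex.I * g x)) {t : ℝ} (ht : t ∈ Icc 0 τ) :
    ∫ x, ‖ψ t x - φ t x‖ ^ 2
      ≤ 16 * (√(∫ x, ‖ψ 0 x - φ 0 x‖ ^ 2) + τ * √(∫ x, ‖g x‖ ^ 2)) ^ 2 := by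
  have hW := hψ.weight hφ
  obtain ⟨K', hu⟩ := h.h1Bdd
  have bW := hW.l1Bdd_mul hu
  have c1 : Continuous (uncurry fun t x => nl γ (ψ t x)) := (nl_continuous hγ₁).comp hψ.cu
  have c2 : Continuous (uncurry fun t x => nl γ (φ t x)) := (nl_continuous hγ₁).comp hφ.cu
  have cD : Continuous (uncurry fun t x => nl γ (ψ t x) - nl γ (φ t x)) := c1.sub c2
  have W1 : ∀ t x, 0 < 1 + (‖ψ t x‖ ^ 2 + ‖φ t x‖ ^ 2) := fun t x => by positivity
  have ci : Continuous (uncurry fun t x => (((1 + (‖ψ t x‖ ^ 2 + ‖φ t x‖ ^ 2))⁻¹ : ℝ) : ℂ)) := by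
    have h1 : Continuous fun q : ℝ × ℝ × ℝ => 1 + (‖ψ q.1 q.2‖ ^ 2 + ‖φ q.1 q.2‖ ^ 2) :=
      continuous_const.add hW.cont
    exact Complex.continuous_ofReal.comp (h1.inv₀ fun q => (W1 q.1 q.2).ne')
  have cW := Complex.continuous_ofReal.comp hW.cont
  have cg' : Continuous (uncurry fun (_ : ℝ) x => Complex.I * g x) :=
    continuous_const.mul (cg.comp continuous_snd)
  have cN₁ := (ci.mul cD).add cg'
  have cN₂ : Continuous (uncurry fun t x => (((1 + (‖ψ t x‖ ^ 2 + ‖φ t x‖ ^ 2))⁻¹ : ℝ) : ℂ)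
      * (nl γ (ψ t x) - nl γ (φ t x)) * ((‖ψ t x‖ ^ 2 + ‖φ t x‖ ^ 2 : ℝ) : ℂ)) :=
    (ci.mul cD).mul cW
  have hD : ∀ t x, ‖(((1 + (‖ψ t x‖ ^ 2 + ‖φ t x‖ ^ 2))⁻¹ : ℝ) : ℂ)
      * (nl γ (ψ t x) - nl γ (φ t x))‖ ≤ 4 * ‖ψ t x - φ t x‖ := by
    intro t x
    have h1 := W1 t x
    rw [norm_mul, Complex.norm_real, Real.norm_of_nonneg (by positivity), inv_mul_le_iff₀ h1]
    have := norm_nl_sub_le hγ₁ hγ₂ (ψ t x) (φ t x)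
    linarith
  have hN₂ : ∀ t x, ‖(((1 + (‖ψ t x‖ ^ 2 + ‖φ t x‖ ^ 2))⁻¹ : ℝ) : ℂ)
      * (nl γ (ψ t x) - nl γ (φ t x)) * ((‖ψ t x‖ ^ 2 + ‖φ t x‖ ^ 2 : ℝ) : ℂ)‖
      ≤ 4 * (‖ψ t x‖ ^ 2 + ‖φ t x‖ ^ 2) * ‖ψ t x - φ t x‖ := by
    intro t x
    have h1 : 0 ≤ ‖ψ t x‖ ^ 2 + ‖φ t x‖ ^ 2 := by positivity
    rw [norm_mul, Complex.norm_real, Real.norm_of_nonneg h1]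
    have := mul_le_mul_of_nonneg_right (hD t x) h1
    linarith
  have bψ : L1Bdd τ fun t x => ((‖ψ t x‖ ^ 2 : ℝ) : ℂ) := by
    refine ⟨K, fun t ht => ⟨(hψ.iu t ht).ofReal, ?_⟩⟩
    simpa using hψ.bu t ht
  have bφ : L1Bdd τ fun t x => ((‖φ t x‖ ^ 2 : ℝ) : ℂ) := by
    refine ⟨K, fun t ht => ⟨(hφ.iu t ht).ofReal, ?_⟩⟩
    simpa using hφ.bu t ht
  -- Qualitative integrability: W|u| ≤ W + W|u|², and both terms are in L¹ uniformly in time.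
  have bN₂ := (((bψ.add bφ).add bW).const_mul 4).of_norm_le cN₂ (fun t ht x => by
    refine (hN₂ t x).trans ?_
    rw [← Complex.ofReal_add, ← Complex.ofReal_add, norm_mul, Complex.norm_real]
    refine le_trans ?_ (mul_le_mul_of_nonneg_left (le_abs_self _) (norm_nonneg _))
    have h1 : 0 ≤ ‖ψ t x‖ ^ 2 + ‖φ t x‖ ^ 2 := by positivity
    rw [show ‖(4 : ℂ)‖ = 4 by simp]
    nlinarith [mul_nonneg h1 (sq_nonneg (‖ψ t x - φ t x‖ - 1)), norm_nonneg (ψ t x - φ t x)])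
  have hfin := h.short_time_bound (by norm_num) hτ
    (N₁ := fun t x => (((1 + (‖ψ t x‖ ^ 2 + ‖φ t x‖ ^ 2))⁻¹ : ℝ) : ℂ)
      * (nl γ (ψ t x) - nl γ (φ t x)) + Complex.I * g x)
    (N₂ := fun t x => (((1 + (‖ψ t x‖ ^ 2 + ‖φ t x‖ ^ 2))⁻¹ : ℝ) : ℂ)
      * (nl γ (ψ t x) - nl γ (φ t x)) * ((‖ψ t x‖ ^ 2 + ‖φ t x‖ ^ 2 : ℝ) : ℂ))
    (g := fun x => ‖g x‖) (fun t x => by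
      have h1 : ((1 + (‖ψ t x‖ ^ 2 + ‖φ t x‖ ^ 2) : ℝ) : ℂ) ≠ 0 := by
        exact_mod_cast (W1 t x).ne'
      have h2 : (((1 + (‖ψ t x‖ ^ 2 + ‖φ t x‖ ^ 2))⁻¹ : ℝ) : ℂ)
          * ((1 + (‖ψ t x‖ ^ 2 + ‖φ t x‖ ^ 2) : ℝ) : ℂ) = 1 := by
        rw [Complex.ofReal_inv]; exact inv_mul_cancel₀ h1
      rw [Complex.ofReal_add, Complex.ofReal_one] at h2
      linear_combination (-(nl γ (ψ t x) - nl γ (φ t x))) * h2)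
    cN₁ cg.norm (fun x => norm_nonneg _) ig (fun t _ x => by
      refine (norm_add_le _ _).trans ?_
      rw [norm_mul Complex.I, Complex.norm_I, one_mul]
      linarith [hD t x]) cN₂ bN₂ hW (fun t _ x => hN₂ t x) bW ht
  exact hfin

/-! ### Time translates, increments, and their propagation along [0, T]. -/

theorem H1Bdd.shift {T K τ t₀ : ℝ} {ψ ψa ψb : ℝ → ℝ × ℝ → ℂ} (h : H1Bdd T K ψ ψa ψb)
    (h0 : 0 ≤ t₀) (h1 : t₀ + τ ≤ T) :
    H1Bdd τ K (fun s => ψ (t₀ + s)) (fun s => ψa (t₀ + s)) (fun s => ψb (t₀ + s)) := by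
  have cs : Continuous fun q : ℝ × ℝ × ℝ => (t₀ + q.1, q.2) := by fun_prop
  have mem : ∀ s ∈ Icc 0 τ, t₀ + s ∈ Icc 0 T := fun s hs =>
    ⟨by linarith [hs.1], by linarith [hs.2]⟩
  exact ⟨h.cu.comp cs, h.cua.comp cs, h.cub.comp cs, fun t => h.da _, fun t => h.db _,
    fun t ht => h.iu _ (mem t ht), fun t ht => h.iua _ (mem t ht), fun t ht => h.iub _ (mem t ht),
    fun t ht => h.bu _ (mem t ht), fun t ht => h.bua _ (mem t ht), fun t ht => h.bub _ (mem t ht)⟩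

theorem H1Bdd.frozen {T K τ t₀ : ℝ} {ψ ψa ψb : ℝ → ℝ × ℝ → ℂ} (h : H1Bdd T K ψ ψa ψb)
    (h0 : t₀ ∈ Icc 0 T) : H1Bdd τ K (fun _ => ψ t₀) (fun _ => ψa t₀) (fun _ => ψb t₀) := by
  have cs : Continuous fun q : ℝ × ℝ × ℝ => (t₀, q.2) := by fun_prop
  exact ⟨h.cu.comp cs, h.cua.comp cs, h.cub.comp cs, fun t => h.da _, fun t => h.db _,
    fun t ht => h.iu _ h0, fun t ht => h.iua _ h0, fun t ht => h.iub _ h0,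
    fun t ht => h.bu _ h0, fun t ht => h.bua _ h0, fun t ht => h.bub _ h0⟩

theorem H1Bdd.l2Bdd {T K : ℝ} {ψ ψa ψb : ℝ → ℝ × ℝ → ℂ} (h : H1Bdd T K ψ ψa ψb) :
    L2Bdd T ψ ∧ L2Bdd T ψa ∧ L2Bdd T ψb :=
  ⟨⟨K, fun t ht => ⟨h.iu t ht, h.bu t ht⟩⟩, ⟨K, fun t ht => ⟨h.iua t ht, h.bua t ht⟩⟩,
    ⟨K, fun t ht => ⟨h.iub t ht, h.bub t ht⟩⟩⟩

theorem L2Bdd.sub {τ : ℝ} {f g : ℝ → ℝ × ℝ → ℂ} (hf : L2Bdd τ f) (hg : L2Bdd τ g)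
    (cf : Continuous (uncurry f)) (cg : Continuous (uncurry g)) :
    L2Bdd τ (fun t x => f t x - g t x) := by
  have h1 := hf.add hg.neg cf cg.neg
  simpa [sub_eq_add_neg] using h1

/-- The equation is autonomous, so two time translates of ψ are both solutions and their difference
has no source. -/
theorem increment_bound {γ T K τ t₀ : ℝ} (hγ₁ : 1 < γ) (hγ₂ : γ ≤ 2) {η : ℝ} (hη : 0 ≤ η)
    {ψ ψt ψa ψb ψaa ψbb : ℝ → ℝ × ℝ → ℂ}
    (h : Schro T ψ ψt ψa ψb ψaa ψbb (fun t x => nl γ (ψ t x))) (hK : H1Bdd T K ψ ψa ψb)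
    (hτ : ShortTime (4 * K) 4 τ) (h0 : 0 ≤ t₀) (h1 : t₀ + η + τ ≤ T) {s : ℝ} (hs : s ∈ Icc 0 τ) :
    ∫ x, ‖ψ (t₀ + η + s) x - ψ (t₀ + s) x‖ ^ 2 ≤ 16 * ∫ x, ‖ψ (t₀ + η) x - ψ t₀ x‖ ^ 2 := by
  have k1 := hK.shift (t₀ := t₀ + η) (τ := τ) (by linarith) h1
  have k2 := hK.shift (t₀ := t₀) (τ := τ) h0 (by linarith)
  have c1 : Continuous fun q : ℝ × ℝ × ℝ => (t₀ + η + q.1, q.2) := by fun_prop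
  have c2 : Continuous fun q : ℝ × ℝ × ℝ => (t₀ + q.1, q.2) := by fun_prop
  have hsch : Schro τ (fun s x => ψ (t₀ + η + s) x - ψ (t₀ + s) x)
      (fun s x => ψt (t₀ + η + s) x - ψt (t₀ + s) x)
      (fun s x => ψa (t₀ + η + s) x - ψa (t₀ + s) x) (fun s x => ψb (t₀ + η + s) x - ψb (t₀ + s) x)
      (fun s x => ψaa (t₀ + η + s) x - ψaa (t₀ + s) x)
      (fun s x => ψbb (t₀ + η + s) x - ψbb (t₀ + s) x)
      (fun s x => nl γ (ψ (t₀ + η + s) x) - nl γ (ψ (t₀ + s) x) + Complex.I * 0) :=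
    { cu := (h.cu.comp c1).sub (h.cu.comp c2)
      cut := (h.cut.comp c1).sub (h.cut.comp c2)
      cua := (h.cua.comp c1).sub (h.cua.comp c2)
      cub := (h.cub.comp c1).sub (h.cub.comp c2)
      cuaa := (h.cuaa.comp c1).sub (h.cuaa.comp c2)
      cubb := (h.cubb.comp c1).sub (h.cubb.comp c2)
      cN := ((h.cN.comp c1).sub (h.cN.comp c2)).add continuous_const
      dt := fun t ht x => by
        have d1 := (h.dt (t₀ + η + t) ⟨by linarith [ht.1], by linarith [ht.2]⟩ x).comp_const_add
        have d2 := (h.dt (t₀ + t) ⟨by linarith [ht.1], by linarith [ht.2]⟩ x).comp_const_add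
        exact d1.sub d2
      da := fun t a b => (h.da _ a b).sub (h.da _ a b)
      db := fun t a b => (h.db _ a b).sub (h.db _ a b)
      daa := fun t a b => (h.daa _ a b).sub (h.daa _ a b)
      dbb := fun t a b => (h.dbb _ a b).sub (h.dbb _ a b)
      bu := k1.l2Bdd.1.sub k2.l2Bdd.1 k1.cu k2.cu
      bua := k1.l2Bdd.2.1.sub k2.l2Bdd.2.1 k1.cua k2.cua
      bub := k1.l2Bdd.2.2.sub k2.l2Bdd.2.2 k1.cub k2.cub
      pde := fun t ht x => by
        rw [h.pde (t₀ + η + t) ⟨by linarith [ht.1], by linarith [ht.2]⟩ x,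
          h.pde (t₀ + t) ⟨by linarith [ht.1], by linarith [ht.2]⟩ x]
        ring }
  have := diff_bound hγ₁ hγ₂ hτ (g := fun _ => 0) k1 k2 continuous_const (by simp) hsch hs
  simp only [add_zero, norm_zero, ne_eq, OfNat.ofNat_ne_zero, not_false_eq_true, zero_pow,
    integral_zero, Real.sqrt_zero, mul_zero] at this
  rwa [Real.sq_sqrt (integral_nonneg fun x => sq_nonneg _)] at this

/-- The comparison function is ψ(0), constant in time. It satisfies the equation up to the defect
(i/2)Δψ(0) - i|ψ(0)|^{2γ-2}ψ(0), which is ∂ₜψ(0) and acts as the source g; the difference starts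
from 0. -/
theorem initial_increment_bound {γ T K τ : ℝ} (hγ₁ : 1 < γ) (hγ₂ : γ ≤ 2)
    {ψ ψt ψa ψb ψaa ψbb : ℝ → ℝ × ℝ → ℂ}
    (h : Schro T ψ ψt ψa ψb ψaa ψbb (fun t x => nl γ (ψ t x))) (hK : H1Bdd T K ψ ψa ψb)
    (hi : Integrable fun x => ‖ψt 0 x‖ ^ 2)
    (hτ : ShortTime (4 * K) 4 τ) (h1 : τ ≤ T) :
    ∫ x, ‖ψ τ x - ψ 0 x‖ ^ 2 ≤ 16 * (τ ^ 2 * ∫ x, ‖ψt 0 x‖ ^ 2) := by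
  have τ0 := hτ.1
  have h0 : (0 : ℝ) ∈ Icc 0 T := left_mem_Icc.2 (by linarith)
  have k1 : H1Bdd τ K ψ ψa ψb := by simpa using hK.shift (t₀ := 0) (τ := τ) le_rfl (by linarith)
  have k2 := hK.frozen (τ := τ) h0
  have c2 : Continuous fun q : ℝ × ℝ × ℝ => ((0 : ℝ), q.2) := by fun_prop
  have hsch : Schro τ (fun s x => ψ s x - ψ 0 x) ψt
      (fun s x => ψa s x - ψa 0 x) (fun s x => ψb s x - ψb 0 x)
      (fun s x => ψaa s x - ψaa 0 x) (fun s x => ψbb s x - ψbb 0 x)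
      (fun s x => nl γ (ψ s x) - nl γ (ψ 0 x) + Complex.I * ψt 0 x) :=
    { cu := h.cu.sub (h.cu.comp c2)
      cut := h.cut
      cua := h.cua.sub (h.cua.comp c2)
      cub := h.cub.sub (h.cub.comp c2)
      cuaa := h.cuaa.sub (h.cuaa.comp c2)
      cubb := h.cubb.sub (h.cubb.comp c2)
      cN := (h.cN.sub (h.cN.comp c2)).add (continuous_const.mul (h.cut.comp c2))
      dt := fun t ht x => (h.dt t ⟨ht.1, by linarith [ht.2]⟩ x).sub_const _
      da := fun t a b => (h.da _ a b).sub (h.da _ a b)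
      db := fun t a b => (h.db _ a b).sub (h.db _ a b)
      daa := fun t a b => (h.daa _ a b).sub (h.daa _ a b)
      dbb := fun t a b => (h.dbb _ a b).sub (h.dbb _ a b)
      bu := k1.l2Bdd.1.sub k2.l2Bdd.1 k1.cu k2.cu
      bua := k1.l2Bdd.2.1.sub k2.l2Bdd.2.1 k1.cua k2.cua
      bub := k1.l2Bdd.2.2.sub k2.l2Bdd.2.2 k1.cub k2.cub
      pde := fun t ht x => by
        have e0 := h.pde 0 h0 x
        rw [h.pde t ⟨ht.1, by linarith [ht.2]⟩ x]
        linear_combination -e0 + ψt 0 x * Complex.I_sq }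
  have := diff_bound hγ₁ hγ₂ hτ k1 k2 (continuous_slice h.cut 0) hi hsch (right_mem_Icc.2 τ0.le)
  simp only [sub_self, norm_zero, ne_eq, OfNat.ofNat_ne_zero, not_false_eq_true, zero_pow,
    integral_zero, Real.sqrt_zero, zero_add] at this
  rwa [mul_pow, Real.sq_sqrt (integral_nonneg fun x => sq_nonneg _)] at this

theorem increment_bound_iterate {γ T K τ : ℝ} (hγ₁ : 1 < γ) (hγ₂ : γ ≤ 2)
    {ψ ψt ψa ψb ψaa ψbb : ℝ → ℝ × ℝ → ℂ}
    (h : Schro T ψ ψt ψa ψb ψaa ψbb (fun t x => nl γ (ψ t x))) (hK : H1Bdd T K ψ ψa ψb)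
    (hK0 : 0 ≤ K) (hτ : ShortTime (4 * K) 4 τ) {η : ℝ} (hη : 0 ≤ η) (n : ℕ) :
    ∀ t, 0 ≤ t → t ≤ n * τ → t + η ≤ T →
      ∫ x, ‖ψ (t + η) x - ψ t x‖ ^ 2 ≤ 16 ^ n * ∫ x, ‖ψ η x - ψ 0 x‖ ^ 2 := by
  have τ0 := hτ.1
  have I0 : 0 ≤ ∫ x, ‖ψ η x - ψ 0 x‖ ^ 2 := integral_nonneg fun x => sq_nonneg _
  induction n with
  | zero =>
    intro t h0 h1 _
    have : t = 0 := le_antisymm (by simpa using h1) h0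
    rw [this]; simp
  | succ n ih =>
    intro t h0 h1 h2
    rcases h0.eq_or_lt with ht | ht
    · rw [← ht]
      simp only [zero_add]
      exact le_mul_of_one_le_left I0 (one_le_pow₀ (by norm_num))
    -- The preceding time is t - τ, or 0 when t is smaller than τ; the last step then has length in
    -- (0, τ], and shorter intervals are still admissible.
    · have hσ : 0 < t - max (t - τ) 0 := by
        rcases le_total (t - τ) 0 with h' | h'
        · rw [max_eq_right h']; linarith
        · rw [max_eq_left h']; linarith
      have hσ' : t - max (t - τ) 0 ≤ τ := by linarith [le_max_left (t - τ) 0]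
      push_cast at h1
      have hb := ih (max (t - τ) 0) (le_max_right _ _)
        (max_le (by linarith) (by positivity)) (by linarith)
      have hb2 := increment_bound hγ₁ hγ₂ hη h hK
        (hτ.mono (by positivity) (by norm_num) hσ hσ') (le_max_right (t - τ) 0)
        (by linarith) (right_mem_Icc.2 hσ.le)
      have e1 : max (t - τ) 0 + η + (t - max (t - τ) 0) = t + η := by ring
      have e2 : max (t - τ) 0 + (t - max (t - τ) 0) = t := by ring
      rw [e1, e2] at hb2
      calc _ ≤ _ := hb2
        _ ≤ 16 * (16 ^ n * ∫ x, ‖ψ η x - ψ 0 x‖ ^ 2) := by linarith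
        _ = _ := by ring

theorem integral_sq_le_of_tendsto {f : ℕ → ℝ × ℝ → ℂ} {F : ℝ × ℝ → ℂ} {B : ℝ}
    (cf : ∀ n, Continuous (f n)) (cF : Continuous F) (hB : 0 ≤ B)
    (h : ∀ x, Tendsto (fun n => f n x) atTop (𝓝 (F x)))
    (hi : ∀ n, Integrable fun x => ‖f n x‖ ^ 2) (hb : ∀ n, ∫ x, ‖f n x‖ ^ 2 ≤ B) :
    Integrable (fun x => ‖F x‖ ^ 2) ∧ ∫ x, ‖F x‖ ^ 2 ≤ B := by
  have l1 : ∀ n, ∫⁻ x, ENNReal.ofReal (‖f n x‖ ^ 2) ≤ ENNReal.ofReal B := fun n => by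
    rw [← ofReal_integral_eq_lintegral_ofReal (hi n) (Eventually.of_forall fun x => sq_nonneg _)]
    exact ENNReal.ofReal_le_ofReal (hb n)
  have l2 : ∫⁻ x, ENNReal.ofReal (‖F x‖ ^ 2) ≤ ENNReal.ofReal B := by
    have e : ∀ x, ENNReal.ofReal (‖F x‖ ^ 2)
        = liminf (fun n => ENNReal.ofReal (‖f n x‖ ^ 2)) atTop := fun x =>
      (((ENNReal.continuous_ofReal.tendsto _).comp ((h x).norm.pow 2)).liminf_eq).symm
    simp only [e]
    refine (lintegral_liminf_le fun n => ?_).trans ?_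
    · exact ENNReal.measurable_ofReal.comp ((cf n).norm.pow 2).measurable
    · exact liminf_le_of_frequently_le' (Frequently.of_forall l1)
  have iF : Integrable (fun x => ‖F x‖ ^ 2) := by
    refine ⟨(cF.norm.pow 2).aestronglyMeasurable, ?_⟩
    rw [hasFiniteIntegral_iff_ofReal (Eventually.of_forall fun x => sq_nonneg _)]
    exact l2.trans_lt ENNReal.ofReal_lt_top
  refine ⟨iF, ?_⟩
  rw [← ofReal_integral_eq_lintegral_ofReal iF (Eventually.of_forall fun x => sq_nonneg _)] at l2
  exact (ENNReal.ofReal_le_ofReal_iff hB).1 l2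

/-- The `L²` norm of the time derivative of a solution of the nonlinear Schrödinger equation is
controlled by its initial value. -/
theorem exists_time_deriv_bound {γ T K : ℝ} (hγ₁ : 1 < γ) (hγ₂ : γ ≤ 2) (hT : 0 < T)
    (hK0 : 0 ≤ K) :
    ∃ C : ℝ, 1 ≤ C ∧ ∀ ψ ψt ψa ψb ψaa ψbb : ℝ → ℝ × ℝ → ℂ,
      Schro T ψ ψt ψa ψb ψaa ψbb (fun t x => nl γ (ψ t x)) → H1Bdd T K ψ ψa ψb →
      (Integrable fun x => ‖ψt 0 x‖ ^ 2) → ∀ t ∈ Icc 0 T, (Integrable fun x => ‖ψt t x‖ ^ 2) ∧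
        ∫ x, ‖ψt t x‖ ^ 2 ≤ C * ∫ x, ‖ψt 0 x‖ ^ 2 := by
  obtain ⟨τ, hτ⟩ := exists_shortTime (m := 4 * K) (c := 4) (by positivity) (by norm_num)
  have τ0 := hτ.1
  obtain ⟨n, hn⟩ := exists_nat_ge (T / τ)
  have hn' : T ≤ n * τ := by rwa [div_le_iff₀ τ0] at hn
  -- The factor 16ⁿ propagates an increment through n ≥ T/τ short intervals; the remaining 16 bounds
  -- the first increment by 16η²‖∂ₜψ(0)‖², and η² cancels in the difference quotient.
  refine ⟨16 ^ n * 16, by nlinarith [one_le_pow₀ (n := n) (by norm_num : (1 : ℝ) ≤ 16)], ?_⟩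
  intro ψ ψt ψa ψb ψaa ψbb h hK hi
  have P0 : 0 ≤ ∫ x, ‖ψt 0 x‖ ^ 2 := integral_nonneg fun x => sq_nonneg _
  have hq : ∀ t, 0 ≤ t → ∀ η, 0 < η → η ≤ τ → t + η ≤ T →
      (Integrable fun x => ‖((η : ℂ))⁻¹ * (ψ (t + η) x - ψ t x)‖ ^ 2) ∧
      ∫ x, ‖((η : ℂ))⁻¹ * (ψ (t + η) x - ψ t x)‖ ^ 2 ≤ 16 ^ n * 16 * ∫ x, ‖ψt 0 x‖ ^ 2 := by
    intro t ht η hη hητ htη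
    have hb := increment_bound_iterate hγ₁ hγ₂ h hK hK0 hτ hη.le n t ht (by linarith) htη
    have hb0 := initial_increment_bound hγ₁ hγ₂ h hK hi
      (hτ.mono (by positivity) (by norm_num) hη hητ) (by linarith)
    have e : ∀ x, ‖((η : ℂ))⁻¹ * (ψ (t + η) x - ψ t x)‖ ^ 2
        = (η ^ 2)⁻¹ * ‖ψ (t + η) x - ψ t x‖ ^ 2 := fun x => by
      rw [norm_mul, norm_inv, Complex.norm_real, Real.norm_of_nonneg hη.le, mul_pow, inv_pow]
    have i1 : Integrable fun x => ‖ψ (t + η) x - ψ t x‖ ^ 2 := by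
      have k1 := hK.frozen (τ := 0) (t₀ := t + η) ⟨by linarith, htη⟩
      have k2 := hK.frozen (τ := 0) (t₀ := t) ⟨ht, by linarith⟩
      obtain ⟨K', hK'⟩ := k1.l2Bdd.1.sub k2.l2Bdd.1 k1.cu k2.cu
      exact (hK' 0 (left_mem_Icc.2 le_rfl)).1
    simp only [e]
    refine ⟨i1.const_mul _, ?_⟩
    rw [integral_const_mul, inv_mul_le_iff₀ (by positivity)]
    have := mul_le_mul_of_nonneg_left hb0 (by positivity : (0 : ℝ) ≤ 16 ^ n)
    linarith
  have hopen : ∀ t ∈ Ioo 0 T, (Integrable fun x => ‖ψt t x‖ ^ 2) ∧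
      ∫ x, ‖ψt t x‖ ^ 2 ≤ 16 ^ n * 16 * ∫ x, ‖ψt 0 x‖ ^ 2 := by
    intro t ht
    have hδ : 0 < min τ (T - t) := lt_min τ0 (by linarith [ht.2])
    have hk : ∀ k : ℕ, 0 < min τ (T - t) * ((k : ℝ) + 1)⁻¹ := fun k => by positivity
    have hk' : ∀ k : ℕ, min τ (T - t) * ((k : ℝ) + 1)⁻¹ ≤ min τ (T - t) := fun k =>
      mul_le_of_le_one_right hδ.le (inv_le_one_of_one_le₀ (by linarith [Nat.cast_nonneg (α := ℝ) k]))
    have hlim : Tendsto (fun k : ℕ => min τ (T - t) * ((k : ℝ) + 1)⁻¹) atTop (𝓝[≠] 0) := by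
      refine tendsto_nhdsWithin_iff.2 ⟨?_, Eventually.of_forall fun k => (hk k).ne'⟩
      have h1 := (tendsto_one_div_add_atTop_nhds_zero_nat (𝕜 := ℝ)).const_mul (min τ (T - t))
      simpa using h1
    refine integral_sq_le_of_tendsto (f := fun k x => ((min τ (T - t) * ((k : ℝ) + 1)⁻¹ : ℝ) : ℂ)⁻¹
      * (ψ (t + min τ (T - t) * ((k : ℝ) + 1)⁻¹) x - ψ t x)) (fun k => ?_)
      (continuous_slice h.cut t) (by positivity) (fun x => ?_)
      (fun k => (hq t ht.1.le _ (hk k) ((hk' k).trans (min_le_left _ _))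
        (by linarith [(hk' k).trans (min_le_right _ _)])).1)
      (fun k => (hq t ht.1.le _ (hk k) ((hk' k).trans (min_le_left _ _))
        (by linarith [(hk' k).trans (min_le_right _ _)])).2)
    · exact continuous_const.mul ((continuous_slice h.cu _).sub (continuous_slice h.cu _))
    · have h1 := (hasDerivAt_iff_tendsto_slope_zero.1 (h.dt t ht x)).comp hlim
      refine h1.congr fun k => ?_
      simp [Function.comp, Complex.real_smul]
  intro t ht
  rcases ht.1.eq_or_lt with h0 | h0
  · rw [← h0]
    exact ⟨hi, le_mul_of_one_le_left P0
      (by nlinarith [one_le_pow₀ (n := n) (by norm_num : (1 : ℝ) ≤ 16)])⟩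
  rcases ht.2.eq_or_lt with h1 | h1
  -- Forward quotients are unavailable at t = T. The endpoint is reached from interior times by
  -- continuity of the time derivative and Fatou's lemma once more.
  · have hm : ∀ k : ℕ, T * (1 - ((k : ℝ) + 2)⁻¹) ∈ Ioo 0 T := fun k => by
      have a1 : (0 : ℝ) < ((k : ℝ) + 2)⁻¹ := by positivity
      have a2 : ((k : ℝ) + 2)⁻¹ < 1 := inv_lt_one_of_one_lt₀ (by linarith [Nat.cast_nonneg (α := ℝ) k])
      exact ⟨by nlinarith, by nlinarith⟩
    have hl : Tendsto (fun k : ℕ => T * (1 - ((k : ℝ) + 2)⁻¹)) atTop (𝓝 T) := by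
      have h1 : Tendsto (fun k : ℕ => ((k : ℝ) + 2)⁻¹) atTop (𝓝 0) :=
        tendsto_inv_atTop_zero.comp (tendsto_atTop_add_const_right _ _ tendsto_natCast_atTop_atTop)
      simpa using (tendsto_const_nhds (x := (1 : ℝ)).sub h1).const_mul T
    rw [h1]
    exact integral_sq_le_of_tendsto (f := fun k => ψt (T * (1 - ((k : ℝ) + 2)⁻¹)))
      (fun k => continuous_slice h.cut _) (continuous_slice h.cut T) (by positivity)
      (fun x => ((continuous_time h.cut x).tendsto T).comp hl) (fun k => (hopen _ (hm k)).1)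
      (fun k => (hopen _ (hm k)).2)
  · exact hopen t ⟨h0, h1⟩

/-! ### Conservation of mass and energy -/

theorem norm_rpow_eq_sq_rpow (γ : ℝ) (z : ℂ) : ‖z‖ ^ (2 * γ - 2) = (‖z‖ ^ 2) ^ (γ - 1) := by
  rw [← Real.rpow_natCast_mul (norm_nonneg z)]
  congr 1
  push_cast
  ring

/-- Since 1 < γ ≤ 2, |ψ|^{2γ} is at most |ψ|² + |ψ|⁴, and the quartic term is integrable by the
two-line argument with |ψ|² itself as the weight. -/
theorem H1Bdd.l1Bdd_rpow {γ T K : ℝ} (hγ₁ : 1 < γ) (hγ₂ : γ ≤ 2) {ψ ψa ψb : ℝ → ℝ × ℝ → ℂ}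
    (h : H1Bdd T K ψ ψa ψb) : L1Bdd T fun t x => (((‖ψ t x‖ ^ 2) ^ γ : ℝ) : ℂ) := by
  have b1 := (h.weight h).l1Bdd_mul h
  have b2 : L1Bdd T fun t x => ((‖ψ t x‖ ^ 2 : ℝ) : ℂ) := by
    refine ⟨K, fun t ht => ⟨(h.iu t ht).ofReal, ?_⟩⟩
    simpa using h.bu t ht
  have c : Continuous (uncurry fun t x => (((‖ψ t x‖ ^ 2) ^ γ : ℝ) : ℂ)) := by
    have h1 : Continuous fun q => (‖uncurry ψ q‖ ^ 2) ^ γ :=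
      (h.cu.norm.pow 2).rpow_const fun q => Or.inr (by linarith)
    exact Complex.continuous_ofReal.comp h1
  refine (b1.add b2).of_norm_le c fun t _ x => ?_
  rw [← Complex.ofReal_add, Complex.norm_real, Complex.norm_real]
  have h0 : 0 ≤ ‖ψ t x‖ ^ 2 := sq_nonneg _
  rw [Real.norm_of_nonneg (Real.rpow_nonneg h0 _)]
  refine le_trans ?_ (le_abs_self _)
  rcases h0.eq_or_lt with h1 | h1
  · rw [← h1, Real.zero_rpow (by linarith)]; simp
  · have h2 : (‖ψ t x‖ ^ 2) ^ γ = (‖ψ t x‖ ^ 2) ^ (γ - 1) * ‖ψ t x‖ ^ 2 := by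
      rw [← Real.rpow_add_one h1.ne', sub_add_cancel]
    have h3 := rpow_le_one_add_sq (norm_nonneg (ψ t x)) (p := 2 * γ - 2) (by linarith) (by linarith)
    rw [norm_rpow_eq_sq_rpow] at h3
    rw [h2]
    nlinarith [mul_le_mul_of_nonneg_right h3 h0, mul_nonneg h0 h0]

/-- The nonlinearity times the conjugate of ψ is real, so the source in the L² identity vanishes. -/
theorem Schro.mass_conserved {γ T : ℝ} (hγ₁ : 1 < γ) (hγ₂ : γ ≤ 2)
    {ψ ψt ψa ψb ψaa ψbb : ℝ → ℝ × ℝ → ℂ}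
    (h : Schro T ψ ψt ψa ψb ψaa ψbb (fun t x => nl γ (ψ t x))) {t : ℝ} (ht : t ∈ Icc 0 T) :
    ∫ x, ‖ψ t x‖ ^ 2 = ∫ x, ‖ψ 0 x‖ ^ 2 := by
  obtain ⟨K, hK⟩ := h.h1Bdd
  have e : ∀ t x, nl γ (ψ t x) * conj (ψ t x)
      = ((‖ψ t x‖ ^ (2 * γ - 2) * ‖ψ t x‖ ^ 2 : ℝ) : ℂ) := fun t x => by
    rw [nl, mul_assoc, Complex.mul_conj']; push_cast; ring
  have c : Continuous (uncurry fun t x => nl γ (ψ t x) * conj (ψ t x)) :=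
    h.cN.mul (Complex.continuous_conj.comp h.cu)
  have b : L1Bdd T fun t x => nl γ (ψ t x) * conj (ψ t x) := by
    refine (hK.l1Bdd_rpow hγ₁ hγ₂).of_norm_le c fun t _ x => le_of_eq ?_
    rw [e, Complex.norm_real, Complex.norm_real, norm_rpow_eq_sq_rpow]
    congr 1
    rcases (sq_nonneg ‖ψ t x‖).eq_or_lt with h1 | h1
    · rw [← h1, Real.zero_rpow (by linarith : γ ≠ 0)]; simp
    · rw [← Real.rpow_add_one h1.ne', sub_add_cancel]
  have := h.integral_sq b ht
  simp only [e, Complex.ofReal_im, mul_zero, integral_zero, intervalIntegral.integral_zero] at this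
  linarith

/-- The energy density of the nonlinear Schrödinger equation. -/
def nlsEnergy (γ : ℝ) (z za zb : ℂ) : ℝ := 1 / 2 * (‖za‖ ^ 2 + ‖zb‖ ^ 2) + (‖z‖ ^ 2) ^ γ / γ

theorem hasDerivAt_sq_rpow {γ : ℝ} (hγ : 1 < γ) {f : ℝ → ℂ} {f' : ℂ} {t : ℝ}
    (h : HasDerivAt f f' t) :
    HasDerivAt (fun s => (((‖f s‖ ^ 2) ^ γ / γ : ℝ) : ℂ))
      (((‖f t‖ ^ (2 * γ - 2) : ℝ) : ℂ) * (f' * conj (f t) + f t * conj f')) t := by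
  have h1 : HasDerivAt (fun s => ‖f s‖ ^ 2) (2 * inner ℝ (f t) f') t := h.norm_sq
  have h2 := ((h1.rpow_const (p := γ) (Or.inr hγ.le)).div_const γ).ofReal_comp
  refine h2.congr_deriv ?_
  rw [norm_rpow_eq_sq_rpow, Complex.inner]
  have hγ0 : γ ≠ 0 := by linarith
  have e : f' * conj (f t) + f t * conj f' = ((2 * (conj (f t) * f').re : ℝ) : ℂ) := by
    have h3 := Complex.add_conj (conj (f t) * f')
    rw [map_mul, Complex.conj_conj] at h3
    rw [mul_comm f', h3]
  rw [mul_comm f' , mul_comm (f t)] at e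
  rw [mul_comm f', mul_comm (f t), e, ← Complex.ofReal_mul]
  congr 1
  rw [show (conj (f t) * f').re = (f' * conj (f t)).re by rw [mul_comm]]
  field_simp

/-- The energy density obeys a conservation law with flux Re(∂ₜψ̄ ∇ψ), which is in L¹ only because
∂ₜψ is assumed bounded in L². -/
theorem Schro.energy_conserved {γ T : ℝ} (hγ₁ : 1 < γ) (hγ₂ : γ ≤ 2)
    {ψ ψt ψa ψb ψaa ψbb ψta ψtb : ℝ → ℝ × ℝ → ℂ}
    (h : Schro T ψ ψt ψa ψb ψaa ψbb (fun t x => nl γ (ψ t x)))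
    (cta : Continuous (uncurry ψta)) (ctb : Continuous (uncurry ψtb))
    (dta : ∀ t ∈ Ioo 0 T, ∀ x, HasDerivAt (fun s => ψa s x) (ψta t x) t)
    (dtb : ∀ t ∈ Ioo 0 T, ∀ x, HasDerivAt (fun s => ψb s x) (ψtb t x) t)
    (dat : ∀ t a b, HasDerivAt (fun a => ψt t (a, b)) (ψta t (a, b)) a)
    (dbt : ∀ t a b, HasDerivAt (fun b => ψt t (a, b)) (ψtb t (a, b)) b)
    (bt : L2Bdd T ψt) {t : ℝ} (ht : t ∈ Icc 0 T) :
    Integrable (fun x => nlsEnergy γ (ψ t x) (ψa t x) (ψb t x)) ∧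
      ∫ x, nlsEnergy γ (ψ t x) (ψa t x) (ψb t x) = ∫ x, nlsEnergy γ (ψ 0 x) (ψa 0 x) (ψb 0 x) := by
  obtain ⟨K, hK⟩ := h.h1Bdd
  have cc : ∀ {f : ℝ → ℝ × ℝ → ℂ}, Continuous (uncurry f) →
      Continuous (uncurry fun t x => conj (f t x)) := fun hf => Complex.continuous_conj.comp hf
  have cE : Continuous (uncurry fun t x => (nlsEnergy γ (ψ t x) (ψa t x) (ψb t x) : ℂ)) := by
    have h1 : Continuous fun q => (‖uncurry ψ q‖ ^ 2) ^ γ :=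
      (h.cu.norm.pow 2).rpow_const fun q => Or.inr (by linarith)
    have h2 : Continuous fun q => 1 / 2 * (‖uncurry ψa q‖ ^ 2 + ‖uncurry ψb q‖ ^ 2)
        + (‖uncurry ψ q‖ ^ 2) ^ γ / γ :=
      (continuous_const.mul ((h.cua.norm.pow 2).add (h.cub.norm.pow 2))).add (h1.div_const γ)
    exact Complex.continuous_ofReal.comp h2
  have eE : ∀ t x, (nlsEnergy γ (ψ t x) (ψa t x) (ψb t x) : ℂ)
      = 1 / 2 * (ψa t x * conj (ψa t x) + ψb t x * conj (ψb t x))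
        + (((‖ψ t x‖ ^ 2) ^ γ / γ : ℝ) : ℂ) := fun t x => by
    rw [nlsEnergy, Complex.mul_conj', Complex.mul_conj']; push_cast; ring
  have bE : L1Bdd T fun t x => (nlsEnergy γ (ψ t x) (ψa t x) (ψb t x) : ℂ) := by
    have b1 := h.bua.mul h.bua.conj h.cua (cc h.cua)
    have b2 := h.bub.mul h.bub.conj h.cub (cc h.cub)
    have b3 := (hK.l1Bdd_rpow hγ₁ hγ₂).const_mul (γ : ℂ)⁻¹
    have b4 := ((b1.add b2).const_mul (1 / 2)).add b3
    have e : (fun t x => (nlsEnergy γ (ψ t x) (ψa t x) (ψb t x) : ℂ))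
        = fun t x => 1 / 2 * (ψa t x * conj (ψa t x) + ψb t x * conj (ψb t x))
          + (γ : ℂ)⁻¹ * (((‖ψ t x‖ ^ 2) ^ γ : ℝ) : ℂ) := by
      ext t x; rw [eE]; push_cast; ring
    rw [e]; exact b4
  have cR : Continuous (uncurry fun t x => ((‖ψ t x‖ ^ (2 * γ - 2) : ℝ) : ℂ)) := by
    have h1 : Continuous fun q => ‖uncurry ψ q‖ ^ (2 * γ - 2) :=
      h.cu.norm.rpow_const fun q => Or.inr (by linarith)
    exact Complex.continuous_ofReal.comp h1
  have c2 : Continuous fun _ : ℝ × ℝ × ℝ => (1 / 2 : ℂ) := continuous_const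
  have hbal := L1Bdd.balance (τ := T)
    (q := fun t x => (nlsEnergy γ (ψ t x) (ψa t x) (ψb t x) : ℂ))
    (qt := fun t x => 1 / 2 * (ψta t x * conj (ψa t x) + ψa t x * conj (ψta t x)
        + (ψtb t x * conj (ψb t x) + ψb t x * conj (ψtb t x)))
      + ((‖ψ t x‖ ^ (2 * γ - 2) : ℝ) : ℂ) * (ψt t x * conj (ψ t x) + ψ t x * conj (ψt t x)))
    (P := fun t x => 1 / 2 * (ψa t x * conj (ψt t x) + ψt t x * conj (ψa t x)))
    (P' := fun t x => 1 / 2 * (ψaa t x * conj (ψt t x) + ψa t x * conj (ψta t x)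
        + (ψta t x * conj (ψa t x) + ψt t x * conj (ψaa t x))))
    (S := fun t x => 1 / 2 * (ψb t x * conj (ψt t x) + ψt t x * conj (ψb t x)))
    (S' := fun t x => 1 / 2 * (ψbb t x * conj (ψt t x) + ψb t x * conj (ψtb t x)
        + (ψtb t x * conj (ψb t x) + ψt t x * conj (ψbb t x))))
    (Q := fun _ _ => 0) cE
    ((c2.mul (((cta.mul (cc h.cua)).add (h.cua.mul (cc cta))).add
      ((ctb.mul (cc h.cub)).add (h.cub.mul (cc ctb))))).add
      (cR.mul ((h.cut.mul (cc h.cu)).add (h.cu.mul (cc h.cut)))))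
    (c2.mul ((h.cua.mul (cc h.cut)).add (h.cut.mul (cc h.cua))))
    (c2.mul (((h.cuaa.mul (cc h.cut)).add (h.cua.mul (cc cta))).add
      ((cta.mul (cc h.cua)).add (h.cut.mul (cc h.cuaa)))))
    (c2.mul ((h.cub.mul (cc h.cut)).add (h.cut.mul (cc h.cub))))
    (c2.mul (((h.cubb.mul (cc h.cut)).add (h.cub.mul (cc ctb))).add
      ((ctb.mul (cc h.cub)).add (h.cut.mul (cc h.cubb)))))
    continuous_const
    (fun t ht x => by
      simp only [eE]
      have d1 := (dta t ht x).mul (dta t ht x).star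
      have d2 := (dtb t ht x).mul (dtb t ht x).star
      exact ((d1.add d2).const_mul (1 / 2)).add (hasDerivAt_sq_rpow hγ₁ (h.dt t ht x)))
    (fun t a b => (((h.daa t a b).mul (dat t a b).star).add
      ((dat t a b).mul (h.daa t a b).star)).const_mul (1 / 2))
    (fun t a b => (((h.dbb t a b).mul (dbt t a b).star).add
      ((dbt t a b).mul (h.dbb t a b).star)).const_mul (1 / 2))
    -- Density rate minus divergence of the flux equals 2 Re((|ψ|^{2γ-2}ψ - ½Δψ) ∂ₜψ̄). The equation
    -- turns the bracket into i∂ₜψ, and i|∂ₜψ|² is purely imaginary.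
    (fun t ht x => by
      have e1 := h.pde t ht x
      have e2 := congrArg conj e1
      simp only [nl, map_sub, map_mul, map_add, map_div₀, Complex.conj_I, Complex.conj_ofReal,
        map_ofNat] at e1 e2
      generalize ((‖ψ t x‖ ^ (2 * γ - 2) : ℝ) : ℂ) = R at *
      have i2 := Complex.I_sq
      linear_combination (-Complex.I * conj (ψt t x)) * e1 + (Complex.I * ψt t x) * e2
        + (-(1 / 2) * (conj (ψt t x)) * (ψaa t x + ψbb t x) + R * ψ t x * conj (ψt t x)
          - 1 / 2 * ψt t x * (conj (ψaa t x) + conj (ψbb t x)) + R * conj (ψ t x) * ψt t x) * i2)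
    bE
    (((h.bua.mul bt.conj h.cua (cc h.cut)).add (bt.mul h.bua.conj h.cut (cc h.cua))).const_mul _)
    (((h.bub.mul bt.conj h.cub (cc h.cut)).add (bt.mul h.bub.conj h.cut (cc h.cub))).const_mul _)
    ⟨0, fun t _ => ⟨integrable_zero _ _ _, by simp⟩⟩ ht
  obtain ⟨B, hB⟩ := bE
  refine ⟨(hB t ht).1.re, ?_⟩
  simp only [integral_complex_ofReal, integral_zero, intervalIntegral.integral_zero] at hbal
  have := sub_eq_zero.1 hbal
  exact_mod_cast this

/-! ### The bound in terms of the initial mass and energy -/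

/-- A smooth finite-energy solution of `∂ₜψ = (i/2) Δψ - i |ψ|^{2γ-2} ψ`, with its derivatives. -/
structure NLS (γ T : ℝ) (ψ ψt ψa ψb ψaa ψbb ψta ψtb : ℝ → ℝ × ℝ → ℂ) : Prop
    extends Schro T ψ ψt ψa ψb ψaa ψbb (fun t x => nl γ (ψ t x)) where
  cta : Continuous (uncurry ψta)
  ctb : Continuous (uncurry ψtb)
  dta : ∀ t ∈ Ioo 0 T, ∀ x, HasDerivAt (fun s => ψa s x) (ψta t x) t
  dtb : ∀ t ∈ Ioo 0 T, ∀ x, HasDerivAt (fun s => ψb s x) (ψtb t x) t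
  dat : ∀ t a b, HasDerivAt (fun a => ψt t (a, b)) (ψta t (a, b)) a
  dbt : ∀ t a b, HasDerivAt (fun b => ψt t (a, b)) (ψtb t (a, b)) b

/-- Conservation bounds each squared norm of ψ and of its two derivatives by M + 2E at all times, so
the constant of `exists_time_deriv_bound` is taken for that value before any solution is chosen. -/
theorem exists_nls_bound {γ T M E : ℝ} (hγ₁ : 1 < γ) (hγ₂ : γ ≤ 2) (hT : 0 < T) (hM : 0 ≤ M)
    (hE : 0 ≤ E) :
    ∃ C : ℝ, 1 ≤ C ∧ ∀ ψ ψt ψa ψb ψaa ψbb ψta ψtb : ℝ → ℝ × ℝ → ℂ,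
      NLS γ T ψ ψt ψa ψb ψaa ψbb ψta ψtb → ∫ x, ‖ψ 0 x‖ ^ 2 ≤ M →
      ∫ x, nlsEnergy γ (ψ 0 x) (ψa 0 x) (ψb 0 x) ≤ E → (Integrable fun x => ‖ψt 0 x‖ ^ 2) →
      ∀ t ∈ Icc 0 T, (Integrable fun x => ‖ψt t x‖ ^ 2) ∧
        ∫ x, ‖ψt t x‖ ^ 2 ≤ C * ∫ x, ‖ψt 0 x‖ ^ 2 := by
  obtain ⟨C, hC, hb⟩ := exists_time_deriv_bound hγ₁ hγ₂ hT (K := M + 2 * E) (by positivity)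
  refine ⟨C, hC, fun ψ ψt ψa ψb ψaa ψbb ψta ψtb h hM0 hE0 hi => ?_⟩
  have hs := h.toSchro
  refine hb ψ ψt ψa ψb ψaa ψbb hs ?_ hi
  obtain ⟨K, hK⟩ := hs.h1Bdd
  have h0 : (0 : ℝ) ∈ Icc 0 T := left_mem_Icc.2 hT.le
  have hK0 : 0 ≤ K := (integral_nonneg fun x => sq_nonneg _).trans (hK.bu 0 h0)
  -- A first pass with an H¹ bound depending on the solution. Its constant is discarded; only the
  -- resulting finiteness of ∂ₜψ in L² is kept, to justify the energy law.
  obtain ⟨C', hC', hb'⟩ := exists_time_deriv_bound hγ₁ hγ₂ hT hK0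
  have bt : L2Bdd T ψt := ⟨_, hb' ψ ψt ψa ψb ψaa ψbb hs hK hi⟩
  have hen := fun t ht => hs.energy_conserved hγ₁ hγ₂ h.cta h.ctb h.dta h.dtb h.dat h.dbt bt
    (t := t) ht
  have hγ0 : 0 < γ := by linarith
  have hgrad : ∀ t ∈ Icc 0 T, ∀ f : ℝ × ℝ → ℂ, (Integrable fun x => ‖f x‖ ^ 2) →
      (∀ x, 1 / 2 * ‖f x‖ ^ 2 ≤ nlsEnergy γ (ψ t x) (ψa t x) (ψb t x)) →
      ∫ x, ‖f x‖ ^ 2 ≤ M + 2 * E := by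
    intro t ht f hf hle
    have h1 := integral_mono (hf.const_mul (1 / 2)) (hen t ht).1 hle
    rw [integral_const_mul, (hen t ht).2] at h1
    linarith
  refine { hK with
    bu := fun t ht => by rw [hs.mass_conserved hγ₁ hγ₂ ht]; linarith
    bua := fun t ht => hgrad t ht _ (hK.iua t ht) fun x => ?_
    bub := fun t ht => hgrad t ht _ (hK.iub t ht) fun x => ?_ }
  all_goals
    have h1 : 0 ≤ (‖ψ t x‖ ^ 2) ^ γ / γ := by positivity
    rw [nlsEnergy]
    nlinarith [sq_nonneg ‖ψa t x‖, sq_nonneg ‖ψb t x‖]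

/-! ### Calculus on the slab `[0, T] × ℝ²` -/

/-- The slab `[0, T] × ℝ²`. -/
def slab (T : ℝ) : Set (ℝ × ℝ × ℝ) := Icc 0 T ×ˢ univ

theorem mem_slab {T t : ℝ} {x : ℝ × ℝ} : (t, x) ∈ slab T ↔ t ∈ Icc 0 T := by simp [slab]

theorem slab_uniqueDiffOn {T : ℝ} (hT : 0 < T) : UniqueDiffOn ℝ (slab T) :=
  (uniqueDiffOn_Icc hT).prod uniqueDiffOn_univ

theorem slab_convex (T : ℝ) : Convex ℝ (slab T) := (convex_Icc 0 T).prod convex_univ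

theorem slab_subset_closure_interior {T : ℝ} (hT : 0 < T) {z : ℝ × ℝ × ℝ} (hz : z ∈ slab T) :
    z ∈ closure (interior (slab T)) := by
  rw [slab, interior_prod_eq, interior_Icc, interior_univ, closure_prod_eq, closure_Ioo hT.ne,
    closure_univ]
  exact hz

/-- The time direction. -/
def dirT : ℝ × ℝ × ℝ := (1, 0, 0)

/-- The first space direction. -/
def dirA : ℝ × ℝ × ℝ := (0, 1, 0)

/-- The second space direction. -/
def dirB : ℝ × ℝ × ℝ := (0, 0, 1)

/-- The extension of a function on the slab, constant in time outside `[0, T]`. -/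
def clamp {V : Type*} (T : ℝ) (F : ℝ × ℝ × ℝ → V) (t : ℝ) (x : ℝ × ℝ) : V := F (max 0 (min T t), x)

theorem clamp_mem {T : ℝ} (hT : 0 < T) (t : ℝ) : max 0 (min T t) ∈ Icc 0 T :=
  ⟨le_max_left _ _, max_le hT.le (min_le_left _ _)⟩

theorem clamp_eq {V : Type*} {T t : ℝ} (ht : t ∈ Icc 0 T) (F : ℝ × ℝ × ℝ → V) (x : ℝ × ℝ) :
    clamp T F t x = F (t, x) := by
  rw [clamp, min_eq_right ht.2, max_eq_right ht.1]

section Calculus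

variable {V : Type*} [NormedAddCommGroup V] [NormedSpace ℝ V]

/-- The directional derivative on the slab, one-sided at its boundary. -/
def ds (T : ℝ) (w : ℝ × ℝ × ℝ) (F : ℝ × ℝ × ℝ → V) (z : ℝ × ℝ × ℝ) : V :=
  fderivWithin ℝ F (slab T) z w

/-- Smoothness on the slab. -/
def Sm (T : ℝ) (F : ℝ × ℝ × ℝ → V) : Prop := ContDiffOn ℝ ∞ F (slab T)

theorem Sm.diff {T : ℝ} {F : ℝ × ℝ × ℝ → V} (h : Sm T F) {z : ℝ × ℝ × ℝ} (hz : z ∈ slab T) :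
    DifferentiableWithinAt ℝ F (slab T) z :=
  (ContDiffOn.differentiableOn h (by simp)) z hz

theorem Sm.hasFDerivWithinAt {T : ℝ} {F : ℝ × ℝ × ℝ → V} (h : Sm T F) {z : ℝ × ℝ × ℝ}
    (hz : z ∈ slab T) : HasFDerivWithinAt F (fderivWithin ℝ F (slab T) z) (slab T) z :=
  (h.diff hz).hasFDerivWithinAt

theorem Sm.smooth_fderivWithin {T : ℝ} (hT : 0 < T) {F : ℝ × ℝ × ℝ → V} (h : Sm T F) :
    ContDiffOn ℝ ∞ (fderivWithin ℝ F (slab T)) (slab T) :=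
  ContDiffOn.fderivWithin h (slab_uniqueDiffOn hT) (by simp)

theorem Sm.dsm {T : ℝ} (hT : 0 < T) {F : ℝ × ℝ × ℝ → V} (h : Sm T F) (w : ℝ × ℝ × ℝ) :
    Sm T (ds T w F) :=
  (h.smooth_fderivWithin hT).clm_apply contDiffOn_const

theorem ds_congr {T : ℝ} {F G : ℝ × ℝ × ℝ → V} (h : EqOn F G (slab T)) (w : ℝ × ℝ × ℝ) :
    EqOn (ds T w F) (ds T w G) (slab T) := fun z hz => by
  rw [ds, ds, fderivWithin_congr h (h hz)]

theorem ds_of_hasFDerivWithinAt {T : ℝ} (hT : 0 < T) {F : ℝ × ℝ × ℝ → V}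
    {F' : ℝ × ℝ × ℝ →L[ℝ] V} {z : ℝ × ℝ × ℝ} (h : HasFDerivWithinAt F F' (slab T) z)
    (hz : z ∈ slab T) (w : ℝ × ℝ × ℝ) : ds T w F z = F' w := by
  rw [ds, h.fderivWithin (slab_uniqueDiffOn hT z hz)]

theorem ds_add {T : ℝ} (hT : 0 < T) {F G : ℝ × ℝ × ℝ → V} (hF : Sm T F) (hG : Sm T G)
    (w : ℝ × ℝ × ℝ) {z : ℝ × ℝ × ℝ} (hz : z ∈ slab T) :
    ds T w (fun z => F z + G z) z = ds T w F z + ds T w G z :=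
  ds_of_hasFDerivWithinAt hT ((hF.hasFDerivWithinAt hz).add (hG.hasFDerivWithinAt hz)) hz w

theorem ds_sub {T : ℝ} (hT : 0 < T) {F G : ℝ × ℝ × ℝ → V} (hF : Sm T F) (hG : Sm T G)
    (w : ℝ × ℝ × ℝ) {z : ℝ × ℝ × ℝ} (hz : z ∈ slab T) :
    ds T w (fun z => F z - G z) z = ds T w F z - ds T w G z :=
  ds_of_hasFDerivWithinAt hT ((hF.hasFDerivWithinAt hz).sub (hG.hasFDerivWithinAt hz)) hz w

theorem ds_mul {T : ℝ} (hT : 0 < T) {A : Type*} [NormedCommRing A] [NormedAlgebra ℝ A]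
    {F G : ℝ × ℝ × ℝ → A} (hF : Sm T F) (hG : Sm T G)
    (w : ℝ × ℝ × ℝ) {z : ℝ × ℝ × ℝ} (hz : z ∈ slab T) :
    ds T w (fun z => F z * G z) z = F z * ds T w G z + G z * ds T w F z := by
  refine (ds_of_hasFDerivWithinAt hT
    ((hF.hasFDerivWithinAt hz).mul (hG.hasFDerivWithinAt hz)) hz w).trans ?_
  simp [ds]

theorem ds_const_mul {T : ℝ} (hT : 0 < T) {A : Type*} [NormedCommRing A] [NormedAlgebra ℝ A]
    (c : A) {F : ℝ × ℝ × ℝ → A} (hF : Sm T F)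
    (w : ℝ × ℝ × ℝ) {z : ℝ × ℝ × ℝ} (hz : z ∈ slab T) :
    ds T w (fun z => c * F z) z = c * ds T w F z := by
  refine (ds_of_hasFDerivWithinAt hT ((hF.hasFDerivWithinAt hz).const_mul c) hz w).trans ?_
  simp [ds]

theorem ds_ofReal {T : ℝ} (hT : 0 < T) {F : ℝ × ℝ × ℝ → ℝ} (hF : Sm T F)
    (w : ℝ × ℝ × ℝ) {z : ℝ × ℝ × ℝ} (hz : z ∈ slab T) :
    ds T w (fun z => (F z : ℂ)) z = ds T w F z :=
  ds_of_hasFDerivWithinAt hT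
    (Complex.ofRealCLM.hasFDerivAt.comp_hasFDerivWithinAt z (hF.hasFDerivWithinAt hz)) hz w

/-- Second derivatives within a set are symmetric wherever the set lies in the closure of its
interior, which includes the faces t = 0 and t = T. -/
theorem ds_comm {T : ℝ} (hT : 0 < T) {F : ℝ × ℝ × ℝ → V} (h : Sm T F) (w w' : ℝ × ℝ × ℝ)
    {z : ℝ × ℝ × ℝ} (hz : z ∈ slab T) : ds T w (ds T w' F) z = ds T w' (ds T w F) z := by
  have hs : IsSymmSndFDerivWithinAt ℝ F (slab T) z :=
    (h z hz).isSymmSndFDerivWithinAt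
      (by rw [minSmoothness_of_isRCLikeNormedField]; exact WithTop.coe_le_coe.2 (le_top : (2 : ℕ∞) ≤ ⊤)) (slab_uniqueDiffOn hT)
      (slab_subset_closure_interior hT hz) hz
  have key : ∀ w w' : ℝ × ℝ × ℝ, ds T w (ds T w' F) z
      = (fderivWithin ℝ (fderivWithin ℝ F (slab T)) (slab T) z) w w' := fun w w' => by
    have h1 : HasFDerivWithinAt (fderivWithin ℝ F (slab T))
        (fderivWithin ℝ (fderivWithin ℝ F (slab T)) (slab T) z) (slab T) z :=
      (((h.smooth_fderivWithin hT).differentiableOn (by simp)) z hz).hasFDerivWithinAt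
    have h2 := h1.clm_apply (hasFDerivWithinAt_const w' z (slab T))
    refine (ds_of_hasFDerivWithinAt hT h2 hz w).trans ?_
    simp
  rw [key, key]
  exact hs w w'

theorem Sm.hasDerivAt_fst {T : ℝ} {F : ℝ × ℝ × ℝ → V} (h : Sm T F) {t : ℝ} (ht : t ∈ Icc 0 T)
    (a b : ℝ) : HasDerivAt (fun a => F (t, a, b)) (ds T dirA F (t, a, b)) a := by
  have h1 : HasDerivAt (fun a : ℝ => (t, a, b)) dirA a :=
    (hasDerivAt_const a t).prodMk ((hasDerivAt_id a).prodMk (hasDerivAt_const a b))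
  have h2 := (h.hasFDerivWithinAt (mem_slab.2 ht : (t, a, b) ∈ slab T)).comp_hasDerivWithinAt
    (s := univ) a h1.hasDerivWithinAt (fun _ _ => mem_slab.2 ht)
  exact h2.hasDerivAt univ_mem

theorem Sm.hasDerivAt_snd {T : ℝ} {F : ℝ × ℝ × ℝ → V} (h : Sm T F) {t : ℝ} (ht : t ∈ Icc 0 T)
    (a b : ℝ) : HasDerivAt (fun b => F (t, a, b)) (ds T dirB F (t, a, b)) b := by
  have h1 : HasDerivAt (fun b : ℝ => (t, a, b)) dirB b :=
    (hasDerivAt_const b t).prodMk ((hasDerivAt_const b a).prodMk (hasDerivAt_id b))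
  have h2 := (h.hasFDerivWithinAt (mem_slab.2 ht : (t, a, b) ∈ slab T)).comp_hasDerivWithinAt
    (s := univ) b h1.hasDerivWithinAt (fun _ _ => mem_slab.2 ht)
  exact h2.hasDerivAt univ_mem

theorem Sm.hasDerivWithinAt_time {T : ℝ} {F : ℝ × ℝ × ℝ → V} (h : Sm T F) {t : ℝ}
    (ht : t ∈ Icc 0 T) (x : ℝ × ℝ) :
    HasDerivWithinAt (fun s => F (s, x)) (ds T dirT F (t, x)) (Icc 0 T) t := by
  have h1 : HasDerivAt (fun s : ℝ => (s, x)) dirT t :=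
    (hasDerivAt_id t).prodMk (hasDerivAt_const t x)
  exact (h.hasFDerivWithinAt (mem_slab.2 ht : (t, x) ∈ slab T)).comp_hasDerivWithinAt
    t h1.hasDerivWithinAt (fun _ hs => mem_slab.2 hs)

theorem Sm.clamp_continuous {T : ℝ} (hT : 0 < T) {F : ℝ × ℝ × ℝ → V} (h : Sm T F) :
    Continuous (uncurry (clamp T F)) := by
  have h1 : Continuous fun q : ℝ × ℝ × ℝ => (max 0 (min T q.1), q.2) := by fun_prop
  exact (ContDiffOn.continuousOn h).comp_continuous h1 fun q => mem_slab.2 (clamp_mem hT _)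

theorem Sm.clamp_time {T : ℝ} {F : ℝ × ℝ × ℝ → V} (h : Sm T F) {t : ℝ}
    (ht : t ∈ Ioo 0 T) (x : ℝ × ℝ) :
    HasDerivAt (fun s => clamp T F s x) (ds T dirT F (t, x)) t := by
  have hn : Icc 0 T ∈ 𝓝 t := Icc_mem_nhds ht.1 ht.2
  refine ((h.hasDerivWithinAt_time ⟨ht.1.le, ht.2.le⟩ x).hasDerivAt hn).congr_of_eventuallyEq ?_
  filter_upwards [hn] with s hs
  exact clamp_eq hs F x

end Calculus

/-- Square integrability of the time slices, uniformly on `[0, T]`. -/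
def SlabL2 (T : ℝ) (F : ℝ × ℝ × ℝ → ℂ) : Prop :=
  ∃ K, ∀ t ∈ Icc 0 T, (Integrable fun x => ‖F (t, x)‖ ^ 2) ∧ ∫ x, ‖F (t, x)‖ ^ 2 ≤ K

theorem SlabL2.l2Bdd {T : ℝ} {F : ℝ × ℝ × ℝ → ℂ} (h : SlabL2 T F) : L2Bdd T (clamp T F) := by
  obtain ⟨K, hK⟩ := h
  refine ⟨K, fun t ht => ?_⟩
  simp only [clamp_eq ht]
  exact hK t ht

/-- Clamping the time makes every function continuous on all of ℝ × ℝ² and commutes with space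
derivatives at every time. It commutes with time derivatives only inside (0, T), which is all that
`Reg` asks. -/
theorem nls_of_slab {γ T : ℝ} (hγ : 1 < γ) (hT : 0 < T) {ψ : ℝ × ℝ × ℝ → ℂ} (h : Sm T ψ)
    (hpde : ∀ z ∈ slab T, ds T dirT ψ z
      = Complex.I / 2 * (ds T dirA (ds T dirA ψ) z + ds T dirB (ds T dirB ψ) z)
        - Complex.I * nl γ (ψ z))
    (b : SlabL2 T ψ) (ba : SlabL2 T (ds T dirA ψ)) (bb : SlabL2 T (ds T dirB ψ)) :
    NLS γ T (clamp T ψ) (clamp T (ds T dirT ψ)) (clamp T (ds T dirA ψ)) (clamp T (ds T dirB ψ))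
      (clamp T (ds T dirA (ds T dirA ψ))) (clamp T (ds T dirB (ds T dirB ψ)))
      (clamp T (ds T dirA (ds T dirT ψ))) (clamp T (ds T dirB (ds T dirT ψ))) where
  cu := h.clamp_continuous hT
  cut := (h.dsm hT _).clamp_continuous hT
  cua := (h.dsm hT _).clamp_continuous hT
  cub := (h.dsm hT _).clamp_continuous hT
  cuaa := ((h.dsm hT _).dsm hT _).clamp_continuous hT
  cubb := ((h.dsm hT _).dsm hT _).clamp_continuous hT
  dt := fun t ht x => by
    rw [clamp_eq ⟨ht.1.le, ht.2.le⟩]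
    exact h.clamp_time ht x
  da := fun t a b => h.hasDerivAt_fst (clamp_mem hT t) a b
  db := fun t a b => h.hasDerivAt_snd (clamp_mem hT t) a b
  daa := fun t a b => (h.dsm hT _).hasDerivAt_fst (clamp_mem hT t) a b
  dbb := fun t a b => (h.dsm hT _).hasDerivAt_snd (clamp_mem hT t) a b
  cN := (nl_continuous hγ).comp (h.clamp_continuous hT)
  bu := b.l2Bdd
  bua := ba.l2Bdd
  bub := bb.l2Bdd
  pde := fun t _ x => hpde _ (mem_slab.2 (clamp_mem hT t))
  cta := ((h.dsm hT _).dsm hT _).clamp_continuous hT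
  ctb := ((h.dsm hT _).dsm hT _).clamp_continuous hT
  dta := fun t ht x => by
    have ht' : t ∈ Icc 0 T := ⟨ht.1.le, ht.2.le⟩
    rw [clamp_eq ht', ds_comm hT h _ _ (mem_slab.2 ht')]
    exact (h.dsm hT _).clamp_time ht x
  dtb := fun t ht x => by
    have ht' : t ∈ Icc 0 T := ⟨ht.1.le, ht.2.le⟩
    rw [clamp_eq ht', ds_comm hT h _ _ (mem_slab.2 ht')]
    exact (h.dsm hT _).clamp_time ht x
  dat := fun t a b => (h.dsm hT _).hasDerivAt_fst (clamp_mem hT t) a b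
  dbt := fun t a b => (h.dsm hT _).hasDerivAt_snd (clamp_mem hT t) a b

/-! ### The Madelung transform on the slab -/

/-- The amplitude `√ρ`. -/
def amp (R : ℝ × ℝ × ℝ → ℝ) (z : ℝ × ℝ × ℝ) : ℝ := √(R z)

/-- A component of the velocity. -/
def vel (R J : ℝ × ℝ × ℝ → ℝ) (z : ℝ × ℝ × ℝ) : ℝ := J z / R z

/-- The spatial Laplacian on the slab. -/
def slabLap {V : Type*} [NormedAddCommGroup V] [NormedSpace ℝ V] (T : ℝ) (F : ℝ × ℝ × ℝ → V)
    (z : ℝ × ℝ × ℝ) : V := ds T dirA (ds T dirA F) z + ds T dirB (ds T dirB F) z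

/-- The time derivative of the phase. -/
def pot (γ T : ℝ) (R J₀ J₁ : ℝ × ℝ × ℝ → ℝ) (z : ℝ × ℝ × ℝ) : ℝ :=
  1 / 2 * (slabLap T (amp R) z / amp R z)
    - 1 / 2 * (vel R J₀ z * vel R J₀ z + vel R J₁ z * vel R J₁ z) - R z ^ (γ - 1)

/-- The quantum hydrodynamic system on the slab, in coordinates. -/
structure Hydro (γ T : ℝ) (R J₀ J₁ : ℝ × ℝ × ℝ → ℝ) : Prop where
  sR : Sm T R
  sJ₀ : Sm T J₀
  sJ₁ : Sm T J₁
  pos : ∀ z ∈ slab T, 0 < R z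
  cont : ∀ z ∈ slab T, ds T dirT R z + (ds T dirA J₀ z + ds T dirB J₁ z) = 0
  mom₀ : ∀ z ∈ slab T, ds T dirT J₀ z + (ds T dirA (fun z => J₀ z * J₀ z / R z) z
      + ds T dirB (fun z => J₀ z * J₁ z / R z) z) + ds T dirA (fun z => pressure γ (R z)) z
    = 1 / 2 * R z * ds T dirA (fun z => slabLap T (amp R) z / amp R z) z
  mom₁ : ∀ z ∈ slab T, ds T dirT J₁ z + (ds T dirA (fun z => J₁ z * J₀ z / R z) z
      + ds T dirB (fun z => J₁ z * J₁ z / R z) z) + ds T dirB (fun z => pressure γ (R z)) z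
    = 1 / 2 * R z * ds T dirB (fun z => slabLap T (amp R) z / amp R z) z
  irrot : ∀ z ∈ slab T, ds T dirA J₁ z - ds T dirB J₀ z
    = 2 * (ds T dirA (amp R) z * ((amp R z)⁻¹ * J₁ z) - ds T dirB (amp R) z * ((amp R z)⁻¹ * J₀ z))

section Madelung

variable {γ T : ℝ} {R J₀ J₁ : ℝ × ℝ × ℝ → ℝ}

theorem ds_rpow (hT : 0 < T) (sR : Sm T R) (pos : ∀ z ∈ slab T, 0 < R z) (p : ℝ)
    (w : ℝ × ℝ × ℝ) {z : ℝ × ℝ × ℝ} (hz : z ∈ slab T) :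
    R z * ds T w (fun z => R z ^ p) z = p * R z ^ p * ds T w R z := by
  have h1 := (sR.hasFDerivWithinAt hz).rpow_const (p := p) (Or.inl (pos z hz).ne')
  rw [ds_of_hasFDerivWithinAt hT h1 hz w]
  simp only [FunLike.coe_smul, Pi.smul_apply, smul_eq_mul, ds]
  rw [Real.rpow_sub_one (pos z hz).ne']
  field_simp [(pos z hz).ne']

namespace Hydro

theorem amp_pos (h : Hydro γ T R J₀ J₁) {z : ℝ × ℝ × ℝ} (hz : z ∈ slab T) : 0 < amp R z := Real.sqrt_pos.2 (h.pos z hz)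

theorem sAmp (h : Hydro γ T R J₀ J₁) : Sm T (amp R) := ContDiffOn.sqrt h.sR fun z hz => (h.pos z hz).ne'

theorem amp_mul (h : Hydro γ T R J₀ J₁) {z : ℝ × ℝ × ℝ} (hz : z ∈ slab T) : R z = amp R z * amp R z :=
  (Real.mul_self_sqrt (h.pos z hz).le).symm

theorem sVel (h : Hydro γ T R J₀ J₁) {J : ℝ × ℝ × ℝ → ℝ} (hJ : Sm T J) : Sm T (vel R J) :=
  ContDiffOn.div hJ h.sR fun z hz => (h.pos z hz).ne'

theorem mul_vel (h : Hydro γ T R J₀ J₁) (J : ℝ × ℝ × ℝ → ℝ) {z : ℝ × ℝ × ℝ} (hz : z ∈ slab T) :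
    J z = R z * vel R J z := by
  rw [vel, mul_div_cancel₀ _ (h.pos z hz).ne']

theorem ds_density (h : Hydro γ T R J₀ J₁) (hT : 0 < T) (w : ℝ × ℝ × ℝ) {z : ℝ × ℝ × ℝ} (hz : z ∈ slab T) :
    ds T w R z = 2 * amp R z * ds T w (amp R) z := by
  have h1 := ds_congr (fun z hz => h.amp_mul hz : EqOn R (fun z => amp R z * amp R z) (slab T)) w hz
  rw [h1, ds_mul hT h.sAmp h.sAmp w hz]
  ring

theorem ds_momentum (h : Hydro γ T R J₀ J₁) (hT : 0 < T) {J : ℝ × ℝ × ℝ → ℝ} (hJ : Sm T J) (w : ℝ × ℝ × ℝ)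
    {z : ℝ × ℝ × ℝ} (hz : z ∈ slab T) :
    ds T w J z = R z * ds T w (vel R J) z + vel R J z * ds T w R z := by
  have h1 := ds_congr (fun z hz => h.mul_vel J hz : EqOn J (fun z => R z * vel R J z) (slab T)) w hz
  rw [h1, ds_mul hT h.sR (h.sVel hJ) w hz]

theorem ds_flux (h : Hydro γ T R J₀ J₁) (hT : 0 < T) {J J' : ℝ × ℝ × ℝ → ℝ} (hJ : Sm T J) (hJ' : Sm T J')
    (w : ℝ × ℝ × ℝ) {z : ℝ × ℝ × ℝ} (hz : z ∈ slab T) :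
    ds T w (fun z => J z * J' z / R z) z
      = J' z * ds T w (vel R J) z + vel R J z * ds T w J' z := by
  have h1 : EqOn (fun z => J z * J' z / R z) (fun z => J' z * vel R J z) (slab T) := fun z _ => by
    simp only [vel]; ring
  rw [ds_congr h1 w hz, ds_mul hT hJ' (h.sVel hJ) w hz]

/-- ∇p(ρ) = ρ∇f'(ρ) with enthalpy f'(ρ) = ρ^{γ-1}; this puts the pressure force into gradient form
after division by ρ. -/
theorem ds_pressure (h : Hydro γ T R J₀ J₁) (hγ : 1 < γ) (hT : 0 < T) (w : ℝ × ℝ × ℝ) {z : ℝ × ℝ × ℝ} (hz : z ∈ slab T) :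
    ds T w (fun z => pressure γ (R z)) z = R z * ds T w (fun z => R z ^ (γ - 1)) z := by
  have sp : ∀ p : ℝ, Sm T fun z => R z ^ p := fun p =>
    ContDiffOn.rpow_const_of_ne h.sR fun z hz => (h.pos z hz).ne'
  have h1 := ds_rpow hT h.sR h.pos γ w hz
  have h2 := ds_rpow hT h.sR h.pos (γ - 1) w hz
  have hR := (h.pos z hz).ne'
  simp only [pressure]
  rw [ds_const_mul hT _ (sp γ) w hz]
  have h3 : R z ^ γ = R z ^ (γ - 1) * R z := by rw [← Real.rpow_add_one hR, sub_add_cancel]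
  have h4 : ds T w (fun z => R z ^ γ) z = γ * R z ^ (γ - 1) * ds T w R z := by
    apply mul_left_cancel₀ hR
    rw [h1, h3]; ring
  rw [h4, h2]
  have : γ ≠ 0 := by linarith
  field_simp

/-- In curl(ρv) = ρ curl v + ∇ρ ∧ v the last term equals 2∇√ρ ∧ √ρ v, which is exactly the assumed
curl of J; what remains is ρ curl v = 0. -/
theorem curl_vel (h : Hydro γ T R J₀ J₁) (hT : 0 < T) {z : ℝ × ℝ × ℝ} (hz : z ∈ slab T) :
    ds T dirA (vel R J₁) z = ds T dirB (vel R J₀) z := by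
  have h1 := h.irrot z hz
  rw [h.ds_momentum hT h.sJ₁ _ hz, h.ds_momentum hT h.sJ₀ _ hz, h.ds_density hT _ hz,
    h.ds_density hT _ hz, h.mul_vel J₁ hz, h.mul_vel J₀ hz, h.amp_mul hz] at h1
  have hr := (h.amp_pos hz).ne'
  field_simp at h1
  have h2 : amp R z * (ds T dirA (vel R J₁) z - ds T dirB (vel R J₀) z) = 0 := by
    linear_combination h1
  exact sub_eq_zero.1 ((mul_eq_zero.1 h2).resolve_left hr)

theorem sQuot (h : Hydro γ T R J₀ J₁) (hT : 0 < T) : Sm T fun z => slabLap T (amp R) z / amp R z :=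
  ContDiffOn.div ((((h.sAmp).dsm hT _).dsm hT _).add (((h.sAmp).dsm hT _).dsm hT _)) h.sAmp
    fun _ hz => (h.amp_pos hz).ne'

theorem sPow (h : Hydro γ T R J₀ J₁) (p : ℝ) : Sm T fun z => R z ^ p :=
  ContDiffOn.rpow_const_of_ne h.sR fun z hz => (h.pos z hz).ne'

theorem sKin (h : Hydro γ T R J₀ J₁) : Sm T fun z => vel R J₀ z * vel R J₀ z + vel R J₁ z * vel R J₁ z :=
  ContDiffOn.add (ContDiffOn.mul (h.sVel h.sJ₀) (h.sVel h.sJ₀))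
    (ContDiffOn.mul (h.sVel h.sJ₁) (h.sVel h.sJ₁))

theorem sPot (h : Hydro γ T R J₀ J₁) (hT : 0 < T) : Sm T (pot γ T R J₀ J₁) :=
  ContDiffOn.sub (ContDiffOn.sub (contDiffOn_const.mul (h.sQuot hT)) (contDiffOn_const.mul h.sKin))
    (h.sPow _)

theorem ds_pot (h : Hydro γ T R J₀ J₁) (hT : 0 < T) (w : ℝ × ℝ × ℝ) {z : ℝ × ℝ × ℝ} (hz : z ∈ slab T) :
    ds T w (pot γ T R J₀ J₁) z = 1 / 2 * ds T w (fun z => slabLap T (amp R) z / amp R z) z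
      - (vel R J₀ z * ds T w (vel R J₀) z + vel R J₁ z * ds T w (vel R J₁) z)
      - ds T w (fun z => R z ^ (γ - 1)) z := by
  have s1 : Sm T fun z => 1 / 2 * (slabLap T (amp R) z / amp R z) :=
    contDiffOn_const.mul (h.sQuot hT)
  have s2 : Sm T fun z => 1 / 2 * (vel R J₀ z * vel R J₀ z + vel R J₁ z * vel R J₁ z) :=
    contDiffOn_const.mul h.sKin
  have e : pot γ T R J₀ J₁ = fun z => (1 / 2 * (slabLap T (amp R) z / amp R z)
    - 1 / 2 * (vel R J₀ z * vel R J₀ z + vel R J₁ z * vel R J₁ z)) - R z ^ (γ - 1) := rfl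
  have s3 : Sm T fun z => 1 / 2 * (slabLap T (amp R) z / amp R z)
    - 1 / 2 * (vel R J₀ z * vel R J₀ z + vel R J₁ z * vel R J₁ z) := ContDiffOn.sub s1 s2
  have m : ∀ {J : ℝ × ℝ × ℝ → ℝ}, Sm T J → Sm T fun z => vel R J z * vel R J z := fun hJ =>
    ContDiffOn.mul (h.sVel hJ) (h.sVel hJ)
  rw [e, ds_sub hT s3 (h.sPow _) w hz, ds_sub hT s1 s2 w hz, ds_const_mul hT _ (h.sQuot hT) w hz,
    ds_const_mul hT _ h.sKin w hz, ds_add hT (m h.sJ₀) (m h.sJ₁) w hz,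
    ds_mul hT (h.sVel h.sJ₀) (h.sVel h.sJ₀) w hz, ds_mul hT (h.sVel h.sJ₁) (h.sVel h.sJ₁) w hz]
  ring

/-- Bernoulli's law: momentum balance minus v₀ times continuity, divided by ρ, leaves ∂ₜv₀ + v·∇v₀
plus gradients, and curl v = 0 makes v·∇v₀ the derivative of ½|v|². -/
theorem dt_vel₀ (h : Hydro γ T R J₀ J₁) (hγ : 1 < γ) (hT : 0 < T) {z : ℝ × ℝ × ℝ} (hz : z ∈ slab T) :
    ds T dirT (vel R J₀) z = ds T dirA (pot γ T R J₀ J₁) z := by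
  have h1 := h.mom₀ z hz
  have h2 := h.cont z hz
  rw [h.ds_momentum hT h.sJ₀ dirT hz, h.ds_flux hT h.sJ₀ h.sJ₀ _ hz, h.ds_flux hT h.sJ₀ h.sJ₁ _ hz,
    h.ds_pressure hγ hT _ hz] at h1
  rw [h.ds_pot hT _ hz, h.curl_vel hT hz]
  have e0 := h.mul_vel J₀ hz
  have e1 := h.mul_vel J₁ hz
  apply mul_left_cancel₀ (h.pos z hz).ne'
  linear_combination h1 - vel R J₀ z * h2 - ds T dirA (vel R J₀) z * e0
    - ds T dirB (vel R J₀) z * e1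

theorem dt_vel₁ (h : Hydro γ T R J₀ J₁) (hγ : 1 < γ) (hT : 0 < T) {z : ℝ × ℝ × ℝ} (hz : z ∈ slab T) :
    ds T dirT (vel R J₁) z = ds T dirB (pot γ T R J₀ J₁) z := by
  have h1 := h.mom₁ z hz
  have h2 := h.cont z hz
  rw [h.ds_momentum hT h.sJ₁ dirT hz, h.ds_flux hT h.sJ₁ h.sJ₀ _ hz, h.ds_flux hT h.sJ₁ h.sJ₁ _ hz,
    h.ds_pressure hγ hT _ hz] at h1
  rw [h.ds_pot hT _ hz, ← h.curl_vel hT hz]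
  have e0 := h.mul_vel J₀ hz
  have e1 := h.mul_vel J₁ hz
  apply mul_left_cancel₀ (h.pos z hz).ne'
  linear_combination h1 - vel R J₁ z * h2 - ds T dirA (vel R J₁) z * e0
    - ds T dirB (vel R J₁) z * e1

end Hydro

end Madelung

/-- A closed one-form on the slab, given by its coefficients, is exact. -/
theorem exists_primitive {T : ℝ} (hT : 0 < T) {m v₀ v₁ : ℝ × ℝ × ℝ → ℝ} (sm : Sm T m)
    (s₀ : Sm T v₀) (s₁ : Sm T v₁) (h₀ : ∀ z ∈ slab T, ds T dirT v₀ z = ds T dirA m z)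
    (h₁ : ∀ z ∈ slab T, ds T dirT v₁ z = ds T dirB m z)
    (h₂ : ∀ z ∈ slab T, ds T dirA v₁ z = ds T dirB v₀ z) :
    ∃ θ : ℝ × ℝ × ℝ → ℝ, Sm T θ ∧ ∀ z ∈ slab T,
      ds T dirT θ z = m z ∧ ds T dirA θ z = v₀ z ∧ ds T dirB θ z = v₁ z := by
  let pt : ℝ × ℝ × ℝ →L[ℝ] ℝ := ContinuousLinearMap.fst ℝ ℝ (ℝ × ℝ)
  let pa : ℝ × ℝ × ℝ →L[ℝ] ℝ :=
    (ContinuousLinearMap.fst ℝ ℝ ℝ).comp (ContinuousLinearMap.snd ℝ ℝ (ℝ × ℝ))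
  let pb : ℝ × ℝ × ℝ →L[ℝ] ℝ :=
    (ContinuousLinearMap.snd ℝ ℝ ℝ).comp (ContinuousLinearMap.snd ℝ ℝ (ℝ × ℝ))
  let form : ℝ × ℝ × ℝ → ℝ × ℝ × ℝ →L[ℝ] ℝ := fun z => m z • pt + v₀ z • pa + v₁ z • pb
  have sform : ContDiffOn ℝ ∞ form (slab T) :=
    ((ContDiffOn.smul sm contDiffOn_const).add (ContDiffOn.smul s₀ contDiffOn_const)).add
      (ContDiffOn.smul s₁ contDiffOn_const)
  have expand : ∀ (F : ℝ × ℝ × ℝ → ℝ) (z x : ℝ × ℝ × ℝ), fderivWithin ℝ F (slab T) z x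
      = x.1 * ds T dirT F z + x.2.1 * ds T dirA F z + x.2.2 * ds T dirB F z := by
    intro F z x
    have e : x = x.1 • dirT + x.2.1 • dirA + x.2.2 • dirB := by
      ext <;> simp [dirT, dirA, dirB]
    conv_lhs => rw [e]
    simp only [map_add, map_smul, smul_eq_mul, ds]
  have hdform : ∀ z ∈ slab T, ∀ x y, fderivWithin ℝ form (slab T) z x y
      = fderivWithin ℝ m (slab T) z x * y.1 + fderivWithin ℝ v₀ (slab T) z x * y.2.1
        + fderivWithin ℝ v₁ (slab T) z x * y.2.2 := by
    intro z hz x y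
    have d := (((sm.hasFDerivWithinAt hz).smul_const pt).add
      ((s₀.hasFDerivWithinAt hz).smul_const pa)).add ((s₁.hasFDerivWithinAt hz).smul_const pb)
    have d' : HasFDerivWithinAt form _ (slab T) z := d
    rw [d'.fderivWithin (slab_uniqueDiffOn hT z hz)]
    simp [pt, pa, pb]
  -- Poincaré's lemma on the convex slab: by the three compatibility relations the derivative of the
  -- form is symmetric.
  obtain ⟨θ, hθ⟩ := (slab_convex T).exists_forall_hasFDerivWithinAt_of_fderivWithin_symmetric
    (sform.differentiableOn (by simp)) (fun z hz x _ y _ => by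
      rw [hdform z hz, hdform z hz]
      simp only [expand]
      rw [h₀ z hz, h₁ z hz, h₂ z hz]
      ring)
  refine ⟨θ, ?_, fun z hz => ?_⟩
  · refine (contDiffOn_infty_iff_fderivWithin (slab_uniqueDiffOn hT)).2
      ⟨fun z hz => (hθ z hz).differentiableWithinAt, sform.congr fun z hz => ?_⟩
    exact (hθ z hz).fderivWithin (slab_uniqueDiffOn hT z hz)
  · refine ⟨?_, ?_, ?_⟩ <;> rw [ds_of_hasFDerivWithinAt hT (hθ z hz) hz] <;>
      simp [form, pt, pa, pb, dirT, dirA, dirB]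

/-! ### Derivatives of an amplitude times a phase factor. -/

theorem ds_mul_cexp {T : ℝ} (hT : 0 < T) {F : ℝ × ℝ × ℝ → ℂ} {θ : ℝ × ℝ × ℝ → ℝ} (sF : Sm T F)
    (sθ : Sm T θ) (w : ℝ × ℝ × ℝ) {z : ℝ × ℝ × ℝ} (hz : z ∈ slab T) :
    ds T w (fun z => F z * Complex.exp (Complex.I * θ z)) z
      = (ds T w F z + Complex.I * ds T w θ z * F z) * Complex.exp (Complex.I * θ z) := by
  have h1 := Complex.ofRealCLM.hasFDerivAt.comp_hasFDerivWithinAt z (sθ.hasFDerivWithinAt hz)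
  have h2 := (sF.hasFDerivWithinAt hz).mul ((h1.const_mul Complex.I).cexp)
  refine (ds_of_hasFDerivWithinAt hT h2 hz w).trans ?_
  simp [ds]
  ring

theorem Sm.mul_cexp {T : ℝ} {F : ℝ × ℝ × ℝ → ℂ} {θ : ℝ × ℝ × ℝ → ℝ} (sF : Sm T F)
    (sθ : Sm T θ) : Sm T fun z => F z * Complex.exp (Complex.I * θ z) :=
  ContDiffOn.mul sF
    (contDiffOn_const.mul (Complex.ofRealCLM.contDiff.comp_contDiffOn sθ)).cexp

theorem Sm.ofReal {T : ℝ} {F : ℝ × ℝ × ℝ → ℝ} (sF : Sm T F) : Sm T fun z => (F z : ℂ) :=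
  Complex.ofRealCLM.contDiff.comp_contDiffOn sF

theorem norm_mul_cexp_sq (x y θ : ℝ) :
    ‖((x : ℂ) + Complex.I * y) * Complex.exp (Complex.I * θ)‖ ^ 2 = x ^ 2 + y ^ 2 := by
  rw [norm_mul, mul_comm Complex.I (θ : ℂ), Complex.norm_exp_ofReal_mul_I, mul_one,
    Complex.sq_norm, Complex.normSq_apply]
  simp
  ring

/-! ### The wave function of a hydrodynamic solution -/

/-- The wave function `ψ` of a solution of the hydrodynamic system. -/
structure IsWave (γ T : ℝ) (R J₀ J₁ : ℝ × ℝ × ℝ → ℝ) (ψ : ℝ × ℝ × ℝ → ℂ) : Prop where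
  smooth : Sm T ψ
  pde : ∀ z ∈ slab T, ds T dirT ψ z
    = Complex.I / 2 * (ds T dirA (ds T dirA ψ) z + ds T dirB (ds T dirB ψ) z)
      - Complex.I * nl γ (ψ z)
  sq : ∀ z ∈ slab T, ‖ψ z‖ ^ 2 = R z
  sq_dirA : ∀ z ∈ slab T,
    ‖ds T dirA ψ z‖ ^ 2 = ds T dirA (amp R) z ^ 2 + (amp R z * vel R J₀ z) ^ 2
  sq_dirB : ∀ z ∈ slab T,
    ‖ds T dirB ψ z‖ ^ 2 = ds T dirB (amp R) z ^ 2 + (amp R z * vel R J₁ z) ^ 2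
  sq_dirT : ∀ z ∈ slab T,
    ‖ds T dirT ψ z‖ ^ 2 = ds T dirT (amp R) z ^ 2 + (amp R z * pot γ T R J₀ J₁ z) ^ 2

theorem ds_amp_cexp {T : ℝ} (hT : 0 < T) {r θ v : ℝ × ℝ × ℝ → ℝ} (sr : Sm T r) (sθ : Sm T θ)
    (w : ℝ × ℝ × ℝ) (hv : ∀ z ∈ slab T, ds T w θ z = v z) {z : ℝ × ℝ × ℝ} (hz : z ∈ slab T) :
    ds T w (fun z => (r z : ℂ) * Complex.exp (Complex.I * θ z)) z
      = (((ds T w r z : ℝ) : ℂ) + Complex.I * ((r z * v z : ℝ) : ℂ)) * Complex.exp (Complex.I * θ z) := by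
  rw [ds_mul_cexp hT sr.ofReal sθ w hz, ds_ofReal hT sr w hz, hv z hz]
  push_cast
  ring

theorem ds_ds_amp_cexp {T : ℝ} (hT : 0 < T) {r θ v : ℝ × ℝ × ℝ → ℝ} (sr : Sm T r) (sθ : Sm T θ)
    (sv : Sm T v) (w : ℝ × ℝ × ℝ) (hv : ∀ z ∈ slab T, ds T w θ z = v z) {z : ℝ × ℝ × ℝ}
    (hz : z ∈ slab T) :
    ds T w (ds T w (fun z => (r z : ℂ) * Complex.exp (Complex.I * θ z))) z
      = (((ds T w (ds T w r) z : ℝ) : ℂ) + Complex.I * ((2 * v z * ds T w r z + r z * ds T w v z : ℝ) : ℂ)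
          - r z * v z ^ 2) * Complex.exp (Complex.I * θ z) := by
  have srv : Sm T fun z => r z * v z := ContDiffOn.mul sr sv
  have s1 : Sm T fun z => ((ds T w r z : ℝ) : ℂ) := (sr.dsm hT w).ofReal
  have s2 : Sm T fun z => Complex.I * ((r z * v z : ℝ) : ℂ) := contDiffOn_const.mul srv.ofReal
  have s3 : Sm T fun z => ((ds T w r z : ℝ) : ℂ) + Complex.I * ((r z * v z : ℝ) : ℂ) :=
    ContDiffOn.add s1 s2
  rw [ds_congr (fun z hz => ds_amp_cexp hT sr sθ w hv hz) w hz, ds_mul_cexp hT s3 sθ w hz,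
    ds_add hT s1 s2 w hz, ds_const_mul hT _ srv.ofReal w hz, ds_ofReal hT (sr.dsm hT w) w hz,
    ds_ofReal hT srv w hz, ds_mul hT sr sv w hz, hv z hz]
  push_cast
  linear_combination (r z * v z ^ 2 : ℂ) * Complex.exp (Complex.I * θ z) * Complex.I_sq

/-- ψ is √ρ e^{iθ} with θ a primitive of the form (`pot`, v₀, v₁). After removing the phase, the
equation splits into two real ones: the imaginary part is the definition of `pot` times √ρ, the real
part is the continuity equation divided by 2√ρ. -/
theorem Hydro.exists_wave {γ T : ℝ} (hγ : 1 < γ) (hT : 0 < T) {R J₀ J₁ : ℝ × ℝ × ℝ → ℝ}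
    (h : Hydro γ T R J₀ J₁) : ∃ ψ, IsWave γ T R J₀ J₁ ψ := by
  obtain ⟨θ, sθ, hθ⟩ := exists_primitive hT (h.sPot hT) (h.sVel h.sJ₀) (h.sVel h.sJ₁)
    (fun z hz => h.dt_vel₀ hγ hT hz) (fun z hz => h.dt_vel₁ hγ hT hz)
    (fun z hz => h.curl_vel hT hz)
  have sr := h.sAmp
  have eT := fun z hz => ds_amp_cexp hT sr sθ dirT (fun z hz => (hθ z hz).1) (z := z) hz
  have eA := fun z hz => ds_amp_cexp hT sr sθ dirA (fun z hz => (hθ z hz).2.1) (z := z) hz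
  have eB := fun z hz => ds_amp_cexp hT sr sθ dirB (fun z hz => (hθ z hz).2.2) (z := z) hz
  have hsq : ∀ z ∈ slab T, ‖(amp R z : ℂ) * Complex.exp (Complex.I * θ z)‖ ^ 2 = R z := by
    intro z hz
    have := norm_mul_cexp_sq (amp R z) 0 (θ z)
    simp only [Complex.ofReal_zero, mul_zero, add_zero] at this
    rw [this, h.amp_mul hz]; ring
  refine ⟨fun z => (amp R z : ℂ) * Complex.exp (Complex.I * θ z), sr.ofReal.mul_cexp sθ,
    fun z hz => ?_, hsq, fun z hz => ?_, fun z hz => ?_, fun z hz => ?_⟩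
  · rw [eT z hz, ds_ds_amp_cexp hT sr sθ (h.sVel h.sJ₀) dirA (fun z hz => (hθ z hz).2.1) hz,
      ds_ds_amp_cexp hT sr sθ (h.sVel h.sJ₁) dirB (fun z hz => (hθ z hz).2.2) hz, nl,
      norm_rpow_eq_sq_rpow, hsq z hz]
    have hr := (h.amp_pos hz).ne'
    have hp : amp R z * pot γ T R J₀ J₁ z = 1 / 2 * slabLap T (amp R) z
        - 1 / 2 * amp R z * (vel R J₀ z ^ 2 + vel R J₁ z ^ 2) - amp R z * R z ^ (γ - 1) := by
      rw [pot]; field_simp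
    have hc := h.cont z hz
    rw [h.ds_momentum hT h.sJ₀ _ hz, h.ds_momentum hT h.sJ₁ _ hz, h.ds_density hT dirT hz,
      h.ds_density hT dirA hz, h.ds_density hT dirB hz, h.amp_mul hz] at hc
    -- The continuity equation in terms of √ρ and the velocity, with one factor √ρ cancelled.
    have hc2 : 2 * ds T dirT (amp R) z + (2 * vel R J₀ z * ds T dirA (amp R) z
        + amp R z * ds T dirA (vel R J₀) z) + (2 * vel R J₁ z * ds T dirB (amp R) z
        + amp R z * ds T dirB (vel R J₁) z) = 0 := by
      apply mul_left_cancel₀ hr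
      linear_combination hc
    rw [hp, slabLap]
    have hc3 := congrArg (fun x : ℝ => (x : ℂ)) hc2
    push_cast at hc3 ⊢
    generalize Complex.exp (Complex.I * θ z) = e
    linear_combination (1 / 2 * e) * hc3 - (1 / 2 * e * (2 * (vel R J₀ z : ℂ)
        * ((ds T dirA (amp R) z : ℝ) : ℂ) + (amp R z : ℂ) * ((ds T dirA (vel R J₀) z : ℝ) : ℂ)
        + (2 * (vel R J₁ z : ℂ) * ((ds T dirB (amp R) z : ℝ) : ℂ)
        + (amp R z : ℂ) * ((ds T dirB (vel R J₁) z : ℝ) : ℂ)))) * Complex.I_sq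
  · rw [eA z hz, norm_mul_cexp_sq]
  · rw [eB z hz, norm_mul_cexp_sq]
  · rw [eT z hz, norm_mul_cexp_sq]

/-! ### Coordinates on the Euclidean plane -/

/-- The plane in coordinates. -/
def planeEquiv : Plane ≃L[ℝ] ℝ × ℝ :=
  (PiLp.continuousLinearEquiv 2 ℝ fun _ : Fin 2 => ℝ).trans (ContinuousLinearEquiv.finTwoArrow ℝ ℝ)

theorem planeEquiv_apply (y : Plane) : planeEquiv y = (y 0, y 1) := rfl

theorem planeEquiv_measurePreserving : MeasurePreserving planeEquiv :=
  (volume_preserving_finTwoArrow ℝ).comp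
    (EuclideanSpace.volume_preserving_symm_measurableEquiv_toLp (Fin 2))

theorem lintegral_planeEquiv (f : ℝ × ℝ → ℝ≥0∞) : ∫⁻ y, f (planeEquiv y) = ∫⁻ x, f x :=
  planeEquiv_measurePreserving.lintegral_comp_emb
    planeEquiv.toHomeomorph.measurableEmbedding f

/-- The space directions. -/
def dirS (i : Fin 2) : ℝ × ℝ × ℝ := (0, planeEquiv (EuclideanSpace.single i 1))

theorem dirS_zero : dirS 0 = dirA := by simp [dirS, dirA, planeEquiv_apply]

theorem dirS_one : dirS 1 = dirB := by simp [dirS, dirB, planeEquiv_apply]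

section Coordinates

variable {V : Type*} [NormedAddCommGroup V] [NormedSpace ℝ V] {T t : ℝ}

theorem Sm.contDiff_plane {F : ℝ × ℝ × ℝ → V} (h : Sm T F) (ht : t ∈ Icc 0 T) :
    ContDiff ℝ ∞ fun y : Plane => F (t, planeEquiv y) :=
  ContDiffOn.comp_contDiff h (contDiff_const.prodMk planeEquiv.contDiff) fun _ => mem_slab.2 ht

theorem Sm.pd_eq {F : ℝ × ℝ × ℝ → ℝ} (h : Sm T F) (ht : t ∈ Icc 0 T) (i : Fin 2) (x : Plane) :
    pd i (fun y => F (t, planeEquiv y)) x = ds T (dirS i) F (t, planeEquiv x) := by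
  have h1 : HasFDerivAt (fun y : Plane => (t, planeEquiv y))
      ((0 : Plane →L[ℝ] ℝ).prod (planeEquiv : Plane →L[ℝ] ℝ × ℝ)) x :=
    (hasFDerivAt_const t x).prodMk planeEquiv.hasFDerivAt
  have h2 := (h.hasFDerivWithinAt (mem_slab.2 ht : (t, planeEquiv x) ∈ slab T)).comp
    (s := univ) x h1.hasFDerivWithinAt (fun _ _ => mem_slab.2 ht)
  have h3 := (h2.hasFDerivAt univ_mem).fderiv
  rw [pd]
  refine (congrArg (fun L : Plane →L[ℝ] ℝ => L (EuclideanSpace.single i 1)) h3).trans ?_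
  rfl

theorem gradient_apply (f : Plane → ℝ) (x : Plane) (i : Fin 2) : gradient f x i = pd i f x := by
  have h := InnerProductSpace.toDual_symm_apply (𝕜 := ℝ) (x := EuclideanSpace.single i (1 : ℝ))
    (y := fderiv ℝ f x)
  rw [EuclideanSpace.inner_single_right, one_mul] at h
  exact h

theorem norm_sq_plane (v : Plane) : ‖v‖ ^ 2 = v 0 ^ 2 + v 1 ^ 2 := by
  rw [EuclideanSpace.norm_sq_eq]; simp

theorem Sm.laplacian_eq (hT : 0 < T) {F : ℝ × ℝ × ℝ → ℝ} (h : Sm T F) (ht : t ∈ Icc 0 T)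
    (x : Plane) :
    Laplacian.laplacian (fun y : Plane => F (t, planeEquiv y)) x
      = slabLap T F (t, planeEquiv x) := by
  have hc := h.contDiff_plane ht
  have hd : DifferentiableAt ℝ (fderiv ℝ fun y : Plane => F (t, planeEquiv y)) x :=
    ((hc.fderiv_right (m := ∞) (by simp)).differentiable (by simp)) x
  rw [InnerProductSpace.laplacian_eq_iteratedFDeriv_orthonormalBasis _
    (EuclideanSpace.basisFun (Fin 2) ℝ)]
  have key : ∀ i : Fin 2, iteratedFDeriv ℝ 2 (fun y : Plane => F (t, planeEquiv y)) x
      ![EuclideanSpace.basisFun (Fin 2) ℝ i, EuclideanSpace.basisFun (Fin 2) ℝ i]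
      = ds T (dirS i) (ds T (dirS i) F) (t, planeEquiv x) := by
    intro i
    rw [iteratedFDeriv_two_apply, ← (h.dsm hT (dirS i)).pd_eq ht i x]
    simp only [← h.pd_eq ht i]
    have h1 := hd.hasFDerivAt.clm_apply (hasFDerivAt_const (EuclideanSpace.single i (1 : ℝ)) x)
    have h2 : fderiv ℝ (pd i fun y : Plane => F (t, planeEquiv y)) x = _ := h1.fderiv
    rw [show pd i (fun y => pd i (fun y => F (t, planeEquiv y)) y) x
      = fderiv ℝ (pd i fun y : Plane => F (t, planeEquiv y)) x (EuclideanSpace.single i 1) from rfl,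
      h2]
    simp
  simp only [Fin.sum_univ_two, key, dirS_zero, dirS_one]
  rfl

end Coordinates

/-! ### Hydrodynamic solutions in coordinates -/

/-- The density in coordinates. -/
def slabDensity (ρ : ℝ → Plane → ℝ) (z : ℝ × ℝ × ℝ) : ℝ := ρ z.1 (planeEquiv.symm z.2)

/-- The momentum in coordinates. -/
def slabMomentum (J : ℝ → Plane → Plane) (i : Fin 2) (z : ℝ × ℝ × ℝ) : ℝ :=
  J z.1 (planeEquiv.symm z.2) i

theorem slabDensity_apply (ρ : ℝ → Plane → ℝ) (t : ℝ) (y : Plane) :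
    slabDensity ρ (t, planeEquiv y) = ρ t y := by simp [slabDensity]

theorem slabMomentum_apply (J : ℝ → Plane → Plane) (i : Fin 2) (t : ℝ) (y : Plane) :
    slabMomentum J i (t, planeEquiv y) = J t y i := by simp [slabMomentum]

theorem amp_slabDensity_apply (ρ : ℝ → Plane → ℝ) (t : ℝ) (y : Plane) :
    amp (slabDensity ρ) (t, planeEquiv y) = sqrtDensity ρ t y := by
  rw [amp, slabDensity_apply, sqrtDensity]

theorem exists_planeEquiv (z : ℝ × ℝ × ℝ) : ∃ y : Plane, z = (z.1, planeEquiv y) :=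
  ⟨planeEquiv.symm z.2, by simp⟩

theorem contDiffOn_comp_planeEquiv {V : Type*} [NormedAddCommGroup V] [NormedSpace ℝ V] {T : ℝ}
    {F : ℝ × Plane → V} (h : ContDiffOn ℝ ∞ F (Icc 0 T ×ˢ univ)) :
    Sm T fun z => F (z.1, planeEquiv.symm z.2) :=
  h.comp (contDiff_fst.prodMk (planeEquiv.symm.contDiff.comp contDiff_snd)).contDiffOn
    fun _ hz => ⟨hz.1, mem_univ _⟩

namespace IsSmoothSolution

variable {γ T : ℝ} {ρ : ℝ → Plane → ℝ} {J : ℝ → Plane → Plane}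

theorem sm_density (h : IsSmoothSolution γ T ρ J) : Sm T (slabDensity ρ) :=
  contDiffOn_comp_planeEquiv h.smooth_density

theorem sm_momentum (h : IsSmoothSolution γ T ρ J) (i : Fin 2) : Sm T (slabMomentum J i) :=
  (EuclideanSpace.proj (𝕜 := ℝ) i).contDiff.comp_contDiffOn
    (contDiffOn_comp_planeEquiv h.smooth_momentum)

theorem slabDensity_pos (h : IsSmoothSolution γ T ρ J) : ∀ z ∈ slab T, 0 < slabDensity ρ z :=
  fun z hz => h.density_pos z.1 hz.1 _

theorem sm_amp (h : IsSmoothSolution γ T ρ J) : Sm T (amp (slabDensity ρ)) :=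
  ContDiffOn.sqrt h.sm_density fun z hz => (h.slabDensity_pos z hz).ne'

theorem laplacian_sqrtDensity (h : IsSmoothSolution γ T ρ J) (hT : 0 < T) {t : ℝ}
    (ht : t ∈ Icc 0 T) (x : Plane) :
    Laplacian.laplacian (sqrtDensity ρ t) x = slabLap T (amp (slabDensity ρ)) (t, planeEquiv x) := by
  rw [← h.sm_amp.laplacian_eq hT ht]
  simp only [amp_slabDensity_apply]

theorem derivWithin_momentum (h : IsSmoothSolution γ T ρ J) (hT : 0 < T) {t : ℝ}
    (ht : t ∈ Icc 0 T) (x : Plane) (i : Fin 2) :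
    derivWithin (fun s => J s x) (Icc 0 T) t i
      = ds T dirT (slabMomentum J i) (t, planeEquiv x) := by
  have s := contDiffOn_comp_planeEquiv h.smooth_momentum
  have h1 := s.hasDerivWithinAt_time ht (planeEquiv x)
  simp only [ContinuousLinearEquiv.symm_apply_apply] at h1
  have h2 := (EuclideanSpace.proj (𝕜 := ℝ) i).hasFDerivAt.comp_hasDerivWithinAt t h1
  have h3 := (h.sm_momentum i).hasDerivWithinAt_time ht (planeEquiv x)
  simp only [slabMomentum_apply] at h3
  rw [h1.derivWithin (uniqueDiffOn_Icc hT t ht)]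
  have h4 := (uniqueDiffOn_Icc hT t ht).eq_deriv _ h2 h3
  exact h4

theorem hydro (h : IsSmoothSolution γ T ρ J) (hT : 0 < T) :
    Hydro γ T (slabDensity ρ) (slabMomentum J 0) (slabMomentum J 1) := by
  have sR := h.sm_density
  have sJ := h.sm_momentum
  have pos := h.slabDensity_pos
  have sA := h.sm_amp
  have sFl : ∀ i j, Sm T fun z => slabMomentum J i z * slabMomentum J j z / slabDensity ρ z :=
    fun i j => ContDiffOn.div (ContDiffOn.mul (sJ i) (sJ j)) sR fun z hz => (pos z hz).ne'
  have sP : Sm T fun z => pressure γ (slabDensity ρ z) :=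
    contDiffOn_const.mul (ContDiffOn.rpow_const_of_ne sR fun z hz => (pos z hz).ne')
  have sQ : Sm T fun z => slabLap T (amp (slabDensity ρ)) z / amp (slabDensity ρ) z :=
    ContDiffOn.div (((sA.dsm hT _).dsm hT _).add ((sA.dsm hT _).dsm hT _)) sA
      fun z hz => (Real.sqrt_pos.2 (pos z hz)).ne'
  have mom : ∀ i : Fin 2, ∀ z ∈ slab T, ds T dirT (slabMomentum J i) z
      + (ds T dirA (fun z => slabMomentum J i z * slabMomentum J 0 z / slabDensity ρ z) z
        + ds T dirB (fun z => slabMomentum J i z * slabMomentum J 1 z / slabDensity ρ z) z)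
      + ds T (dirS i) (fun z => pressure γ (slabDensity ρ z)) z
      = 1 / 2 * slabDensity ρ z
        * ds T (dirS i) (fun z => slabLap T (amp (slabDensity ρ)) z / amp (slabDensity ρ) z) z := by
    rintro i ⟨t, z⟩ hz
    obtain ⟨y, hy⟩ := exists_planeEquiv (t, z)
    have ht : t ∈ Icc 0 T := mem_slab.1 hz
    -- Each component of the vector equation is rewritten through functions on the slab, where every
    -- Euclidean partial derivative becomes a directional derivative.
    have e := congrArg (fun v : Plane => v i) (h.momentum_eq t ht y)
    simp only [PiLp.add_apply, PiLp.smul_apply, smul_eq_mul, gradient_apply, tensorDiv,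
      Fin.sum_univ_two, Matrix.of_apply, h.derivWithin_momentum hT ht,
      h.laplacian_sqrtDensity hT ht] at e
    simp only [← slabDensity_apply ρ t, ← slabMomentum_apply J _ t,
      ← amp_slabDensity_apply ρ t] at e
    rw [(sFl i 0).pd_eq ht, (sFl i 1).pd_eq ht, sP.pd_eq ht, sQ.pd_eq ht, dirS_zero, dirS_one] at e
    rw [hy]
    exact e
  refine ⟨sR, sJ 0, sJ 1, pos, ?_, ?_, ?_, ?_⟩
  · rintro ⟨t, z⟩ hz
    obtain ⟨y, hy⟩ := exists_planeEquiv (t, z)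
    have ht : t ∈ Icc 0 T := mem_slab.1 hz
    have e := h.continuity_eq t ht y
    have h1 := sR.hasDerivWithinAt_time ht (planeEquiv y)
    simp only [div, Fin.sum_univ_two] at e
    simp only [← slabDensity_apply ρ, ← slabMomentum_apply J _ t] at e
    rw [(sJ 0).pd_eq ht, (sJ 1).pd_eq ht, h1.derivWithin (uniqueDiffOn_Icc hT t ht), dirS_zero,
      dirS_one] at e
    rw [hy]
    exact e
  · intro z hz
    have := mom 0 z hz
    rwa [dirS_zero] at this
  · intro z hz
    have := mom 1 z hz
    rwa [dirS_one] at this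
  · rintro ⟨t, z⟩ hz
    obtain ⟨y, hy⟩ := exists_planeEquiv (t, z)
    have ht : t ∈ Icc 0 T := mem_slab.1 hz
    have e := h.irrotational t ht y
    simp only [curl, wedge, gradient_apply, Lam, PiLp.smul_apply, smul_eq_mul] at e
    have e2 : sqrtDensity ρ t = fun y => amp (slabDensity ρ) (t, planeEquiv y) := by
      ext y; rw [amp_slabDensity_apply]
    rw [e2] at e
    simp only [← slabMomentum_apply J _ t] at e
    rw [(sJ 0).pd_eq ht, (sJ 1).pd_eq ht, sA.pd_eq ht, sA.pd_eq ht, dirS_zero, dirS_one] at e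
    rw [hy]
    exact e

theorem deriv_internalEnergy (hγ : 1 < γ) {r : ℝ} (hr : 0 < r) :
    deriv (internalEnergy γ) r = r ^ (γ - 1) := by
  have h1 : internalEnergy γ =ᶠ[𝓝 r] fun s => s ^ γ / γ := by
    filter_upwards [eventually_gt_nhds hr] with s hs
    exact internalEnergy_eq hγ hs
  rw [h1.deriv_eq, ((Real.hasDerivAt_rpow_const (Or.inl hr.ne')).div_const γ).deriv]
  have : γ ≠ 0 := by linarith
  field_simp

theorem norm_sq_Lam (h : IsSmoothSolution γ T ρ J) (hT : 0 < T) {t : ℝ} (ht : t ∈ Icc 0 T)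
    (x : Plane) : ‖Lam ρ J t x‖ ^ 2
      = (amp (slabDensity ρ) (t, planeEquiv x)
          * vel (slabDensity ρ) (slabMomentum J 0) (t, planeEquiv x)) ^ 2
        + (amp (slabDensity ρ) (t, planeEquiv x)
          * vel (slabDensity ρ) (slabMomentum J 1) (t, planeEquiv x)) ^ 2 := by
  have hy := h.hydro hT
  have hz : (t, planeEquiv x) ∈ slab T := mem_slab.2 ht
  have hr := (hy.amp_pos hz).ne'
  have key : ∀ i, (Lam ρ J t x) i = amp (slabDensity ρ) (t, planeEquiv x)
      * vel (slabDensity ρ) (slabMomentum J i) (t, planeEquiv x) := by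
    intro i
    rw [Lam, PiLp.smul_apply, smul_eq_mul, ← amp_slabDensity_apply, ← slabMomentum_apply,
      hy.mul_vel (slabMomentum J i) hz, hy.amp_mul hz]
    field_simp
  rw [norm_sq_plane, key, key]

/-- The Madelung potential is Bernoulli's function with the opposite sign, λ = -√ρ ∂ₜθ, so the
integrand of I is the squared modulus of ∂ₜψ = (∂ₜ√ρ + i√ρ ∂ₜθ)e^{iθ}. -/
theorem functionalI_density (h : IsSmoothSolution γ T ρ J) (hγ : 1 < γ) (hT : 0 < T) {t : ℝ}
    (ht : t ∈ Icc 0 T) (x : Plane) {ψ : ℝ × ℝ × ℝ → ℂ}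
    (hψ : IsWave γ T (slabDensity ρ) (slabMomentum J 0) (slabMomentum J 1) ψ) :
    lam γ ρ J t x ^ 2 + dtSqrtDensity T ρ t x ^ 2 = ‖ds T dirT ψ (t, planeEquiv x)‖ ^ 2 := by
  have hz : (t, planeEquiv x) ∈ slab T := mem_slab.2 ht
  have hr := ((h.hydro hT).amp_pos hz).ne'
  rw [hψ.sq_dirT _ hz]
  have e1 : dtSqrtDensity T ρ t x = ds T dirT (amp (slabDensity ρ)) (t, planeEquiv x) := by
    have h1 := h.sm_amp.hasDerivWithinAt_time ht (planeEquiv x)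
    simp only [amp_slabDensity_apply] at h1
    exact h1.derivWithin (uniqueDiffOn_Icc hT t ht)
  have e2 : lam γ ρ J t x = -(amp (slabDensity ρ) (t, planeEquiv x)
      * pot γ T (slabDensity ρ) (slabMomentum J 0) (slabMomentum J 1) (t, planeEquiv x)) := by
    rw [lam, h.laplacian_sqrtDensity hT ht, h.norm_sq_Lam hT ht,
      deriv_internalEnergy hγ (h.density_pos t ht x), ← amp_slabDensity_apply,
      ← slabDensity_apply ρ t x, pot]
    field_simp
    ring
  rw [e1, e2]
  ring

/-- |∇ψ|² = |∇√ρ|² + |√ρ v|², and √ρ v = Λ. -/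
theorem energyDensity_eq (h : IsSmoothSolution γ T ρ J) (hγ : 1 < γ) (hT : 0 < T) {t : ℝ}
    (ht : t ∈ Icc 0 T) (x : Plane) {ψ : ℝ × ℝ × ℝ → ℂ}
    (hψ : IsWave γ T (slabDensity ρ) (slabMomentum J 0) (slabMomentum J 1) ψ) :
    energyDensity γ ρ J t x = nlsEnergy γ (ψ (t, planeEquiv x)) (ds T dirA ψ (t, planeEquiv x))
      (ds T dirB ψ (t, planeEquiv x)) := by
  have hz : (t, planeEquiv x) ∈ slab T := mem_slab.2 ht
  have e2 : sqrtDensity ρ t = fun y => amp (slabDensity ρ) (t, planeEquiv y) := by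
    ext y; rw [amp_slabDensity_apply]
  rw [energyDensity, nlsEnergy, hψ.sq _ hz, hψ.sq_dirA _ hz, hψ.sq_dirB _ hz, h.norm_sq_Lam hT ht,
    norm_sq_plane, gradient_apply, gradient_apply, e2, h.sm_amp.pd_eq ht, h.sm_amp.pd_eq ht,
    dirS_zero, dirS_one, internalEnergy_eq hγ (h.density_pos t ht x), slabDensity_apply]
  ring

end IsSmoothSolution

/-! ### Integrals of hydrodynamic quantities -/

theorem integrable_of_lintegral_le {g : ℝ × ℝ → ℝ} (cg : Continuous g) (g0 : ∀ x, 0 ≤ g x)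
    {B : ℝ≥0} (h : ∫⁻ x, ENNReal.ofReal (g x) ≤ B) : Integrable g ∧ ∫ x, g x ≤ B := by
  have i : Integrable g := by
    refine ⟨cg.aestronglyMeasurable, ?_⟩
    rw [hasFiniteIntegral_iff_ofReal (Eventually.of_forall g0)]
    exact h.trans_lt ENNReal.coe_lt_top
  refine ⟨i, ?_⟩
  rw [← ofReal_integral_eq_lintegral_ofReal i (Eventually.of_forall g0)] at h
  exact (ENNReal.ofReal_le_iff_le_toReal ENNReal.coe_ne_top).1 h

theorem integrable_sq_of_lintegral_le {f : ℝ × ℝ → ℂ} (cf : Continuous f) {B : ℝ≥0}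
    (h : ∫⁻ x, ENNReal.ofReal (‖f x‖ ^ 2) ≤ B) :
    Integrable (fun x => ‖f x‖ ^ 2) ∧ ∫ x, ‖f x‖ ^ 2 ≤ B :=
  integrable_of_lintegral_le (cf.norm.pow 2) (fun _ => sq_nonneg _) h

theorem Sm.continuous_slice {T t : ℝ} {F : ℝ × ℝ × ℝ → ℂ} (h : Sm T F) (ht : t ∈ Icc 0 T) :
    Continuous fun x : ℝ × ℝ => F (t, x) := by
  have h1 : Continuous fun x : ℝ × ℝ => (t, x) := by fun_prop
  exact (ContDiffOn.continuousOn h).comp_continuous h1 fun _ => mem_slab.2 ht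

theorem half_sq_le_nlsEnergy {γ : ℝ} (hγ : 0 < γ) (z za zb : ℂ) :
    ‖za‖ ^ 2 ≤ 2 * nlsEnergy γ z za zb ∧ ‖zb‖ ^ 2 ≤ 2 * nlsEnergy γ z za zb := by
  have h1 : 0 ≤ (‖z‖ ^ 2) ^ γ / γ := by positivity
  rw [nlsEnergy]
  constructor <;> nlinarith [sq_nonneg ‖za‖, sq_nonneg ‖zb‖]

theorem nlsEnergy_nonneg {γ : ℝ} (hγ : 1 < γ) (z za zb : ℂ) : 0 ≤ nlsEnergy γ z za zb := by
  have : 0 < γ := by linarith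
  rw [nlsEnergy]
  positivity

theorem continuous_nlsEnergy {γ : ℝ} (hγ : 1 < γ) {f fa fb : ℝ × ℝ → ℂ} (cf : Continuous f)
    (ca : Continuous fa) (cb : Continuous fb) :
    Continuous fun x => nlsEnergy γ (f x) (fa x) (fb x) :=
  (continuous_const.mul ((ca.norm.pow 2).add (cb.norm.pow 2))).add
    (((cf.norm.pow 2).rpow_const fun _ => Or.inr (by linarith)).div_const γ)

namespace IsSmoothSolution

variable {γ T : ℝ} {ρ : ℝ → Plane → ℝ} {J : ℝ → Plane → Plane} {ψ : ℝ × ℝ × ℝ → ℂ}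

theorem mass_eq {t : ℝ} (ht : t ∈ Icc 0 T)
    (hψ : IsWave γ T (slabDensity ρ) (slabMomentum J 0) (slabMomentum J 1) ψ) :
    mass ρ t = ∫⁻ x, ENNReal.ofReal (‖ψ (t, x)‖ ^ 2) := by
  rw [mass, ← lintegral_planeEquiv]
  simp only [hψ.sq _ (mem_slab.2 ht), slabDensity_apply]

theorem energy_eq (h : IsSmoothSolution γ T ρ J) (hγ : 1 < γ) (hT : 0 < T) {t : ℝ}
    (ht : t ∈ Icc 0 T)
    (hψ : IsWave γ T (slabDensity ρ) (slabMomentum J 0) (slabMomentum J 1) ψ) :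
    energy γ ρ J t = ∫⁻ x, ENNReal.ofReal
      (nlsEnergy γ (ψ (t, x)) (ds T dirA ψ (t, x)) (ds T dirB ψ (t, x))) := by
  rw [energy, ← lintegral_planeEquiv]
  simp only [h.energyDensity_eq hγ hT ht _ hψ]

theorem functionalI_eq (h : IsSmoothSolution γ T ρ J) (hγ : 1 < γ) (hT : 0 < T) {t : ℝ}
    (ht : t ∈ Icc 0 T)
    (hψ : IsWave γ T (slabDensity ρ) (slabMomentum J 0) (slabMomentum J 1) ψ) :
    functionalI γ T ρ J t = ∫⁻ x, ENNReal.ofReal (‖ds T dirT ψ (t, x)‖ ^ 2) := by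
  rw [functionalI, ← lintegral_planeEquiv]
  simp only [h.functionalI_density hγ hT ht _ hψ]

/-- The uniform bounds on mass and energy are turned into L² bounds on ψ and its gradient; they
supply the a priori finiteness used in the absorption arguments and never enter the constant. -/
theorem slabL2 (h : IsSmoothSolution γ T ρ J) (hγ : 1 < γ) (hT : 0 < T)
    (hψ : IsWave γ T (slabDensity ρ) (slabMomentum J 0) (slabMomentum J 1) ψ) :
    SlabL2 T ψ ∧ SlabL2 T (ds T dirA ψ) ∧ SlabL2 T (ds T dirB ψ) := by
  obtain ⟨K, hK⟩ := h.finite_mass_energy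
  have hE : ∀ t ∈ Icc 0 T, ∀ f : ℝ × ℝ → ℝ, (∀ x, f x ≤ 2 *
      nlsEnergy γ (ψ (t, x)) (ds T dirA ψ (t, x)) (ds T dirB ψ (t, x))) →
      ∫⁻ x, ENNReal.ofReal (f x) ≤ (2 * K : ℝ≥0) := by
    intro t ht f hf
    have h1 := (hK t ht).2
    rw [h.energy_eq hγ hT ht hψ] at h1
    refine (lintegral_mono fun x => ENNReal.ofReal_le_ofReal (hf x)).trans ?_
    simp only [ENNReal.ofReal_mul zero_le_two]
    rw [lintegral_const_mul' _ _ ENNReal.ofReal_ne_top, ENNReal.coe_mul]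
    simpa using mul_le_mul_right h1 2
  refine ⟨⟨K, fun t ht => ?_⟩, ⟨(2 * K : ℝ≥0), fun t ht => ?_⟩, ⟨(2 * K : ℝ≥0), fun t ht => ?_⟩⟩
  · refine integrable_sq_of_lintegral_le (hψ.smooth.continuous_slice ht) ?_
    rw [← mass_eq ht hψ]
    exact (hK t ht).1
  · exact integrable_sq_of_lintegral_le ((hψ.smooth.dsm hT _).continuous_slice ht)
      (hE t ht _ fun x => (half_sq_le_nlsEnergy (by linarith) _ _ _).1)
  · exact integrable_sq_of_lintegral_le ((hψ.smooth.dsm hT _).continuous_slice ht)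
      (hE t ht _ fun x => (half_sq_le_nlsEnergy (by linarith) _ _ _).2)

end IsSmoothSolution

end QHD

end

/-! ### Assembly of the estimate. -/

theorem mainTheorem12 (γ : ℝ) (hγ₁ : 1 < γ) (hγ₂ : γ ≤ 2) (T : ℝ) (hT : 0 < T)
    (M₀ E₀ : ℝ≥0) :
    ∃ C : ℝ≥0, ∀ (ρ : ℝ → QHD.Plane → ℝ) (J : ℝ → QHD.Plane → QHD.Plane),
      QHD.IsSmoothSolution γ T ρ J →
      QHD.mass ρ 0 ≤ M₀ → QHD.energy γ ρ J 0 ≤ E₀ →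
      ∀ t ∈ Set.Icc 0 T,
        QHD.functionalI γ T ρ J t ≤ C * QHD.functionalI γ T ρ J 0 := by
  obtain ⟨C, hC, hb⟩ := QHD.exists_nls_bound hγ₁ hγ₂ hT M₀.2 E₀.2
  refine ⟨C.toNNReal, fun ρ J h hM hE t ht => ?_⟩
  obtain ⟨ψ, hψ⟩ := (h.hydro hT).exists_wave hγ₁ hT
  obtain ⟨b, ba, bb⟩ := h.slabL2 hγ₁ hT hψ
  have hnls := QHD.nls_of_slab hγ₁ hT hψ.smooth hψ.pde b ba bb
  have h0 : (0 : ℝ) ∈ Set.Icc 0 T := Set.left_mem_Icc.2 hT.le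
  have sT := hψ.smooth.dsm hT QHD.dirT
  -- Needed when I(0) = ∞: in the extended nonnegative reals 0 · ∞ = 0, so the right side is
  -- infinite only because C is not zero.
  have hC0 : C.toNNReal ≠ 0 := by
    rw [Ne, Real.toNNReal_eq_zero]
    linarith
  by_cases hI : QHD.functionalI γ T ρ J 0 = ⊤
  · rw [hI, ENNReal.mul_top (by exact_mod_cast hC0)]
    exact le_top
  have hI0 : Integrable fun x => ‖QHD.ds T QHD.dirT ψ (0, x)‖ ^ 2 := by
    have h1 := h.functionalI_eq hγ₁ hT h0 hψ
    refine (QHD.integrable_sq_of_lintegral_le (B := (QHD.functionalI γ T ρ J 0).toNNReal)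
      (sT.continuous_slice h0) ?_).1
    rw [← h1, ENNReal.coe_toNNReal hI]
  have hM' : ∫ x, ‖QHD.clamp T ψ 0 x‖ ^ 2 ≤ (M₀ : ℝ) := by
    simp only [QHD.clamp_eq h0]
    refine (QHD.integrable_sq_of_lintegral_le (hψ.smooth.continuous_slice h0) ?_).2
    rwa [← QHD.IsSmoothSolution.mass_eq h0 hψ]
  have hE' : ∫ x, QHD.nlsEnergy γ (QHD.clamp T ψ 0 x) (QHD.clamp T (QHD.ds T QHD.dirA ψ) 0 x)
      (QHD.clamp T (QHD.ds T QHD.dirB ψ) 0 x) ≤ (E₀ : ℝ) := by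
    simp only [QHD.clamp_eq h0]
    refine (QHD.integrable_of_lintegral_le
      (QHD.continuous_nlsEnergy hγ₁ (hψ.smooth.continuous_slice h0)
        ((hψ.smooth.dsm hT _).continuous_slice h0) ((hψ.smooth.dsm hT _).continuous_slice h0))
      (fun x => QHD.nlsEnergy_nonneg hγ₁ _ _ _) ?_).2
    rwa [← h.energy_eq hγ₁ hT h0 hψ]
  have hfin := hb _ _ _ _ _ _ _ _ hnls hM' hE' (by simpa only [QHD.clamp_eq h0] using hI0) t ht
  simp only [QHD.clamp_eq h0, QHD.clamp_eq ht] at hfin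
  rw [h.functionalI_eq hγ₁ hT ht hψ, h.functionalI_eq hγ₁ hT h0 hψ,
    ← ofReal_integral_eq_lintegral_ofReal hfin.1 (Filter.Eventually.of_forall fun x => sq_nonneg _),
    ← ofReal_integral_eq_lintegral_ofReal hI0 (Filter.Eventually.of_forall fun x => sq_nonneg _)]
  refine (ENNReal.ofReal_le_ofReal hfin.2).trans (le_of_eq ?_)
  rw [ENNReal.ofReal_mul (by linarith)]
  rfl
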